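/- **Model.** Base stations (MBSs) form a homogeneous Poisson point process $\Phi_m=\{X_j\}$ of density $\lambda_m>0$ in $\mathbb R^2$; the typical user is at the origin, and $r_j=\|X_j\|$. Given $\Phi_m$, the links are independent, and each carries three independent marks: * its blockage state: LOS with probability $P_L(r_j)=e^{-\beta r_j}$, NLOS with probability $P_N(r_j)=1-P_L(r_j)$, where $\beta>0$; its path loss factor is $L_j=C_Lr_j^{-\alpha_L}$ if LOS and $L_j=C_Nr_j^{-\alpha_N}$ if NLOS ($C_L,C_N>0$, $\alpha_L>0$, $\alpha_N>2$); * its horizontal gain $D_j$, equal to $d_1=M_tM_r$, $d_2=M_tm_r$, $d_3=m_tM_r$, $d_4=m_tm_r$ with probabilities $p_1=c_tc_r$, $p_2=c_t(1-c_r)$, $p_3=(1-c_t)c_r$, $p_4=(1-c_t)(1-c_r)$, where $c_t=\varphi_t/2\pi$, $c_r=\varphi_r/2\pi$ with beamwidths $\varphi_t,\varphi_r\in[0,2\pi]$, main-lobe gains $M_t,M_r>0$ and side-lobe gains $m_t,m_r\ge0$; * its Nakagami-$m$ fading power $|h_j|^2\sim\Gamma(m,1/m)$ (shape $m$, scale $1/m$),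 $m\ge1$ an integer. The vertical gain at horizontal distance $R$ is, on the linear scale, $$G(R,\theta_{\rm tilt})=10^{-\frac1{10}\min\left(12\left(\frac{\arctan(H_{\rm eff}/R)-\theta_{\rm tilt}}{\theta_{\rm 3dB}}\right)^2,\ {\rm SLL}_{\rm dB}\right)},\qquad H_{\rm eff}=H_{\rm BS}-H_u\ge0,\ \theta_{\rm tilt}\ge0,\ \theta_{\rm 3dB}>0,\ {\rm SLL}_{\rm dB}\ge0 .$$ The user is served by the MBS with the strongest average received power $P_mL_j$ ($P_m>0$); index $0$ refers to this MBS. An NLOS MBS at distance $r$ is equivalent to a LOS MBS at distance $R_{eq}(r)=(C_L/C_N)^{1/\alpha_L}r^{\alpha_N/\alpha_L}$; the inverse map is $R_{eq}^{-1}(r)=\mu r^{\kappa}$ with $\mu=(C_N/C_L)^{1/\alpha_N}$ and $\kappa=\alpha_L/\alpha_N$. The serving distance $r_{0,0}$ is the distance of the serving MBS if it is LOS, and its equivalent LOS distance if it is NLOS. The main beams of the serving link are aligned, $D_0=M_tM_r$, and its vertical gain is evaluated at the serving distance, $G_0=G(r_{0,0},\theta_{\rm tilt})$. With noise power $\sigma^2>0$,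 $${\rm SINR}=\frac{P_mL_0D_0G_0|h_0|^2}{I_{\Phi_m}+\sigma^2},\qquad I_{\Phi_m}=\sum_{j\ne0}P_mL_jD_j\,G(r_j,\theta_{\rm tilt})\,|h_j|^2 .$$ **Theorem.** Almost surely the serving MBS is unique and $I_{\Phi_m}<\infty$. The serving distance has density, for $r>0$, $$\begin{aligned}f_R(r)=\;&2\pi\lambda_m\left(re^{-\beta r}+\mu^2\kappa r^{2\kappa-1}\left(1-e^{-\beta R_{eq}^{-1}(r)}\right)\right)\exp\left(-\tfrac{2\pi\lambda_m}{\beta^2}\left(1-(1+\beta r)e^{-\beta r}\right)\right)\\&\times\exp\left(-\tfrac{2\pi\lambda_m}{\beta^2}\left(\tfrac{\beta^2(R_{eq}^{-1}(r))^2}{2}+(\beta R_{eq}^{-1}(r)+1)e^{-\beta R_{eq}^{-1}(r)}-1\right)\right).\end{aligned}$$ For $z\ge0$, given $r_{0,0}=\rho$, the interference has the conditional Laplace transform $E[e^{-zI_{\Phi_m}}\mid r_{0,0}=\rho]=\mathcal L_\rho(z)$, where $$\mathcal L_\rho(z)=\prod_{i=1}^4\exp\left(-C_i\int_\rho^\infty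 F_L(z,x,d_i)\,xP_L(x)\,dx\right)\prod_{i=1}^4\exp\left(-C_i\int_{R_{eq}^{-1}(\rho)}^\infty F_N(z,x,d_i)\,xP_N(x)\,dx\right),$$ $$C_i=2\pi\lambda_mp_i,\qquad F_w(z,x,d)=1-\left(1+\frac{zP_mC_w\,d\,G(x,\theta_{\rm tilt})}{m\,x^{\alpha_w}}\right)^{-m},\quad w\in\{L,N\};$$ for each $\rho>0$ these integrals converge and $\mathcal L_\rho$ is smooth on $(0,\infty)$. For every threshold $\gamma>0$, $$\Pr\{{\rm SINR}>\gamma\}=\int_0^\infty e^{-ms\sigma^2}\sum_{k=0}^{m-1}\sum_{\ell=0}^kC_{k,\ell}\,\frac{d^\ell\mathcal L_\rho}{dz^\ell}(ms)\,f_R(\rho)\,d\rho,$$ where the integrand is integrable, and $$s=\frac{\gamma\rho^{\alpha_L}}{P_mC_LD_0\,G(\rho,\theta_{\rm tilt})},\qquad C_{k,\ell}=(-1)^\ell\,(ms)^\ell\,\frac{(ms\sigma^2)^{k-\ell}}{k!}\binom k\ell .$$ -/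

import Mathlib

open MeasureTheory ProbabilityTheory Set
open scoped ENNReal NNReal

noncomputable section

/-! ### Poisson point processes and independent marking -/

/-- The random counting measure of an enumerated random point configuration. -/
def pointMeasure {Ω E : Type*} [MeasurableSpace E] (X : ℕ → Ω → E) (ω : Ω) : Measure E :=
  Measure.sum fun j => Measure.dirac (X j ω)

/-- The points `X 0, X 1, …` form a Poisson point process with intensity measure `Λ`: the number of
points in a set of finite intensity is Poisson distributed, and the numbers of points in disjoint
sets are independent. (If `Λ` is infinite there are almost surely infinitely many points, so that
they can be enumerated by `ℕ`; the enumeration is arbitrary.) -/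
structure IsPoissonProcess {Ω E : Type*} [MeasurableSpace Ω] [MeasurableSpace E]
    (X : ℕ → Ω → E) (Λ : Measure E) (μ : Measure Ω) : Prop where
  measurable : ∀ j, Measurable (X j)
  count_law : ∀ B : Set E, MeasurableSet B → Λ B ≠ ∞ →
    μ.map (fun ω => pointMeasure X ω B) =
      (poissonMeasure (Λ B).toNNReal).map (fun k : ℕ => (k : ℝ≥0∞))
  count_indep : ∀ (n : ℕ) (B : Fin n → Set E), (∀ i, MeasurableSet (B i)) →
    (∀ i j, i ≠ j → Disjoint (B i) (B j)) →
    iIndepFun (fun i ω => pointMeasure X ω (B i)) μ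

/-- `M j` is a random mark attached to the point `X j`; conditionally on all the points, the marks
are independent, and the mark of a point at `x` has law `κ x`. -/
structure IsIndependentMarking {Ω E Y : Type*} [MeasurableSpace Ω] [MeasurableSpace E]
    [MeasurableSpace Y] (X : ℕ → Ω → E) (M : ℕ → Ω → Y) (κ : E → Measure Y) (μ : Measure Ω) :
    Prop where
  measurable : ∀ j, Measurable (M j)
  joint_law : ∀ (n : ℕ) (A : Set (ℕ → E)), MeasurableSet A →
    ∀ S : ℕ → Set Y, (∀ j, MeasurableSet (S j)) →
      μ ({ω | (fun j => X j ω) ∈ A} ∩ {ω | ∀ j < n, M j ω ∈ S j}) =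
        ∫⁻ ω in {ω | (fun j => X j ω) ∈ A}, ∏ j ∈ Finset.range n, κ (X j ω) (S j) ∂μ

/-! ### The network -/

/-- Parameters of the homogeneous cellular network. All gains (`Mt`, …) are on the linear scale,
`SLL` is in dB, all angles are in radians. -/
structure Network where
  /-- density of the base stations -/
  lam : ℝ
  /-- blockage intensity -/
  β : ℝ
  /-- LOS / NLOS path loss constants and exponents -/
  CL : ℝ
  CN : ℝ
  αL : ℝ
  αN : ℝ
  /-- transmission power -/
  Pm : ℝ
  /-- noise power `σ²` -/
  noise : ℝ
  /-- Nakagami fading parameter -/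
  m : ℕ
  /-- main-lobe and side-lobe horizontal gains and beamwidths, transmitter and receiver -/
  Mt : ℝ
  mt : ℝ
  Mr : ℝ
  mr : ℝ
  φt : ℝ
  φr : ℝ
  /-- antenna heights of the base stations and of the users -/
  HBS : ℝ
  Hu : ℝ
  /-- vertical 3dB beamwidth and side-lobe level (in dB) -/
  θ3dB : ℝ
  SLL : ℝ
  lam_pos : 0 < lam
  β_pos : 0 < β
  CL_pos : 0 < CL
  CN_pos : 0 < CN
  αL_pos : 0 < αL
  αN_gt : 2 < αN
  Pm_pos : 0 < Pm
  noise_pos : 0 < noise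
  m_pos : 0 < m
  Mt_pos : 0 < Mt
  mt_nonneg : 0 ≤ mt
  Mr_pos : 0 < Mr
  mr_nonneg : 0 ≤ mr
  φt_mem : φt ∈ Icc 0 (2 * Real.pi)
  φr_mem : φr ∈ Icc 0 (2 * Real.pi)
  height_le : Hu ≤ HBS
  θ3dB_pos : 0 < θ3dB
  SLL_nonneg : 0 ≤ SLL

/-- Mark of a base station: is its link to the typical user LOS, the state (one of four) of its
horizontal antenna gain, and its fading power `|h|²`. -/
abbrev LinkMark : Type := Bool × Fin 4 × ℝ

namespace Network

/-- Probability that a link of length `r` is LOS. -/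
def PL (N : Network) (r : ℝ) : ℝ := Real.exp (-(N.β * r))

/-- Probability that a link of length `r` is NLOS. -/
def PN (N : Network) (r : ℝ) : ℝ := 1 - N.PL r

/-- The path loss factor `C r^(-α)` of a LOS (`true`) or NLOS (`false`) link of length `r`. -/
def pathGain (N : Network) (los : Bool) (r : ℝ) : ℝ :=
  if los then N.CL * r ^ (-N.αL) else N.CN * r ^ (-N.αN)

/-- The vertical gain on the linear scale, at horizontal distance `x` and for tilt `θ`. -/
def G (N : Network) (x θ : ℝ) : ℝ :=
  (10 : ℝ) ^ (-(min (12 * ((Real.arctan ((N.HBS - N.Hu) / x) - θ) / N.θ3dB) ^ 2) N.SLL) / 10)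

def ct (N : Network) : ℝ := N.φt / (2 * Real.pi)

def cr (N : Network) : ℝ := N.φr / (2 * Real.pi)

/-- The four values of the total horizontal gain. -/
def d (N : Network) : Fin 4 → ℝ := ![N.Mt * N.Mr, N.Mt * N.mr, N.mt * N.Mr, N.mt * N.mr]

/-- The probabilities of the four values of the total horizontal gain. -/
def p (N : Network) : Fin 4 → ℝ :=
  ![N.ct * N.cr, N.ct * (1 - N.cr), (1 - N.ct) * N.cr, (1 - N.ct) * (1 - N.cr)]

/-- Law of the LOS indicator of a link of length `r`. -/
def losLaw (N : Network) (r : ℝ) : Measure Bool :=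
  ENNReal.ofReal (N.PL r) • Measure.dirac true + ENNReal.ofReal (N.PN r) • Measure.dirac false

/-- Law of the state of the horizontal gain of an interfering link. -/
def gainLaw (N : Network) : Measure (Fin 4) := ∑ i, ENNReal.ofReal (N.p i) • Measure.dirac i

/-- Law of the mark of a base station at `x`: the three components are independent, and the fading
power has the Gamma law with shape `m` and scale `1/m` (that is, rate `m`). -/
def markLaw (N : Network) (x : EuclideanSpace ℝ (Fin 2)) : Measure LinkMark :=
  (N.losLaw ‖x‖).prod (N.gainLaw.prod (gammaMeasure N.m N.m))

/-- Distance at which a LOS link has the path loss of a NLOS link of length `r`. -/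
def Req (N : Network) (r : ℝ) : ℝ := (N.CL / N.CN) ^ (1 / N.αL) * r ^ (N.αN / N.αL)

/-- `(C_N / C_L)^(1/α_N)`. -/
def mu (N : Network) : ℝ := (N.CN / N.CL) ^ (1 / N.αN)

/-- `α_L / α_N`. -/
def kappa (N : Network) : ℝ := N.αL / N.αN

/-- The inverse function of `Req`. -/
def ReqInv (N : Network) (r : ℝ) : ℝ := N.mu * r ^ N.kappa

/-! ### The random quantities seen by the typical user at the origin

`X j` is the position and `M j` the mark of the `j`-th base station. -/

/-- Path loss factor of the link to base station `j`. -/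
def linkGain {Ω : Type*} (N : Network) (X : ℕ → Ω → EuclideanSpace ℝ (Fin 2))
    (M : ℕ → Ω → LinkMark) (j : ℕ) (ω : Ω) : ℝ :=
  N.pathGain (M j ω).1 ‖X j ω‖

/-- Base station `j` provides the strongest average received power `P_m L`. -/
def IsServing {Ω : Type*} (N : Network) (X : ℕ → Ω → EuclideanSpace ℝ (Fin 2))
    (M : ℕ → Ω → LinkMark) (ω : Ω) (j : ℕ) : Prop :=
  ∀ i, N.Pm * N.linkGain X M i ω ≤ N.Pm * N.linkGain X M j ω

/-- Index of the serving base station (almost surely there is exactly one). -/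
def serving {Ω : Type*} (N : Network) (X : ℕ → Ω → EuclideanSpace ℝ (Fin 2))
    (M : ℕ → Ω → LinkMark) (ω : Ω) : ℕ :=
  sInf {j | N.IsServing X M ω j}

/-- Equivalent LOS distance of base station `j`: its distance if its link is LOS, and `Req` of its
distance if its link is NLOS. -/
def eqDist {Ω : Type*} (N : Network) (X : ℕ → Ω → EuclideanSpace ℝ (Fin 2))
    (M : ℕ → Ω → LinkMark) (j : ℕ) (ω : Ω) : ℝ :=
  if (M j ω).1 then ‖X j ω‖ else N.Req ‖X j ω‖

/-- The serving distance `r_{0,0}`: the equivalent LOS distance of the serving base station. -/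
def servingDist {Ω : Type*} (N : Network) (X : ℕ → Ω → EuclideanSpace ℝ (Fin 2))
    (M : ℕ → Ω → LinkMark) (ω : Ω) : ℝ :=
  N.eqDist X M (N.serving X M ω) ω

/-- Interfering power `P_m L D_j G_j |h_j|²` of base station `j`; the serving one contributes `0`. -/
def interferenceTerm {Ω : Type*} (N : Network) (X : ℕ → Ω → EuclideanSpace ℝ (Fin 2))
    (M : ℕ → Ω → LinkMark) (θ : ℝ) (ω : Ω) (j : ℕ) : ℝ :=
  if j = N.serving X M ω then 0
  else N.Pm * N.linkGain X M j ω * N.d (M j ω).2.1 * N.G ‖X j ω‖ θ * (M j ω).2.2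

/-- Total interference. -/
def interference {Ω : Type*} (N : Network) (X : ℕ → Ω → EuclideanSpace ℝ (Fin 2))
    (M : ℕ → Ω → LinkMark) (θ : ℝ) (ω : Ω) : ℝ :=
  ∑' j, N.interferenceTerm X M θ ω j

/-- Horizontal gain `D_0` of the serving link: main beams aligned. -/
def D0 (N : Network) : ℝ := N.Mt * N.Mr

/-- The received SINR. The vertical gain of the serving link is taken at the serving distance, that
is, at the position of the equivalent LOS base station. -/
def sinr {Ω : Type*} (N : Network) (X : ℕ → Ω → EuclideanSpace ℝ (Fin 2))
    (M : ℕ → Ω → LinkMark) (θ : ℝ) (ω : Ω) : ℝ :=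
  N.Pm * N.linkGain X M (N.serving X M ω) ω * N.D0 * N.G (N.servingDist X M ω) θ
      * (M (N.serving X M ω) ω).2.2
    / (N.interference X M θ ω + N.noise)

/-! ### The explicit expressions -/

/-- Density of the serving distance. -/
def fR (N : Network) (r : ℝ) : ℝ :=
  2 * Real.pi * N.lam * (r * Real.exp (-(N.β * r))
      + N.mu ^ 2 * N.kappa * r ^ (2 * N.kappa - 1) * (1 - Real.exp (-(N.β * N.ReqInv r))))
    * Real.exp (-(2 * Real.pi * N.lam / N.β ^ 2) * (1 - (1 + N.β * r) * Real.exp (-(N.β * r))))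
    * Real.exp (-(2 * Real.pi * N.lam / N.β ^ 2) * (N.β ^ 2 * N.ReqInv r ^ 2 / 2
        + (N.β * N.ReqInv r + 1) * Real.exp (-(N.β * N.ReqInv r)) - 1))

/-- `F_L`. -/
def FL (N : Network) (θ z x d : ℝ) : ℝ :=
  1 - 1 / (1 + z * N.Pm * N.CL * d * N.G x θ / (N.m * x ^ N.αL)) ^ N.m

/-- `F_N`. -/
def FN (N : Network) (θ z x d : ℝ) : ℝ :=
  1 - 1 / (1 + z * N.Pm * N.CN * d * N.G x θ / (N.m * x ^ N.αN)) ^ N.m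

/-- `C_i = 2 π λ p_i`. -/
def C (N : Network) (i : Fin 4) : ℝ := 2 * Real.pi * N.lam * N.p i

/-- Laplace transform at `z` of the interference, given the serving distance `ρ`. -/
def laplace (N : Network) (θ ρ z : ℝ) : ℝ :=
  (∏ i, Real.exp (-N.C i * ∫ x in Ioi ρ, N.FL θ z x (N.d i) * x * N.PL x))
    * ∏ i, Real.exp (-N.C i * ∫ x in Ioi (N.ReqInv ρ), N.FN θ z x (N.d i) * x * N.PN x)

/-- `s = γ ρ^α_L / (P_m C_L D_0 G_0)` with `G_0 = G(ρ, θ)`. -/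
def s (N : Network) (θ γ ρ : ℝ) : ℝ :=
  γ * ρ ^ N.αL / (N.Pm * N.CL * N.D0 * N.G ρ θ)

/-- The coefficients `C_{k,l}`, as functions of `s`. -/
def coeff (N : Network) (k l : ℕ) (s : ℝ) : ℝ :=
  (-1) ^ l * (N.m * s) ^ l * (N.m * s * N.noise) ^ (k - l) / (k.factorial : ℝ) * (k.choose l : ℝ)

/-- Integrand of the coverage probability. -/
def coverageIntegrand (N : Network) (θ γ ρ : ℝ) : ℝ :=
  Real.exp (-(N.m * N.s θ γ ρ * N.noise))
    * (∑ k ∈ Finset.range N.m, ∑ l ∈ Finset.range (k + 1),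
        N.coeff k l (N.s θ γ ρ) * iteratedDeriv l (N.laplace θ ρ) (N.m * N.s θ γ ρ))
    * N.fR ρ

end Network

end

open Filter Topology

/-! ### The probability generating functional of a Poisson process -/

/-- The infinite product of the values of a `[0,1]`-valued function along a sequence. -/
noncomputable def infProd {S : Type*} (g : S → ℝ≥0∞) (y : ℕ → S) : ℝ≥0∞ :=
  ⨅ n, ∏ j ∈ Finset.range n, g (y j)

lemma antitone_prod_range {S : Type*} {g : S → ℝ≥0∞} (hg : ∀ x, g x ≤ 1) (y : ℕ → S) :
    Antitone fun n => ∏ j ∈ Finset.range n, g (y j) :=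
  antitone_nat_of_succ_le fun _ => by
    rw [Finset.prod_range_succ]
    exact mul_le_of_le_one_right' (hg _)

lemma tendsto_infProd {S : Type*} {g : S → ℝ≥0∞} (hg : ∀ x, g x ≤ 1) (y : ℕ → S) :
    Tendsto (fun n => ∏ j ∈ Finset.range n, g (y j)) atTop (𝓝 (infProd g y)) :=
  tendsto_atTop_iInf (antitone_prod_range hg y)

lemma infProd_le_one {S : Type*} (g : S → ℝ≥0∞) (y : ℕ → S) : infProd g y ≤ 1 :=
  (iInf_le _ 0).trans (by simp)

lemma measurable_infProd {S Ω : Type*} [MeasurableSpace S] [MeasurableSpace Ω] {g : S → ℝ≥0∞}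
    (hg : Measurable g) {Y : ℕ → Ω → S} (hY : ∀ j, Measurable (Y j)) :
    Measurable fun ω => infProd g fun j => Y j ω :=
  Measurable.iInf fun _ => Finset.measurable_fun_prod _ fun j _ => hg.comp (hY j)

lemma infProd_eq_prod {S : Type*} {g : S → ℝ≥0∞} (hg : ∀ x, g x ≤ 1) {y : ℕ → S} (J : Finset ℕ)
    (hJ : ∀ j ∉ J, g (y j) = 1) : infProd g y = ∏ j ∈ J, g (y j) := by
  refine tendsto_nhds_unique (tendsto_infProd hg y) (tendsto_atTop_of_eventually_const
    (i₀ := J.sup id + 1) fun n hn => ?_)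
  symm
  refine Finset.prod_subset (fun j hj => ?_) fun j _ hj => hJ j hj
  have : j ≤ J.sup id := Finset.le_sup (f := id) hj
  simp; omega

lemma infProd_iInf {S : Type*} {g : ℕ → S → ℝ≥0∞} (hg : ∀ k x, g k x ≤ 1)
    (hanti : ∀ x, Antitone fun k => g k x) (y : ℕ → S) :
    infProd (fun x => ⨅ k, g k x) y = ⨅ k, infProd (g k) y := by
  unfold infProd
  rw [iInf_comm]
  congr 1; ext n
  refine tendsto_nhds_unique (ENNReal.tendsto_finsetProd_of_ne_top _
    (fun j _ => tendsto_atTop_iInf (hanti (y j)))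
    fun j _ => ((iInf_le (fun k => g k (y j)) 0).trans_lt ((hg 0 (y j)).trans_lt ENNReal.one_lt_top)).ne)
    (tendsto_atTop_iInf fun k l hkl => Finset.prod_le_prod' fun j _ => hanti (y j) hkl)

lemma lintegral_pow_poissonMeasure (r : ℝ≥0) {q : ℝ≥0∞} (hq : q ≤ 1) :
    ∫⁻ k, q ^ k ∂(poissonMeasure r) = ENNReal.ofReal (Real.exp (-(r * (1 - q).toReal))) := by
  have hq' : q ≠ ∞ := (hq.trans_lt ENNReal.one_lt_top).ne
  obtain ⟨x, rfl⟩ : ∃ x : ℝ≥0, q = x := ⟨q.toNNReal, by simp [hq']⟩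
  have hx : ENNReal.toReal (1 - (x : ℝ≥0∞)) = 1 - x := by
    rw [ENNReal.toReal_sub_of_le hq (by simp)]; simp
  have hs : HasSum (fun n : ℕ => Real.exp (-r) * r ^ n / n.factorial * (x : ℝ) ^ n)
      (Real.exp (-(r * (1 - x)))) := by
    have h := (NormedSpace.expSeries_div_hasSum_exp ((r : ℝ) * x)).mul_left (Real.exp (-r))
    rw [← Real.exp_eq_exp_ℝ, ← Real.exp_add] at h
    have e1 : -(r : ℝ) + r * x = -(r * (1 - x)) := by ring
    rw [e1] at h
    refine h.congr_fun fun n => ?_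
    rw [mul_pow]; ring
  rw [poissonMeasure, lintegral_sum_measure, hx, ← hs.tsum_eq,
    ENNReal.ofReal_tsum_of_nonneg (fun n => by positivity) hs.summable]
  congr 1; ext n
  rw [lintegral_smul_measure, lintegral_dirac, ENNReal.ofReal_mul (by positivity),
    ENNReal.ofReal_pow (by positivity)]
  simp

lemma measurable_pointMeasure {Ω E : Type*} [MeasurableSpace Ω] [MeasurableSpace E]
    {X : ℕ → Ω → E} (hX : ∀ j, Measurable (X j)) {B : Set E} (hB : MeasurableSet B) :
    Measurable fun ω => pointMeasure X ω B := by
  simp only [pointMeasure, Measure.sum_apply _ hB, Measure.dirac_apply' _ hB]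
  exact Measurable.tsum fun j => (measurable_one.indicator hB).comp (hX j)

lemma pointMeasure_apply {Ω E : Type*} [MeasurableSpace E] (X : ℕ → Ω → E) (ω : Ω) {B : Set E}
    (hB : MeasurableSet B) : pointMeasure X ω B = ({j | X j ω ∈ B}.encard : ℝ≥0∞) := by
  rw [pointMeasure, Measure.sum_apply _ hB, ← ENNReal.tsum_set_one,
    tsum_subtype {j | X j ω ∈ B} (fun _ => (1 : ℝ≥0∞))]
  congr 1; ext j
  rw [Measure.dirac_apply' _ hB]
  simp [indicator]

namespace IsPoissonProcess

variable {Ω E : Type*} [MeasurableSpace Ω] [MeasurableSpace E]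
    {X : ℕ → Ω → E} {Λ : Measure E} {μ : Measure Ω}

lemma ae_finite (hX : IsPoissonProcess X Λ μ) {B : Set E} (hB : MeasurableSet B)
    (hΛ : Λ B ≠ ∞) : ∀ᵐ ω ∂μ, {j | X j ω ∈ B}.Finite := by
  have h := hX.count_law B hB hΛ
  have h2 : μ.map (fun ω => pointMeasure X ω B) {∞} = 0 := by
    rw [h, Measure.map_apply (by fun_prop) (measurableSet_singleton _)]
    convert measure_empty (μ := poissonMeasure (Λ B).toNNReal)
    ext k; simp
  rw [Measure.map_apply (measurable_pointMeasure hX.measurable hB) (measurableSet_singleton _)]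
    at h2
  filter_upwards [measure_eq_zero_iff_ae_notMem.1 h2] with ω hω
  rw [mem_preimage, mem_singleton_iff, pointMeasure_apply X ω hB] at hω
  rw [← Set.encard_ne_top_iff]
  intro h3; simp [h3] at hω

lemma lintegral_pow_count (hX : IsPoissonProcess X Λ μ) {B : Set E} (hB : MeasurableSet B)
    (hΛ : Λ B ≠ ∞) {q : ℝ≥0∞} (hq : q ≤ 1) :
    ∫⁻ ω, q ^ ⌊(pointMeasure X ω B).toReal⌋₊ ∂μ
      = ENNReal.ofReal (Real.exp (-((Λ B).toReal * (1 - q).toReal))) := by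
  have hm : Measurable fun v : ℝ≥0∞ => q ^ ⌊v.toReal⌋₊ :=
    (measurable_from_nat (f := fun n : ℕ => q ^ n)).comp
      (Nat.measurable_floor.comp ENNReal.measurable_toReal)
  rw [← lintegral_map (f := fun v : ℝ≥0∞ => q ^ ⌊v.toReal⌋₊) hm
    (measurable_pointMeasure hX.measurable hB), hX.count_law B hB hΛ,
    lintegral_map hm (by fun_prop)]
  simp only [ENNReal.toReal_natCast, Nat.floor_natCast]
  exact lintegral_pow_poissonMeasure (Λ B).toNNReal hq

lemma lintegral_infProd_simpleFunc (hX : IsPoissonProcess X Λ μ) (h : SimpleFunc E ℝ≥0∞)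
    (h1 : ∀ x, h x ≤ 1) (hfin : ∫⁻ x, h x ∂Λ ≠ ∞) :
    ∫⁻ ω, infProd (fun x => 1 - h x) (fun j => X j ω) ∂μ
      = ENNReal.ofReal (Real.exp (-(∫⁻ x, h x ∂Λ).toReal)) := by
  set s : Finset ℝ≥0∞ := h.range.erase 0
  have hB : ∀ c : ℝ≥0∞, MeasurableSet (h ⁻¹' {c}) := fun c => h.measurableSet_preimage _
  have hsum : ∫⁻ x, h x ∂Λ = ∑ c ∈ s, c * Λ (h ⁻¹' {c}) := by
    rw [SimpleFunc.lintegral_eq_lintegral h Λ, SimpleFunc.lintegral]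
    symm
    refine Finset.sum_subset (Finset.erase_subset _ _) fun c hc hc' => ?_
    have : c = 0 := by simpa [s, hc, -SimpleFunc.mem_range] using hc'
    simp [this]
  have hterm : ∀ c ∈ s, c * Λ (h ⁻¹' {c}) ≠ ∞ := by
    rw [hsum] at hfin
    exact fun c hc => (ENNReal.sum_ne_top.1 hfin) c hc
  have hΛ : ∀ c ∈ s, Λ (h ⁻¹' {c}) ≠ ∞ := fun c hc htop => by
    have := hterm c hc
    rw [htop, ENNReal.mul_top (Finset.ne_of_mem_erase hc)] at this
    exact this rfl
  have hc1 : ∀ c ∈ s, c ≤ 1 := fun c hc => by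
    obtain ⟨x, rfl⟩ := SimpleFunc.mem_range.1 (Finset.mem_of_mem_erase hc)
    exact h1 x
  have hae : ∀ᵐ ω ∂μ, infProd (fun x => 1 - h x) (fun j => X j ω)
      = ∏ c : s, (1 - (c : ℝ≥0∞)) ^ ⌊(pointMeasure X ω (h ⁻¹' {(c : ℝ≥0∞)})).toReal⌋₊ := by
    have : ∀ᵐ ω ∂μ, ∀ c : s, {j | X j ω ∈ h ⁻¹' {(c : ℝ≥0∞)}}.Finite :=
      ae_all_iff.2 fun c => hX.ae_finite (hB c) (hΛ c c.2)
    filter_upwards [this] with ω hω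
    have hJ : {j | h (X j ω) ∈ s}.Finite := by
      refine (Set.finite_iUnion hω).subset fun j hj => ?_
      exact mem_iUnion.2 ⟨⟨_, hj⟩, rfl⟩
    rw [infProd_eq_prod (fun x => tsub_le_self) hJ.toFinset,
      ← Finset.prod_fiberwise_of_maps_to (s := hJ.toFinset) (t := s) (g := fun j => h (X j ω)),
      ← Finset.prod_coe_sort s]
    · refine Finset.prod_congr rfl fun c _ => ?_
      rw [Finset.prod_congr rfl (g := fun _ => 1 - (c : ℝ≥0∞)), Finset.prod_const]
      · congr 1
        rw [pointMeasure_apply X ω (hB c), (hω c).encard_eq_coe_toFinset_card]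
        simp only [ENat.toENNReal_coe, ENNReal.toReal_natCast, Nat.floor_natCast]
        congr 1; ext j
        simp only [Finset.mem_filter, Finite.mem_toFinset, mem_ofPred_eq, mem_preimage,
          mem_singleton_iff]
        exact ⟨fun hj => hj.2, fun hj => ⟨by rw [hj]; exact c.2, hj⟩⟩
      · intro j hj
        rw [(Finset.mem_filter.1 hj).2]
    · intro j hj; simpa using hj
    · intro j hj
      have : h (X j ω) = 0 := by
        by_contra h0
        exact hj (by simp only [Finite.mem_toFinset, mem_ofPred_eq, s]
                     exact Finset.mem_erase.2 ⟨h0, SimpleFunc.mem_range_self _ _⟩)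
      simp [this]
  let e := s.equivFin
  have hind := hX.count_indep s.card (fun i => h ⁻¹' {((e.symm i : s) : ℝ≥0∞)})
    (fun i => hB _) (fun i j hij => Disjoint.preimage _ (by
      rw [Set.disjoint_singleton]
      exact fun h => hij (e.symm.injective (Subtype.ext h))))
  have hm : ∀ q : ℝ≥0∞, Measurable fun v : ℝ≥0∞ => q ^ ⌊v.toReal⌋₊ := fun q =>
    (measurable_from_nat (f := fun n : ℕ => q ^ n)).comp
      (Nat.measurable_floor.comp ENNReal.measurable_toReal)
  have hind2 := hind.comp (fun i v => (1 - ((e.symm i : s) : ℝ≥0∞)) ^ ⌊v.toReal⌋₊)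
    (fun i => hm _)
  rw [lintegral_congr_ae hae]
  have hre : ∀ ω, ∏ c : s, (1 - (c : ℝ≥0∞)) ^ ⌊(pointMeasure X ω (h ⁻¹' {(c : ℝ≥0∞)})).toReal⌋₊
      = ∏ i : Fin s.card, (1 - ((e.symm i : s) : ℝ≥0∞)) ^
        ⌊(pointMeasure X ω (h ⁻¹' {((e.symm i : s) : ℝ≥0∞)})).toReal⌋₊ := fun ω =>
    (Equiv.prod_comp e.symm (fun c : s => (1 - (c : ℝ≥0∞)) ^
      ⌊(pointMeasure X ω (h ⁻¹' {(c : ℝ≥0∞)})).toReal⌋₊)).symm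
  simp_rw [hre]
  have := lintegral_prod_eq_prod_lintegral_of_indepFun Finset.univ _ hind2
    (fun i => (hm _).comp (measurable_pointMeasure hX.measurable (hB _)))
  simp only [Function.comp_def] at this
  rw [this, Finset.prod_congr rfl fun i _ => hX.lintegral_pow_count (hB _)
    (hΛ _ (e.symm i).2) tsub_le_self,
    Equiv.prod_comp e.symm (fun c : s => ENNReal.ofReal (Real.exp
      (-((Λ (h ⁻¹' {(c : ℝ≥0∞)})).toReal * (1 - (1 - (c : ℝ≥0∞))).toReal)))),
    Finset.prod_coe_sort s (fun c => ENNReal.ofReal (Real.exp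
      (-((Λ (h ⁻¹' {c})).toReal * (1 - (1 - c)).toReal)))),
    ← ENNReal.ofReal_prod_of_nonneg (fun _ _ => (Real.exp_pos _).le), ← Real.exp_sum, hsum,
    ENNReal.toReal_sum hterm, Finset.sum_neg_distrib]
  congr 3
  refine Finset.sum_congr rfl fun c hc => ?_
  rw [ENNReal.sub_sub_cancel ENNReal.one_ne_top (hc1 c hc), ENNReal.toReal_mul, mul_comm]

/-- The probability generating functional of a Poisson process. -/
theorem lintegral_infProd [IsFiniteMeasure μ] [SigmaFinite Λ] (hX : IsPoissonProcess X Λ μ)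
    {g : E → ℝ≥0∞} (hg : Measurable g) (hg1 : ∀ x, g x ≤ 1) (hfin : ∫⁻ x, 1 - g x ∂Λ ≠ ∞) :
    ∫⁻ ω, infProd g (fun j => X j ω) ∂μ
      = ENNReal.ofReal (Real.exp (-(∫⁻ x, 1 - g x ∂Λ).toReal)) := by
  have hgm : Measurable fun x => 1 - g x := measurable_const.sub hg
  let h : ℕ → SimpleFunc E ℝ≥0∞ := SimpleFunc.eapprox fun x => 1 - g x
  have hmono : ∀ x, Monotone fun k => h k x := fun x k l hkl =>
    SimpleFunc.monotone_eapprox (fun x => 1 - g x) hkl x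
  have hsup : ∀ x, ⨆ k, h k x = 1 - g x := fun x => SimpleFunc.iSup_eapprox_apply hgm x
  have hle : ∀ k x, h k x ≤ 1 - g x := fun k x => (le_iSup (fun k => h k x) k).trans (hsup x).le
  have hg_eq : g = fun x => ⨅ k, (1 - h k x) := by
    ext x
    rw [← ENNReal.sub_iSup ENNReal.one_ne_top, hsup, ENNReal.sub_sub_cancel ENNReal.one_ne_top
      (hg1 x)]
  have hint : ∀ k, ∫⁻ x, h k x ∂Λ ≠ ∞ := fun k =>
    ((lintegral_mono (hle k)).trans_lt hfin.lt_top).ne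
  have hk := fun k => hX.lintegral_infProd_simpleFunc (h k)
    (fun x => (hle k x).trans tsub_le_self) (hint k)
  have hanti : ∀ x, Antitone fun k => 1 - h k x := fun x k l hkl =>
    tsub_le_tsub_left (hmono x hkl) _
  have hL : ∫⁻ ω, infProd g (fun j => X j ω) ∂μ
      = ⨅ k, ∫⁻ ω, infProd (fun x => 1 - h k x) (fun j => X j ω) ∂μ := by
    conv_lhs => rw [hg_eq]
    simp_rw [infProd_iInf (g := fun k x => 1 - h k x) (fun k x => tsub_le_self) hanti]
    refine lintegral_iInf (fun k => measurable_infProd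
      (measurable_const.sub (h k).measurable) hX.measurable) ?_ ?_
    · intro k l hkl ω
      exact iInf_mono fun n => Finset.prod_le_prod' fun j _ => hanti _ hkl
    · exact ((lintegral_mono fun ω => infProd_le_one _ _).trans_lt (by simp)).ne
  have hlim : Tendsto (fun k => ∫⁻ x, h k x ∂Λ) atTop (𝓝 (∫⁻ x, 1 - g x ∂Λ)) := by
    simp_rw [← hsup]
    rw [lintegral_iSup (fun k => (h k).measurable) fun k l hkl x => hmono x hkl]
    exact tendsto_atTop_iSup fun k l hkl => lintegral_mono fun x => hmono x hkl
  rw [hL]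
  refine tendsto_nhds_unique (tendsto_atTop_iInf fun k l hkl => lintegral_mono fun ω =>
    iInf_mono fun n => Finset.prod_le_prod' fun j _ => hanti _ hkl) ?_
  simp_rw [hk]
  exact ((ENNReal.continuous_ofReal.comp Real.continuous_exp).tendsto _).comp
    (((ENNReal.tendsto_toReal hfin).comp hlim).neg)

end IsPoissonProcess

/-! ### Independent markings -/

/-- Boxes in the space of point sequences and mark sequences. -/
def markBoxes (E Y : Type*) [MeasurableSpace E] [MeasurableSpace Y] :
    Set (Set ((ℕ → E) × (ℕ → Y))) :=
  {B | ∃ (n : ℕ) (A : Set (ℕ → E)) (S : ℕ → Set Y), MeasurableSet A ∧ (∀ j, MeasurableSet (S j)) ∧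
    B = {p | p.1 ∈ A ∧ ∀ j < n, p.2 j ∈ S j}}

section Boxes

variable {E Y : Type*} [MeasurableSpace E] [MeasurableSpace Y]

lemma measurableSet_forall_lt {n : ℕ} {S : ℕ → Set Y} (hS : ∀ j, MeasurableSet (S j)) :
    MeasurableSet {y : ℕ → Y | ∀ j < n, y j ∈ S j} := by
  have : {y : ℕ → Y | ∀ j < n, y j ∈ S j} = ⋂ j, ⋂ (_ : j < n), (fun y => y j) ⁻¹' S j := by
    ext; simp
  rw [this]
  exact .iInter fun j => .iInter fun _ => measurable_pi_apply j (hS j)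

lemma isPiSystem_markBoxes : IsPiSystem (markBoxes E Y) := by
  classical
  rintro _ ⟨n, A, S, hA, hS, rfl⟩ _ ⟨n', A', S', hA', hS', rfl⟩ -
  refine ⟨max n n', A ∩ A', fun j => (if j < n then S j else univ) ∩ if j < n' then S' j else univ,
    hA.inter hA', fun j => ?_, ?_⟩
  · refine MeasurableSet.inter ?_ ?_ <;> split_ifs <;> simp [hS, hS']
  · ext p
    simp only [mem_inter_iff, mem_ofPred_eq, lt_max_iff]
    constructor
    · rintro ⟨⟨h1, h2⟩, h3, h4⟩
      refine ⟨⟨h1, h3⟩, fun j _ => ⟨?_, ?_⟩⟩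
      · split_ifs with h
        exacts [h2 j h, mem_univ _]
      · split_ifs with h
        exacts [h4 j h, mem_univ _]
    · rintro ⟨⟨h1, h3⟩, h⟩
      refine ⟨⟨h1, fun j hj => ?_⟩, h3, fun j hj => ?_⟩
      · simpa [hj] using (h j (Or.inl hj)).1
      · simpa [hj] using (h j (Or.inr hj)).2

lemma generateFrom_markBoxes :
    (inferInstance : MeasurableSpace ((ℕ → E) × (ℕ → Y)))
      = MeasurableSpace.generateFrom (markBoxes E Y) := by
  refine le_antisymm ?_ (MeasurableSpace.generateFrom_le ?_)
  · refine sup_le ?_ ?_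
    · rintro _ ⟨A, hA, rfl⟩
      refine MeasurableSpace.measurableSet_generateFrom ⟨0, A, fun _ => univ, hA, by simp, ?_⟩
      ext; simp
    · rw [MeasurableSpace.pi, MeasurableSpace.comap_iSup]
      refine iSup_le fun j => ?_
      rw [MeasurableSpace.comap_comp]
      rintro _ ⟨B, hB, rfl⟩
      classical
      refine MeasurableSpace.measurableSet_generateFrom
        ⟨j + 1, univ, fun i => if i = j then B else univ, .univ, fun i => ?_, ?_⟩
      · dsimp only; split_ifs <;> simp [hB]
      · ext p
        simp only [mem_preimage, Function.comp_apply, mem_univ, true_and, mem_ofPred_eq]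
        constructor
        · intro h i _
          split_ifs with hi
          exacts [hi ▸ h, mem_univ _]
        · intro h
          simpa using h j (Nat.lt_succ_self j)
  · rintro _ ⟨n, A, S, hA, hS, rfl⟩
    exact (measurable_fst hA).inter (measurable_snd (measurableSet_forall_lt hS))

lemma generateFrom_forall_lt :
    (inferInstance : MeasurableSpace (ℕ → Y)) = MeasurableSpace.generateFrom
      {B | ∃ (n : ℕ) (S : ℕ → Set Y), (∀ j, MeasurableSet (S j)) ∧ B = {y | ∀ j < n, y j ∈ S j}} := by
  refine le_antisymm ?_ (MeasurableSpace.generateFrom_le ?_)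
  · refine iSup_le fun j => ?_
    rintro _ ⟨B, hB, rfl⟩
    classical
    refine MeasurableSpace.measurableSet_generateFrom
      ⟨j + 1, fun i => if i = j then B else univ, fun i => ?_, ?_⟩
    · dsimp only; split_ifs <;> simp [hB]
    · ext p
      constructor
      · intro h i _
        dsimp only
        split_ifs with hi
        exacts [hi ▸ h, mem_univ _]
      · intro h
        simpa using h j (Nat.lt_succ_self j)
  · rintro _ ⟨n, S, hS, rfl⟩
    exact measurableSet_forall_lt hS

lemma isPiSystem_forall_lt : IsPiSystem
      {B : Set (ℕ → Y) | ∃ (n : ℕ) (S : ℕ → Set Y), (∀ j, MeasurableSet (S j)) ∧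
        B = {y | ∀ j < n, y j ∈ S j}} := by
  classical
  rintro _ ⟨n, S, hS, rfl⟩ _ ⟨n', S', hS', rfl⟩ -
  refine ⟨max n n', fun j => (if j < n then S j else univ) ∩ if j < n' then S' j else univ,
    fun j => ?_, ?_⟩
  · refine MeasurableSet.inter ?_ ?_ <;> split_ifs <;> simp [hS, hS']
  · ext p
    simp only [mem_inter_iff, mem_ofPred_eq, lt_max_iff]
    constructor
    · rintro ⟨h2, h4⟩ j _
      refine ⟨?_, ?_⟩
      · split_ifs with h
        exacts [h2 j h, mem_univ _]
      · split_ifs with h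
        exacts [h4 j h, mem_univ _]
    · intro h
      refine ⟨fun j hj => ?_, fun j hj => ?_⟩
      · simpa [hj] using (h j (Or.inl hj)).1
      · simpa [hj] using (h j (Or.inr hj)).2

lemma infinitePi_forall_lt (ν : ℕ → Measure Y) [∀ j, IsProbabilityMeasure (ν j)] (n : ℕ)
    {S : ℕ → Set Y} (hS : ∀ j, MeasurableSet (S j)) :
    Measure.infinitePi ν {y | ∀ j < n, y j ∈ S j} = ∏ j ∈ Finset.range n, ν j (S j) := by
  rw [← Measure.infinitePi_pi ν (fun j _ => hS j)]
  congr 1; ext y; simp [Set.mem_pi]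

/-- Given the points, the marks are independent: the kernel from points to marks. -/
noncomputable def seqKernel (K : Kernel E Y) [IsMarkovKernel K] : Kernel (ℕ → E) (ℕ → Y) where
  toFun x := Measure.infinitePi fun j => K (x j)
  measurable' := by
    refine Measurable.measure_of_isPiSystem_of_isProbabilityMeasure generateFrom_forall_lt
      isPiSystem_forall_lt ?_
    rintro _ ⟨n, S, hS, rfl⟩
    simp_rw [infinitePi_forall_lt _ n hS]
    exact Finset.measurable_fun_prod _ fun j _ =>
      (Kernel.measurable_coe K (hS j)).comp (measurable_pi_apply j)

lemma seqKernel_apply (K : Kernel E Y) [IsMarkovKernel K] (x : ℕ → E) :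
    seqKernel K x = Measure.infinitePi fun j => K (x j) := rfl

instance (K : Kernel E Y) [IsMarkovKernel K] : IsMarkovKernel (seqKernel K) :=
  ⟨fun x => by rw [seqKernel_apply]; infer_instance⟩

end Boxes

namespace IsIndependentMarking

variable {Ω E Y : Type*} [MeasurableSpace Ω] [MeasurableSpace E] [MeasurableSpace Y]
  {X : ℕ → Ω → E} {M : ℕ → Ω → Y} {μ : Measure Ω}

lemma map_eq_compProd [IsProbabilityMeasure μ] {K : Kernel E Y} [IsMarkovKernel K]
    (hM : IsIndependentMarking X M (fun x => K x) μ) (hX : ∀ j, Measurable (X j)) :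
    μ.map (fun ω => ((fun j => X j ω), fun j => M j ω))
      = (μ.map fun ω j => X j ω) ⊗ₘ seqKernel K := by
  have hXm : Measurable fun ω j => X j ω := measurable_pi_lambda _ hX
  have hMm : Measurable fun ω j => M j ω := measurable_pi_lambda _ hM.measurable
  have : IsProbabilityMeasure (μ.map fun ω j => X j ω) :=
    Measure.isProbabilityMeasure_map hXm.aemeasurable
  have : IsProbabilityMeasure (μ.map (fun ω => ((fun j => X j ω), fun j => M j ω))) :=
    Measure.isProbabilityMeasure_map (hXm.prodMk hMm).aemeasurable
  refine ext_of_generate_finite _ generateFrom_markBoxes isPiSystem_markBoxes ?_ (by simp)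
  rintro _ ⟨n, A, S, hA, hS, rfl⟩
  have hB : MeasurableSet {p : (ℕ → E) × (ℕ → Y) | p.1 ∈ A ∧ ∀ j < n, p.2 j ∈ S j} :=
    (measurable_fst hA).inter (measurable_snd (measurableSet_forall_lt hS))
  rw [Measure.map_apply (hXm.prodMk hMm) hB,
    show {p : (ℕ → E) × (ℕ → Y) | p.1 ∈ A ∧ ∀ j < n, p.2 j ∈ S j}
      = A ×ˢ {y | ∀ j < n, y j ∈ S j} from rfl,
    Measure.compProd_apply_prod hA (measurableSet_forall_lt hS)]
  refine (hM.joint_law n A hA S hS).trans ?_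
  simp_rw [seqKernel_apply, infinitePi_forall_lt _ n hS]
  have hm : Measurable fun x : ℕ → E => ∏ j ∈ Finset.range n, K (x j) (S j) :=
    Finset.measurable_fun_prod _ fun j _ =>
      (Kernel.measurable_coe K (hS j)).comp (measurable_pi_apply j)
  rw [setLIntegral_map hA hm hXm]
  rfl

lemma lintegral_prod_range [IsProbabilityMeasure μ] {K : Kernel E Y} [IsMarkovKernel K]
    (hM : IsIndependentMarking X M (fun x => K x) μ) (hX : ∀ j, Measurable (X j))
    {g : E × Y → ℝ≥0∞} (hg : Measurable g) (n : ℕ) :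
    ∫⁻ ω, ∏ j ∈ Finset.range n, g (X j ω, M j ω) ∂μ
      = ∫⁻ ω, ∏ j ∈ Finset.range n, ∫⁻ y, g (X j ω, y) ∂(K (X j ω)) ∂μ := by
  have hXm : Measurable fun ω j => X j ω := measurable_pi_lambda _ hX
  have hMm : Measurable fun ω j => M j ω := measurable_pi_lambda _ hM.measurable
  have hG : Measurable fun p : (ℕ → E) × (ℕ → Y) => ∏ j ∈ Finset.range n, g (p.1 j, p.2 j) :=
    Finset.measurable_fun_prod _ fun j _ => by fun_prop
  rw [← lintegral_map (f := fun p : (ℕ → E) × (ℕ → Y) => ∏ j ∈ Finset.range n, g (p.1 j, p.2 j))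
    hG (hXm.prodMk hMm), hM.map_eq_compProd hX, Measure.lintegral_compProd hG,
    lintegral_map hG.lintegral_kernel_prod_right hXm]
  refine lintegral_congr fun ω => ?_
  rw [seqKernel_apply]
  have hind : iIndepFun (fun j (y : ℕ → Y) => g (X j ω, y j))
      (Measure.infinitePi fun j => K (X j ω)) :=
    iIndepFun_infinitePi (X := fun j y => g (X j ω, y)) fun j => by fun_prop
  rw [lintegral_prod_eq_prod_lintegral_of_indepFun _ _ hind fun j => by fun_prop]
  refine Finset.prod_congr rfl fun j _ => ?_
  have := (measurePreserving_eval_infinitePi (fun j => K (X j ω)) j).lintegral_comp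
    (f := fun y => g (X j ω, y)) (by fun_prop)
  exact this

/-- The probability generating functional of an independently marked Poisson process. -/
theorem lintegral_infProd [IsProbabilityMeasure μ] {Λ : Measure E} [SigmaFinite Λ]
    {K : Kernel E Y} [IsMarkovKernel K]
    (hX : IsPoissonProcess X Λ μ) (hM : IsIndependentMarking X M (fun x => K x) μ)
    {g : E × Y → ℝ≥0∞} (hg : Measurable g) (hg1 : ∀ p, g p ≤ 1)
    (hfin : ∫⁻ p, 1 - g p ∂(Λ ⊗ₘ K) ≠ ∞) :
    ∫⁻ ω, infProd g (fun j => (X j ω, M j ω)) ∂μ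
      = ENNReal.ofReal (Real.exp (-(∫⁻ p, 1 - g p ∂(Λ ⊗ₘ K)).toReal)) := by
  set G : E → ℝ≥0∞ := fun x => ∫⁻ y, g (x, y) ∂(K x)
  have hG : Measurable G := hg.lintegral_kernel_prod_right'
  have hG1 : ∀ x, G x ≤ 1 := fun x => by
    calc G x ≤ ∫⁻ y, 1 ∂(K x) := lintegral_mono fun y => hg1 _
      _ = 1 := by simp
  have hsub : ∀ x, 1 - G x = ∫⁻ y, 1 - g (x, y) ∂(K x) := fun x => by
    rw [lintegral_sub (by fun_prop) ((hG1 x).trans_lt ENNReal.one_lt_top).ne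
      (ae_of_all _ fun y => hg1 _)]
    simp [G]
  have hint : ∫⁻ p, 1 - g p ∂(Λ ⊗ₘ K) = ∫⁻ x, 1 - G x ∂Λ := by
    have hm : Measurable fun p => 1 - g p := measurable_const.sub hg
    rw [Measure.lintegral_compProd hm]
    exact lintegral_congr fun x => (hsub x).symm
  rw [hint] at hfin ⊢
  rw [← hX.lintegral_infProd hG hG1 hfin]
  have hYm : ∀ j, Measurable fun ω => (X j ω, M j ω) := fun j =>
    (hX.measurable j).prodMk (hM.measurable j)
  have h1 : ∀ n, Measurable fun ω => ∏ j ∈ Finset.range n, g (X j ω, M j ω) := fun n =>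
    Finset.measurable_fun_prod _ fun j _ => hg.comp (hYm j)
  have h2 : ∀ n, Measurable fun ω => ∏ j ∈ Finset.range n, G (X j ω) := fun n =>
    Finset.measurable_fun_prod _ fun j _ => hG.comp (hX.measurable j)
  unfold infProd
  rw [lintegral_iInf h1 (fun n m hnm ω => antitone_prod_range hg1 _ hnm) (by simp),
    lintegral_iInf h2 (fun n m hnm ω => antitone_prod_range hG1 _ hnm) (by simp)]
  simp_rw [hM.lintegral_prod_range hX.measurable hg]
  rfl

/-- If one component `φ` of the marks is independent of the others, which `ψ` retains, and has law
`ν`, then this component of one mark is independent of everything else. -/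
theorem measure_update_inter [IsProbabilityMeasure μ] {κ : E → Measure Y}
    (hM : IsIndependentMarking X M κ μ) (hX : ∀ j, Measurable (X j))
    [∀ x, IsProbabilityMeasure (κ x)]
    {ψ : Y → Y} (hψ : Measurable ψ) {F : Type*} [MeasurableSpace F] {φ : Y → F}
    (hφ : Measurable φ) {ν : Measure F} [IsProbabilityMeasure ν]
    (hκ : ∀ x (S : Set Y) (B : Set F), MeasurableSet S → MeasurableSet B →
      κ x (ψ ⁻¹' S ∩ φ ⁻¹' B) = κ x (ψ ⁻¹' S) * ν B) (j : ℕ)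
    {C : Set ((ℕ → E) × (ℕ → Y))} (hC : MeasurableSet C) {B : Set F} (hB : MeasurableSet B) :
    μ ({ω | ((fun i => X i ω), Function.update (fun i => M i ω) j (ψ (M j ω))) ∈ C}
        ∩ {ω | φ (M j ω) ∈ B})
      = μ {ω | ((fun i => X i ω), Function.update (fun i => M i ω) j (ψ (M j ω))) ∈ C} * ν B := by
  classical
  have hXm : Measurable fun ω j => X j ω := measurable_pi_lambda _ hX
  set Z : Ω → (ℕ → E) × (ℕ → Y) := fun ω =>
    ((fun i => X i ω), Function.update (fun i => M i ω) j (ψ (M j ω))) with hZdef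
  have hZ : Measurable Z := hXm.prodMk (measurable_pi_lambda _ fun i => by
    by_cases hi : i = j
    · subst hi; simpa [Function.comp_def] using hψ.comp (hM.measurable i)
    · simpa [Function.update_of_ne hi] using hM.measurable i)
  have hBm : MeasurableSet {ω | φ (M j ω) ∈ B} := hφ.comp (hM.measurable j) hB
  have key : ∀ (B' : Set F), MeasurableSet B' → ∀ n, j < n → ∀ A : Set (ℕ → E), MeasurableSet A →
      ∀ S : ℕ → Set Y, (∀ i, MeasurableSet (S i)) →
      μ ({ω | Z ω ∈ {p | p.1 ∈ A ∧ ∀ i < n, p.2 i ∈ S i}} ∩ {ω | φ (M j ω) ∈ B'})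
      = (∫⁻ ω in {ω | (fun i => X i ω) ∈ A}, (κ (X j ω) (ψ ⁻¹' S j)) *
          ∏ i ∈ (Finset.range n).erase j, κ (X i ω) (S i) ∂μ) * ν B' := by
    intro B' hB' n hn A hA S hS
    have hjn : j ∈ Finset.range n := Finset.mem_range.2 hn
    rw [← lintegral_mul_const' _ _ (measure_ne_top ν B')]
    have h := hM.joint_law n A hA (Function.update S j (ψ ⁻¹' S j ∩ φ ⁻¹' B')) (fun i => by
      by_cases hi : i = j
      · subst hi; simpa using (hψ (hS _)).inter (hφ hB')
      · simpa [Function.update_of_ne hi] using hS i)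
    convert h using 2
    · ext ω
      simp only [mem_inter_iff, mem_ofPred_eq, hZdef, and_assoc, and_congr_right_iff]
      intro _
      constructor
      · rintro ⟨h1, h2⟩ i hi
        by_cases hij : i = j
        · subst hij; simpa using ⟨by simpa using h1 i hi, h2⟩
        · simpa [Function.update_of_ne hij] using h1 i hi
      · intro h
        have hj := h j hn
        simp only [Function.update_self] at hj
        refine ⟨fun i hi => ?_, hj.2⟩
        by_cases hij : i = j
        · subst hij; simpa using hj.1
        · simpa [Function.update_of_ne hij] using h i hi
    · ext ω
      have hp : ∏ i ∈ (Finset.range n).erase j,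
          κ (X i ω) (Function.update S j (ψ ⁻¹' S j ∩ φ ⁻¹' B') i)
          = ∏ i ∈ (Finset.range n).erase j, κ (X i ω) (S i) :=
        Finset.prod_congr rfl fun i hi => by
          rw [Function.update_of_ne (Finset.ne_of_mem_erase hi)]
      rw [← Finset.mul_prod_erase _ _ hjn, Function.update_self, hκ _ _ _ (hS j) hB', hp]
      ring
  have heq : (μ.restrict {ω | φ (M j ω) ∈ B}).map Z = ν B • μ.map Z := by
    refine ext_of_generate_finite _ generateFrom_markBoxes isPiSystem_markBoxes ?_ ?_
    · rintro _ ⟨n, A, S, hA, hS, rfl⟩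
      have hB2 : MeasurableSet {p : (ℕ → E) × (ℕ → Y) | p.1 ∈ A ∧ ∀ j < n, p.2 j ∈ S j} :=
        (measurable_fst hA).inter (measurable_snd (measurableSet_forall_lt hS))
      have hext : {p : (ℕ → E) × (ℕ → Y) | p.1 ∈ A ∧ ∀ j < n, p.2 j ∈ S j}
          = {p | p.1 ∈ A ∧ ∀ i < max n (j + 1), p.2 i ∈ if i < n then S i else univ} := by
        ext p
        simp only [mem_ofPred_eq, and_congr_right_iff]
        intro _
        constructor
        · intro h i _
          split_ifs with hi
          exacts [h i hi, mem_univ _]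
        · intro h i hi
          simpa [hi] using h i (lt_max_of_lt_left hi)
      have hS' : ∀ i, MeasurableSet (if i < n then S i else univ) := fun i => by
        split_ifs <;> simp [hS]
      have hj : j < max n (j + 1) := lt_max_of_lt_right (Nat.lt_succ_self j)
      rw [Measure.map_apply hZ hB2, Measure.restrict_apply (hZ hB2), Measure.smul_apply,
        Measure.map_apply hZ hB2, hext]
      have h1 := key B hB _ hj A hA _ hS'
      have h2 := key univ .univ _ hj A hA _ hS'
      simp only [mem_univ, ofPred_true, inter_univ, measure_univ, mul_one] at h2
      rw [smul_eq_mul, mul_comm]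
      refine h1.trans ?_
      rw [← h2]; rfl
    · have h1 := key B hB (j + 1) (Nat.lt_succ_self j) univ .univ (fun _ => univ) (fun _ => .univ)
      rw [Measure.map_apply hZ .univ, Measure.smul_apply, Measure.map_apply hZ .univ]
      simpa using h1
  have := congrArg (fun m => m C) heq
  simp only [Measure.smul_apply, smul_eq_mul] at this
  rw [Measure.map_apply hZ hC, Measure.restrict_apply (hZ hC), Measure.map_apply hZ hC] at this
  rw [mul_comm]
  exact this

end IsIndependentMarking

/-! ### Consequences of the formula for the probability generating functional -/

/-- The random points `Y 0, Y 1, …` have the probability generating functional of a Poisson process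
with intensity measure `Λ`. -/
structure HasPoissonPGFL {Ω S : Type*} [MeasurableSpace Ω] [MeasurableSpace S]
    (Y : ℕ → Ω → S) (Λ : Measure S) (μ : Measure Ω) : Prop where
  measurable : ∀ j, Measurable (Y j)
  lintegral_infProd : ∀ g : S → ℝ≥0∞, Measurable g → (∀ x, g x ≤ 1) → ∫⁻ x, 1 - g x ∂Λ ≠ ∞ →
    ∫⁻ ω, infProd g (fun j => Y j ω) ∂μ = ENNReal.ofReal (Real.exp (-(∫⁻ x, 1 - g x ∂Λ).toReal))

section InfProd

variable {S : Type*}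

lemma infProd_le_prod {g : S → ℝ≥0∞} (hg : ∀ x, g x ≤ 1) (y : ℕ → S) (J : Finset ℕ) :
    infProd g y ≤ ∏ j ∈ J, g (y j) := by
  refine (iInf_le _ (J.sup id + 1)).trans
    (Finset.prod_le_prod_of_subset_of_le_one' (fun j hj => ?_) fun j _ _ => hg _)
  have : j ≤ J.sup id := Finset.le_sup (f := id) hj
  simp; omega

lemma infProd_mul {f g : S → ℝ≥0∞} (hf : ∀ x, f x ≤ 1) (hg : ∀ x, g x ≤ 1) (y : ℕ → S) :
    infProd (fun x => f x * g x) y = infProd f y * infProd g y := by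
  refine tendsto_nhds_unique (tendsto_infProd (fun x => mul_le_one' (hf x) (hg x)) y) ?_
  simp_rw [Finset.prod_mul_distrib]
  exact ENNReal.Tendsto.mul (tendsto_infProd hf y)
    (Or.inr ((infProd_le_one g y).trans_lt ENNReal.one_lt_top).ne) (tendsto_infProd hg y)
    (Or.inr ((infProd_le_one f y).trans_lt ENNReal.one_lt_top).ne)

open Classical in
lemma infProd_indicator (B : Set S) (y : ℕ → S) :
    infProd (B.indicator 1) y = if ∀ j, y j ∈ B then 1 else 0 := by
  split_ifs with h
  · simp [infProd, h]
  · push Not at h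
    obtain ⟨j, hj⟩ := h
    refine le_antisymm ((infProd_le_prod (g := B.indicator 1) (fun x => ?_) y {j}).trans ?_)
      zero_le
    · exact indicator_le_self' (fun _ _ => zero_le) x
    · simp [hj]

lemma ofReal_exp_neg_le_one (u : ℝ≥0) : ENNReal.ofReal (Real.exp (-(u : ℝ))) ≤ 1 := by
  rw [ENNReal.ofReal_le_one]; simp

lemma one_sub_ofReal_exp_neg (u : ℝ) :
    1 - ENNReal.ofReal (Real.exp (-u)) = ENNReal.ofReal (1 - Real.exp (-u)) := by
  rw [ENNReal.ofReal_sub _ (Real.exp_pos _).le, ENNReal.ofReal_one]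

lemma prod_ofReal_exp_neg (a : S → ℝ≥0) (y : ℕ → S) (n : ℕ) :
    ∏ j ∈ Finset.range n, ENNReal.ofReal (Real.exp (-(a (y j) : ℝ)))
      = ENNReal.ofReal (Real.exp (-∑ j ∈ Finset.range n, (a (y j) : ℝ))) := by
  rw [← ENNReal.ofReal_prod_of_nonneg (fun _ _ => (Real.exp_pos _).le), ← Real.exp_sum,
    Finset.sum_neg_distrib]

lemma infProd_exp_of_summable {a : S → ℝ≥0} {y : ℕ → S} (h : Summable fun j => (a (y j) : ℝ)) :
    infProd (fun x => ENNReal.ofReal (Real.exp (-(a x : ℝ)))) y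
      = ENNReal.ofReal (Real.exp (-∑' j, (a (y j) : ℝ))) := by
  refine tendsto_nhds_unique (tendsto_infProd (fun x => ofReal_exp_neg_le_one _) y) ?_
  simp_rw [prod_ofReal_exp_neg]
  exact ((ENNReal.continuous_ofReal.comp Real.continuous_exp).tendsto _).comp
    h.hasSum.tendsto_sum_nat.neg

lemma infProd_exp_of_not_summable {a : S → ℝ≥0} {y : ℕ → S}
    (h : ¬ Summable fun j => (a (y j) : ℝ)) :
    infProd (fun x => ENNReal.ofReal (Real.exp (-(a x : ℝ)))) y = 0 := by
  refine tendsto_nhds_unique (tendsto_infProd (fun x => ofReal_exp_neg_le_one _) y) ?_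
  simp_rw [prod_ofReal_exp_neg]
  have h1 := (not_summable_iff_tendsto_nat_atTop_of_nonneg fun j => NNReal.coe_nonneg _).1 h
  have := ENNReal.tendsto_ofReal (Real.tendsto_exp_atBot.comp (tendsto_neg_atTop_atBot.comp h1))
  simpa using this

end InfProd

namespace HasPoissonPGFL

variable {Ω S : Type*} [MeasurableSpace Ω] [MeasurableSpace S] {Y : ℕ → Ω → S} {Λ : Measure S}
  {μ : Measure Ω}

lemma measure_forall_notMem (h : HasPoissonPGFL Y Λ μ) {B : Set S} (hB : MeasurableSet B)
    (hΛ : Λ B ≠ ∞) :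
    μ {ω | ∀ j, Y j ω ∉ B} = ENNReal.ofReal (Real.exp (-(Λ B).toReal)) := by
  classical
  have hsub : ∀ x, 1 - (Bᶜ.indicator 1 : S → ℝ≥0∞) x = B.indicator 1 x := fun x => by
    by_cases hx : x ∈ B <;> simp [hx]
  have hm : MeasurableSet {ω | ∀ j, Y j ω ∉ B} := by
    rw [ofPred_forall]
    exact .iInter fun j => (h.measurable j hB).compl
  have := h.lintegral_infProd (Bᶜ.indicator 1) (measurable_one.indicator hB.compl)
    (fun x => indicator_le_self' (fun _ _ => zero_le) x) (by
      simp_rw [hsub]; rwa [lintegral_indicator_one hB])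
  simp_rw [hsub, lintegral_indicator_one hB, infProd_indicator] at this
  rw [← this, ← lintegral_indicator_one hm]
  refine lintegral_congr fun ω => ?_
  simp [indicator]

theorem ae_summable [IsProbabilityMeasure μ] (h : HasPoissonPGFL Y Λ μ) {a : S → ℝ≥0}
    (ha : Measurable a) (hfin : ∫⁻ x, ENNReal.ofReal (1 - Real.exp (-(a x : ℝ))) ∂Λ ≠ ∞) :
    ∀ᵐ ω ∂μ, Summable fun j => (a (Y j ω) : ℝ) := by
  let b : ℕ → S → ℝ≥0 := fun n x => a x / (n + 1)
  have hb : ∀ n, Measurable (b n) := fun n => ha.div_const _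
  have hbm : ∀ n, Measurable fun x => ENNReal.ofReal (1 - Real.exp (-(b n x : ℝ))) :=
    fun n => by have := hb n; fun_prop
  have hbound : ∀ n x, ENNReal.ofReal (1 - Real.exp (-(b n x : ℝ)))
      ≤ ENNReal.ofReal (1 - Real.exp (-(a x : ℝ))) := fun n x => by
    refine ENNReal.ofReal_le_ofReal (sub_le_sub_left (Real.exp_le_exp.2 (neg_le_neg ?_)) _)
    exact_mod_cast div_le_self (zero_le (a := a x)) (by simp)
  have hlim : Tendsto (fun n => ∫⁻ x, ENNReal.ofReal (1 - Real.exp (-(b n x : ℝ))) ∂Λ) atTop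
      (𝓝 0) := by
    rw [← lintegral_zero (μ := Λ)]
    refine tendsto_lintegral_of_dominated_convergence _ hbm (fun n => ae_of_all _ (hbound n)) hfin
      (ae_of_all _ fun x => ?_)
    have h0 : Tendsto (fun n : ℕ => (b n x : ℝ)) atTop (𝓝 0) := by
      have := tendsto_one_div_add_atTop_nhds_zero_nat (𝕜 := ℝ) |>.const_mul (a x : ℝ)
      simpa [b, div_eq_mul_inv] using this
    have h1 : Continuous fun u : ℝ => ENNReal.ofReal (1 - Real.exp (-u)) :=
      ENNReal.continuous_ofReal.comp (by fun_prop)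
    simpa [Function.comp_def] using (h1.tendsto 0).comp h0
  have hmeas : MeasurableSet {ω | Summable fun j => (a (Y j ω) : ℝ)} := by
    have : {ω | Summable fun j => (a (Y j ω) : ℝ)}
        = {ω | ∑' j, (a (Y j ω) : ℝ≥0∞) ≠ ∞} := by
      ext ω
      simp only [mem_ofPred_eq, NNReal.summable_coe, ENNReal.tsum_coe_ne_top_iff_summable]
    rw [this]
    have hm : Measurable fun ω => ∑' j, (a (Y j ω) : ℝ≥0∞) :=
      Measurable.tsum fun j => (ha.comp (h.measurable j)).coe_nnreal_ennreal
    exact (hm (measurableSet_singleton ∞)).compl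
  have hle : ∀ n, ENNReal.ofReal (Real.exp
      (-(∫⁻ x, ENNReal.ofReal (1 - Real.exp (-(b n x : ℝ))) ∂Λ).toReal))
      ≤ μ {ω | Summable fun j => (a (Y j ω) : ℝ)} := by
    intro n
    have hm : Measurable fun x => ENNReal.ofReal (Real.exp (-(b n x : ℝ))) := by
      have := hb n; fun_prop
    have := h.lintegral_infProd _ hm (fun x => ofReal_exp_neg_le_one _) (by
      simp_rw [one_sub_ofReal_exp_neg]
      exact ((lintegral_mono (hbound n)).trans_lt hfin.lt_top).ne)
    simp_rw [one_sub_ofReal_exp_neg] at this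
    rw [← this, ← lintegral_indicator_one hmeas]
    refine lintegral_mono fun ω => ?_
    by_cases hs : Summable fun j => (a (Y j ω) : ℝ)
    · rw [indicator_of_mem (show ω ∈ {ω | Summable fun j => (a (Y j ω) : ℝ)} from hs)]
      exact infProd_le_one _ _
    · rw [infProd_exp_of_not_summable]
      · exact zero_le
      · intro hs'
        refine hs ((hs'.mul_left ((n : ℝ) + 1)).congr fun j => ?_)
        have : (n : ℝ) + 1 ≠ 0 := by positivity
        simp only [b, NNReal.coe_div, NNReal.coe_add, NNReal.coe_natCast, NNReal.coe_one]
        field_simp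
  have h1 : Tendsto (fun n => ENNReal.ofReal (Real.exp
      (-(∫⁻ x, ENNReal.ofReal (1 - Real.exp (-(b n x : ℝ))) ∂Λ).toReal))) atTop (𝓝 1) := by
    have := ((ENNReal.continuous_ofReal.comp Real.continuous_exp).tendsto _).comp
      ((ENNReal.tendsto_toReal ENNReal.zero_ne_top).comp hlim).neg
    simpa [Function.comp_def] using this
  exact (mem_ae_iff_prob_eq_one hmeas).2 (le_antisymm prob_le_one (le_of_tendsto' h1 hle))

lemma ae_finite_of_measure_ne_top [IsProbabilityMeasure μ] (h : HasPoissonPGFL Y Λ μ) {B : Set S}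
    (hB : MeasurableSet B) (hΛ : Λ B ≠ ∞) : ∀ᵐ ω ∂μ, {j | Y j ω ∈ B}.Finite := by
  classical
  have := h.ae_summable (a := B.indicator 1) (measurable_one.indicator hB) (by
    refine ((lintegral_mono (g := B.indicator 1) fun x => ?_).trans_lt
      ((lintegral_indicator_one hB).trans_lt hΛ.lt_top)).ne
    by_cases hx : x ∈ B <;> simp [hx, Real.exp_nonneg])
  filter_upwards [this] with ω hω
  have h0 := hω.tendsto_cofinite_zero.eventually (gt_mem_nhds one_pos)
  refine (eventually_cofinite.1 h0).subset fun j hj => ?_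
  have hj' : Y j ω ∈ B := hj
  simp [hj']

lemma measure_two_mem_le [IsProbabilityMeasure μ] (h : HasPoissonPGFL Y Λ μ) {B : Set S}
    (hB : MeasurableSet B) (hΛ : Λ B ≠ ∞) :
    μ {ω | ∃ i j, i ≠ j ∧ Y i ω ∈ B ∧ Y j ω ∈ B} ≤ ENNReal.ofReal ((Λ B).toReal ^ 2) := by
  classical
  set A : Set Ω := {ω | ∃ i j, i ≠ j ∧ Y i ω ∈ B ∧ Y j ω ∈ B}
  have hA : MeasurableSet A := by
    have : A = ⋃ i, ⋃ j, ⋃ (_ : i ≠ j), (Y i ⁻¹' B ∩ Y j ⁻¹' B) := by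
      ext; simp only [A, mem_iUnion, mem_inter_iff, mem_preimage, mem_ofPred_eq, exists_prop]
    rw [this]
    exact .iUnion fun i => .iUnion fun j => .iUnion fun _ =>
      (h.measurable i hB).inter (h.measurable j hB)
  let g : S → ℝ≥0∞ := fun x => if x ∈ B then 2⁻¹ else 1
  have hg : Measurable g := Measurable.ite hB measurable_const measurable_const
  have hg1 : ∀ x, g x ≤ 1 := fun x => by
    simp only [g]; split_ifs <;> simp
  have hsub : ∀ x, 1 - g x = B.indicator (fun _ => 2⁻¹) x := fun x => by
    by_cases hx : x ∈ B
    · simp [g, hx]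
    · simp [g, hx]
  have hint : ∫⁻ x, 1 - g x ∂Λ = 2⁻¹ * Λ B := by
    simp_rw [hsub]
    rw [lintegral_indicator_const hB]
  have hpg := h.lintegral_infProd g hg hg1 (by
    rw [hint]; exact ENNReal.mul_ne_top (by simp) hΛ)
  have h0 := h.measure_forall_notMem hB hΛ
  have hm0 : MeasurableSet {ω | ∀ j, Y j ω ∉ B} := by
    rw [ofPred_forall]
    exact .iInter fun j => (h.measurable j hB).compl
  have hpt : ∀ ω, A.indicator (fun _ => (2⁻¹ : ℝ≥0∞)) ω + 2 * infProd g (fun j => Y j ω)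
      ≤ 1 + {ω | ∀ j, Y j ω ∉ B}.indicator 1 ω := by
    intro ω
    by_cases h2 : ω ∈ A
    · obtain ⟨i, j, hij, hi, hj⟩ := h2
      have hA' : ω ∈ A := ⟨i, j, hij, hi, hj⟩
      have := infProd_le_prod hg1 (fun j => Y j ω) {i, j}
      rw [Finset.prod_pair hij] at this
      simp only [g, hi, hj, if_true] at this
      rw [indicator_of_mem hA']
      calc (2⁻¹ : ℝ≥0∞) + 2 * infProd g (fun j => Y j ω)
          ≤ 2⁻¹ + 2 * (2⁻¹ * 2⁻¹) := by gcongr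
        _ = 1 := by
          rw [← mul_assoc, ENNReal.mul_inv_cancel (by simp) (by simp), one_mul,
            ENNReal.inv_two_add_inv_two]
        _ ≤ _ := le_self_add
    · rw [indicator_of_notMem h2, zero_add]
      by_cases h1 : ∀ j, Y j ω ∉ B
      · rw [indicator_of_mem (show ω ∈ {ω | ∀ j, Y j ω ∉ B} from h1)]
        calc 2 * infProd g (fun j => Y j ω) ≤ 2 * 1 := by gcongr; exact infProd_le_one _ _
          _ = 1 + 1 := by norm_num
      · push Not at h1
        obtain ⟨j, hj⟩ := h1
        have := infProd_le_prod hg1 (fun j => Y j ω) {j}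
        simp only [Finset.prod_singleton, g, hj, if_true] at this
        calc 2 * infProd g (fun j => Y j ω) ≤ 2 * 2⁻¹ := by gcongr
          _ = 1 := ENNReal.mul_inv_cancel (by simp) (by simp)
          _ ≤ _ := le_self_add
  have hI := lintegral_mono (μ := μ) hpt
  rw [lintegral_add_left (measurable_const.indicator hA), lintegral_indicator_const hA,
    lintegral_const_mul _ (measurable_infProd hg h.measurable), hpg,
    lintegral_add_left measurable_const, lintegral_indicator_one hm0, h0, hint] at hI
  simp only [lintegral_const, measure_univ, mul_one, ENNReal.toReal_mul, ENNReal.toReal_inv,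
    ENNReal.toReal_ofNat] at hI
  set l := (Λ B).toReal
  have hl : 0 ≤ l := ENNReal.toReal_nonneg
  rw [← ENNReal.ofReal_toReal (measure_ne_top μ A)] at hI ⊢
  have e2 : (2 : ℝ≥0∞) = ENNReal.ofReal 2 := by simp
  rw [← ENNReal.ofReal_one, e2, ← ENNReal.ofReal_inv_of_pos two_pos,
    ← ENNReal.ofReal_mul (by norm_num), ← ENNReal.ofReal_mul (by norm_num),
    ← ENNReal.ofReal_add (by positivity) (by positivity),
    ← ENNReal.ofReal_add (by positivity) (by positivity),
    ENNReal.ofReal_le_ofReal_iff (by positivity)] at hI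
  refine ENNReal.ofReal_le_ofReal ?_
  have hsq : Real.exp (-l) = Real.exp (-(2⁻¹ * l)) ^ 2 := by
    rw [← Real.exp_nat_mul]; congr 1; push_cast; ring
  have hlow : 1 - 2⁻¹ * l ≤ Real.exp (-(2⁻¹ * l)) := by
    have := Real.add_one_le_exp (-(2⁻¹ * l)); linarith
  have hup : Real.exp (-(2⁻¹ * l)) ≤ 1 := by
    rw [Real.exp_le_one_iff]; linarith
  rw [hsq] at hI
  nlinarith [mul_self_nonneg l]

end HasPoissonPGFL

/-! ### The smallest value of a function on a Poisson process -/

namespace HasPoissonPGFL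

variable {Ω S : Type*} [MeasurableSpace Ω] [MeasurableSpace S] {Y : ℕ → Ω → S} {Λ : Measure S}
  {μ : Measure Ω} {t : S → ℝ} {H : ℝ → ℝ}

lemma ae_forall_pos [IsProbabilityMeasure μ] (h : HasPoissonPGFL Y Λ μ) (ht : Measurable t)
    (ht0 : Λ {x | t x ≤ 0} = 0) : ∀ᵐ ω ∂μ, ∀ j, 0 < t (Y j ω) := by
  have hB : MeasurableSet {x | t x ≤ 0} := ht measurableSet_Iic
  have h1 := h.measure_forall_notMem hB (by simp [ht0])
  have hm : MeasurableSet {ω | ∀ j, Y j ω ∉ {x | t x ≤ 0}} := by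
    rw [ofPred_forall]
    exact .iInter fun j => (h.measurable j hB).compl
  have h2 := (mem_ae_iff_prob_eq_one hm).2 (by rw [h1, ht0]; simp)
  filter_upwards [h2] with ω hω j
  simpa using hω j

lemma ae_forall_finite_le [IsProbabilityMeasure μ] (h : HasPoissonPGFL Y Λ μ) (ht : Measurable t)
    (hfin : ∀ r, Λ {x | t x ≤ r} ≠ ∞) : ∀ᵐ ω ∂μ, ∀ r, {j | t (Y j ω) ≤ r}.Finite := by
  have : ∀ᵐ ω ∂μ, ∀ n : ℕ, {j | Y j ω ∈ {x | t x ≤ n}}.Finite :=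
    ae_all_iff.2 fun n => h.ae_finite_of_measure_ne_top (ht measurableSet_Iic) (hfin n)
  filter_upwards [this] with ω hω r
  obtain ⟨n, hn⟩ := exists_nat_ge r
  exact (hω n).subset fun j hj => le_trans (show t (Y j ω) ≤ r from hj) hn

lemma measure_Ioc (ht : Measurable t) (hH : ∀ r, 0 ≤ r → Λ {x | t x ≤ r} = ENNReal.ofReal (H r))
    (hH0 : ∀ r, 0 ≤ r → 0 ≤ H r) {a b : ℝ} (ha : 0 ≤ a) (hab : a ≤ b) :
    Λ {x | t x ∈ Ioc a b} = ENNReal.ofReal (H b - H a) := by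
  have h1 : {x | t x ∈ Ioc a b} = {x | t x ≤ b} \ {x | t x ≤ a} := by
    ext x; simp [and_comm]
  rw [h1, measure_sdiff (show {x | t x ≤ a} ⊆ {x | t x ≤ b} from
      fun x hx => le_trans (show t x ≤ a from hx) hab)
    (ht measurableSet_Iic).nullMeasurableSet (by rw [hH a ha]; simp), hH a ha, hH b (ha.trans hab),
    ENNReal.ofReal_sub _ (hH0 a ha)]

lemma ae_injective [IsProbabilityMeasure μ] (h : HasPoissonPGFL Y Λ μ) (ht : Measurable t)
    (hHc : Continuous H) (hH : ∀ r, 0 ≤ r → Λ {x | t x ≤ r} = ENNReal.ofReal (H r))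
    (hH0 : ∀ r, 0 ≤ r → 0 ≤ H r) (hHm : MonotoneOn H (Ici 0)) (hz : H 0 = 0) :
    ∀ᵐ ω ∂μ, Function.Injective fun j => t (Y j ω) := by
  have ht0 : Λ {x | t x ≤ 0} = 0 := by rw [hH 0 le_rfl, hz]; simp
  have key : ∀ R : ℕ, μ {ω | ∃ i j, i ≠ j ∧ t (Y i ω) = t (Y j ω) ∧ t (Y i ω) ∈ Ioc (0 : ℝ) R}
      = 0 := by
    intro R
    set A : Set Ω := {ω | ∃ i j, i ≠ j ∧ t (Y i ω) = t (Y j ω) ∧ t (Y i ω) ∈ Ioc (0 : ℝ) R}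
    have hbound : ∀ ε > 0, μ A ≤ ENNReal.ofReal (ε * H R) := by
      intro ε hε
      have huc := isCompact_Icc (a := (0 : ℝ)) (b := R) |>.uniformContinuousOn_of_continuous
        hHc.continuousOn
      obtain ⟨δ, hδ, hd⟩ := Metric.uniformContinuousOn_iff.1 huc ε hε
      obtain ⟨n, hn⟩ := exists_nat_gt ((R : ℝ) / δ)
      have hn0 : (0 : ℝ) < n := lt_of_le_of_lt (by positivity) hn
      let b : ℕ → ℝ := fun k => R * k / n
      have hb0 : ∀ k, 0 ≤ b k := fun k => by positivity
      have hbm : ∀ k, b k ≤ b (k + 1) := fun k => by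
        simp only [b]; gcongr; simp
      have hbR : ∀ k, k ≤ n → b k ≤ R := fun k hk => by
        have : (k : ℝ) ≤ n := by exact_mod_cast hk
        simp only [b]
        rw [div_le_iff₀ hn0]; gcongr
      have hsub : A ⊆ ⋃ k ∈ Finset.range n, {ω | ∃ i j, i ≠ j ∧
          Y i ω ∈ {x | t x ∈ Ioc (b k) (b (k + 1))} ∧ Y j ω ∈ {x | t x ∈ Ioc (b k) (b (k + 1))}} := by
        rintro ω ⟨i, j, hij, he, hi⟩
        have hR0 : (0 : ℝ) < R := hi.1.trans_le hi.2
        set u := t (Y i ω) * n / R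
        have hu : 0 < u := by have := hi.1; positivity
        have huk : t (Y i ω) = R * u / n := by simp only [u]; field_simp
        obtain ⟨k, hk⟩ : ∃ k, ⌈u⌉₊ = k + 1 :=
          Nat.exists_eq_succ_of_ne_zero (Nat.ceil_pos.2 hu).ne'
        have hun : u ≤ n := by
          simp only [u]; rw [div_le_iff₀ hR0, mul_comm]; gcongr; exact hi.2
        have hkn : k + 1 ≤ n := by rw [← hk]; exact Nat.ceil_le.2 hun
        have h1 : (k : ℝ) < u := by
          have := Nat.lt_ceil.1 (show k < ⌈u⌉₊ by omega); exact this
        have h2 : u ≤ ((k + 1 : ℕ) : ℝ) := by rw [← hk]; exact Nat.le_ceil u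
        have hmem : t (Y i ω) ∈ Ioc (b k) (b (k + 1)) := by
          rw [huk]
          constructor
          · simp only [b]; gcongr
          · simp only [b]; gcongr
        simp only [mem_iUnion, Finset.mem_range]
        exact ⟨k, by omega, i, j, hij, hmem, by
          show t (Y j ω) ∈ Ioc (b k) (b (k + 1))
          rw [← he]; exact hmem⟩
      have hcell : ∀ k ∈ Finset.range n, μ {ω | ∃ i j, i ≠ j ∧
          Y i ω ∈ {x | t x ∈ Ioc (b k) (b (k + 1))} ∧ Y j ω ∈ {x | t x ∈ Ioc (b k) (b (k + 1))}}
          ≤ ENNReal.ofReal (ε * (H (b (k + 1)) - H (b k))) := by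
        intro k hk
        rw [Finset.mem_range] at hk
        have hΛ := measure_Ioc (Λ := Λ) ht hH hH0 (hb0 k) (hbm k)
        have hnn : 0 ≤ H (b (k + 1)) - H (b k) :=
          sub_nonneg.2 (hHm (hb0 k) (hb0 (k + 1)) (hbm k))
        refine (h.measure_two_mem_le (B := {x | t x ∈ Ioc (b k) (b (k + 1))})
          (ht measurableSet_Ioc) (by rw [hΛ]; simp)).trans ?_
        rw [hΛ, ENNReal.toReal_ofReal hnn, sq]
        refine ENNReal.ofReal_le_ofReal (mul_le_mul_of_nonneg_right ?_ hnn)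
        have hdist : dist (b (k + 1)) (b k) < δ := by
          have : b (k + 1) - b k = R / n := by simp only [b]; push_cast; ring
          rw [Real.dist_eq, this, abs_of_nonneg (by positivity), div_lt_iff₀ hn0]
          rwa [div_lt_iff₀ hδ, mul_comm] at hn
        have := hd _ ⟨hb0 _, hbR _ (by omega)⟩ _ ⟨hb0 _, hbR _ (by omega)⟩ hdist
        rw [Real.dist_eq] at this
        exact (le_abs_self _).trans this.le
      calc μ A ≤ ∑ k ∈ Finset.range n, ENNReal.ofReal (ε * (H (b (k + 1)) - H (b k))) :=
            (measure_mono hsub).trans ((measure_biUnion_finset_le _ _).trans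
              (Finset.sum_le_sum hcell))
        _ = ENNReal.ofReal (ε * H R) := by
          rw [← ENNReal.ofReal_sum_of_nonneg, ← Finset.mul_sum,
            Finset.sum_range_sub (fun k => H (b k))]
          · have : b n = R := by simp only [b]; field_simp
            simp [this, b, hz]
          · intro k _
            exact mul_nonneg hε.le (sub_nonneg.2 (hHm (hb0 k) (hb0 (k + 1)) (hbm k)))
    have hlim : Tendsto (fun ε => ENNReal.ofReal (ε * H R)) (𝓝[>] 0) (𝓝 0) := by
      have h1 : Continuous fun ε : ℝ => ENNReal.ofReal (ε * H R) :=
        ENNReal.continuous_ofReal.comp (by fun_prop)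
      simpa using (h1.tendsto 0).mono_left nhdsWithin_le_nhds
    exact le_antisymm (ge_of_tendsto hlim (eventually_nhdsWithin_of_forall hbound)) zero_le
  have hall := ae_all_iff.2 fun R => measure_eq_zero_iff_ae_notMem.1 (key R)
  filter_upwards [hall, h.ae_forall_pos ht ht0] with ω h1 h2 i j hij
  by_contra hne
  obtain ⟨R, hR⟩ := exists_nat_ge (t (Y i ω))
  exact h1 R ⟨i, j, hne, hij, h2 i, hR⟩

/-- The smallest value is almost surely attained exactly once. -/
theorem ae_exists_forall_lt [IsProbabilityMeasure μ] (h : HasPoissonPGFL Y Λ μ) (ht : Measurable t)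
    (hHc : Continuous H) (hH : ∀ r, 0 ≤ r → Λ {x | t x ≤ r} = ENNReal.ofReal (H r))
    (hH0 : ∀ r, 0 ≤ r → 0 ≤ H r) (hHm : MonotoneOn H (Ici 0)) (hz : H 0 = 0) :
    ∀ᵐ ω ∂μ, ∃ j, ∀ i, i ≠ j → t (Y j ω) < t (Y i ω) := by
  have hfin : ∀ r, Λ {x | t x ≤ r} ≠ ∞ := fun r => by
    refine ((measure_mono fun x hx => ?_).trans_lt
      ((hH (max r 0) (le_max_right _ _)).trans_lt ENNReal.ofReal_lt_top)).ne
    exact le_trans (show t x ≤ r from hx) (le_max_left _ _)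
  filter_upwards [h.ae_injective ht hHc hH hH0 hHm hz, h.ae_forall_finite_le ht hfin]
    with ω hinj hf
  obtain ⟨j, hj, hmin⟩ := exists_min_image _ (fun j => t (Y j ω)) (hf (t (Y 0 ω)))
    ⟨0, le_refl (t (Y 0 ω))⟩
  refine ⟨j, fun i hi => lt_of_le_of_ne ?_ fun he => hi (hinj he).symm⟩
  by_cases hi0 : t (Y i ω) ≤ t (Y 0 ω)
  · exact hmin i hi0
  · exact le_trans (show t (Y j ω) ≤ t (Y 0 ω) from hj) (not_le.1 hi0).le

variable {T : Ω → ℝ}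

lemma measure_lt_min (h : HasPoissonPGFL Y Λ μ) (ht : Measurable t)
    (hH : ∀ r, 0 ≤ r → Λ {x | t x ≤ r} = ENNReal.ofReal (H r)) (hH0 : ∀ r, 0 ≤ r → 0 ≤ H r)
    (hT : ∀ᵐ ω ∂μ, ∃ j, T ω = t (Y j ω) ∧ ∀ i, i ≠ j → t (Y j ω) < t (Y i ω))
    {r : ℝ} (hr : 0 ≤ r) : μ {ω | r < T ω} = ENNReal.ofReal (Real.exp (-H r)) := by
  have h1 := h.measure_forall_notMem (B := {x | t x ≤ r}) (ht measurableSet_Iic)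
    (by rw [hH r hr]; simp)
  rw [hH r hr, ENNReal.toReal_ofReal (hH0 r hr)] at h1
  rw [← h1]
  refine measure_congr ?_
  filter_upwards [hT] with ω ⟨j, hj, hmin⟩
  refine propext ⟨fun (hω : r < T ω) i => ?_, fun (hω : ∀ j, Y j ω ∉ {x | t x ≤ r}) => ?_⟩
  · refine not_le.2 ?_
    by_cases hi : i = j
    · rw [hi, ← hj]; exact hω
    · exact (hj ▸ hω).trans (hmin i hi)
  · show r < T ω
    rw [hj]
    simpa using hω j

end HasPoissonPGFL

/-! ### Sums over the points beyond the smallest value -/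

section Tail

set_option linter.unusedSectionVars false

variable {Ω S : Type*} [MeasurableSpace Ω] [MeasurableSpace S]

/-- The weight `w`, restricted to the points at which `t` exceeds `b`. -/
noncomputable def tailWeight (t : S → ℝ) (w : S → ℝ≥0) (b : ℝ) : S → ℝ≥0 :=
  {x | b < t x}.indicator w

/-- The total weight of the points at which `t` exceeds `b`. -/
noncomputable def tailSum (Y : ℕ → Ω → S) (t : S → ℝ) (w : S → ℝ≥0) (b : ℝ) (ω : Ω) : ℝ :=
  ∑' j, (tailWeight t w b (Y j ω) : ℝ)

/-- Exponent of the Laplace transform of `tailSum`. -/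
noncomputable def tailExponent (Λ : Measure S) (t : S → ℝ) (w : S → ℝ≥0) (b : ℝ) : ℝ≥0∞ :=
  ∫⁻ x, ENNReal.ofReal (1 - Real.exp (-(tailWeight t w b x : ℝ))) ∂Λ

variable {Y : ℕ → Ω → S} {Λ : Measure S} {μ : Measure Ω} {t : S → ℝ} {w : S → ℝ≥0}

lemma measurable_tailWeight (ht : Measurable t) (hw : Measurable w) (b : ℝ) :
    Measurable (tailWeight t w b) :=
  hw.indicator (ht measurableSet_Ioi)

lemma tailWeight_anti {b c : ℝ} (h : b ≤ c) (x : S) : tailWeight t w c x ≤ tailWeight t w b x :=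
  indicator_le_indicator_of_subset (fun _ hx => lt_of_le_of_lt h hx) (fun _ => zero_le) x

lemma tailWeight_eventuallyEq {u : ℕ → ℝ} {b : ℝ} (hb : ∀ n, b ≤ u n)
    (hu : Tendsto u atTop (𝓝 b)) (x : S) :
    ∀ᶠ n in atTop, tailWeight t w (u n) x = tailWeight t w b x := by
  by_cases hx : b < t x
  · filter_upwards [hu.eventually (gt_mem_nhds hx)] with n hn
    simp [tailWeight, hx, hn]
  · refine Eventually.of_forall fun n => ?_
    have : ¬ u n < t x := fun h => hx ((hb n).trans_lt h)
    simp [tailWeight, hx, this]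

lemma ofReal_one_sub_exp_mono {u v : ℝ≥0} (h : u ≤ v) :
    ENNReal.ofReal (1 - Real.exp (-(u : ℝ))) ≤ ENNReal.ofReal (1 - Real.exp (-(v : ℝ))) :=
  ENNReal.ofReal_le_ofReal (sub_le_sub_left (Real.exp_le_exp.2 (neg_le_neg
    (by exact_mod_cast h))) _)

lemma antitone_tailExponent : Antitone (tailExponent Λ t w) := fun _ _ h =>
  lintegral_mono fun x => ofReal_one_sub_exp_mono (tailWeight_anti h x)

lemma tendsto_tailExponent (ht : Measurable t) (hw : Measurable w) {u : ℕ → ℝ} {b : ℝ}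
    (hb : ∀ n, b ≤ u n) (hu : Tendsto u atTop (𝓝 b)) (hfin : tailExponent Λ t w b ≠ ∞) :
    Tendsto (fun n => tailExponent Λ t w (u n)) atTop (𝓝 (tailExponent Λ t w b)) := by
  refine tendsto_lintegral_of_dominated_convergence _ (fun n => ?_)
    (fun n => ae_of_all _ fun x => ofReal_one_sub_exp_mono (tailWeight_anti (hb n) x)) hfin
    (ae_of_all _ fun x => tendsto_const_nhds.congr' ?_)
  · have := measurable_tailWeight ht hw (u n)
    fun_prop
  · filter_upwards [tailWeight_eventuallyEq (w := w) hb hu x] with n hn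
    rw [hn]

lemma measurable_tailSum (hY : ∀ j, Measurable (Y j)) (ht : Measurable t) (hw : Measurable w)
    {K : Ω → ℝ} (hK : Measurable K) : Measurable fun ω => tailSum Y t w (K ω) ω := by
  refine Measurable.tsum fun j => ?_
  have : (fun ω => (tailWeight t w (K ω) (Y j ω) : ℝ))
      = {ω | K ω < t (Y j ω)}.indicator fun ω => (w (Y j ω) : ℝ) := by
    ext ω
    by_cases h : K ω < t (Y j ω) <;> simp [tailWeight, h]
  rw [this]
  exact (hw.comp (hY j)).coe_nnreal_real.indicator
    (measurableSet_lt hK (ht.comp (hY j)))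

lemma tailSum_nonneg (b : ℝ) (ω : Ω) : 0 ≤ tailSum Y t w b ω :=
  tsum_nonneg fun _ => NNReal.coe_nonneg _

/-- Approximation of `x > 0` from above by multiples of `1 / (n + 1)`. -/
noncomputable def ceilDiv (n : ℕ) (x : ℝ) : ℝ := ⌈x * (n + 1)⌉₊ / (n + 1)

lemma le_ceilDiv (n : ℕ) (x : ℝ) : x ≤ ceilDiv n x := by
  rw [ceilDiv, le_div_iff₀ (by positivity)]
  exact Nat.le_ceil _

lemma tendsto_ceilDiv {x : ℝ} (hx : 0 ≤ x) : Tendsto (fun n => ceilDiv n x) atTop (𝓝 x) := by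
  have h1 := (tendsto_one_div_add_atTop_nhds_zero_nat (𝕜 := ℝ)).const_add x
  rw [add_zero] at h1
  refine tendsto_of_tendsto_of_tendsto_of_le_of_le tendsto_const_nhds h1
    (fun n => le_ceilDiv n x) fun n => ?_
  have hn : (0 : ℝ) < n + 1 := by positivity
  have := (Nat.ceil_lt_add_one (a := x * (n + 1)) (by positivity)).le
  rw [ceilDiv, div_le_iff₀ hn]
  field_simp
  linarith

lemma measurable_ceilDiv (n : ℕ) : Measurable (ceilDiv n) := by
  unfold ceilDiv; fun_prop

namespace HasPoissonPGFL

lemma ae_summable_tailWeight [IsProbabilityMeasure μ] (h : HasPoissonPGFL Y Λ μ)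
    (ht : Measurable t) (hw : Measurable w) (hfin : ∀ b, 0 < b → tailExponent Λ t w b ≠ ∞) :
    ∀ᵐ ω ∂μ, ∀ b, 0 < b → Summable fun j => (tailWeight t w b (Y j ω) : ℝ) := by
  have : ∀ᵐ ω ∂μ, ∀ n : ℕ, Summable fun j => (tailWeight t w (1 / ((n : ℝ) + 1)) (Y j ω) : ℝ) :=
    ae_all_iff.2 fun n => h.ae_summable (measurable_tailWeight ht hw _) (hfin _ (by positivity))
  filter_upwards [this] with ω hω b hb
  obtain ⟨n, hn⟩ := exists_nat_one_div_lt hb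
  exact (hω n).of_nonneg_of_le (fun j => NNReal.coe_nonneg _) fun j =>
    NNReal.coe_le_coe.2 (tailWeight_anti hn.le _)

variable {T : Ω → ℝ}

/-- The points with `t ≤ c` and those with `t > b ≥ c` are independent. -/
lemma setLIntegral_exp_tailSum [IsProbabilityMeasure μ] (h : HasPoissonPGFL Y Λ μ)
    (ht : Measurable t) (hw : Measurable w) (hfin : ∀ b, 0 < b → tailExponent Λ t w b ≠ ∞)
    (hΛ : ∀ r, Λ {x | t x ≤ r} ≠ ∞) (hTm : Measurable T)
    (hT : ∀ᵐ ω ∂μ, ∃ j, T ω = t (Y j ω) ∧ ∀ i, i ≠ j → t (Y j ω) < t (Y i ω))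
    {b c : ℝ} (hb : 0 < b) (hcb : c ≤ b) :
    ∫⁻ ω in {ω | c < T ω}, ENNReal.ofReal (Real.exp (-tailSum Y t w b ω)) ∂μ
      = ENNReal.ofReal (Real.exp (-(tailExponent Λ t w b).toReal)) * μ {ω | c < T ω} := by
  classical
  have hBm : MeasurableSet {x | t x ≤ c} := ht measurableSet_Iic
  have hgm : Measurable fun x => ENNReal.ofReal (Real.exp (-(tailWeight t w b x : ℝ))) := by
    have := measurable_tailWeight ht hw b
    fun_prop
  have hgm' : Measurable fun x => ENNReal.ofReal (1 - Real.exp (-(tailWeight t w b x : ℝ))) := by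
    have := measurable_tailWeight ht hw b
    fun_prop
  have hi1 : ∀ x, ({x | t x ≤ c}ᶜ.indicator 1 : S → ℝ≥0∞) x ≤ 1 := fun x =>
    indicator_le_self' (fun _ _ => zero_le) x
  have hsub : ∀ x, 1 - ({x | t x ≤ c}ᶜ.indicator 1 : S → ℝ≥0∞) x *
      ENNReal.ofReal (Real.exp (-(tailWeight t w b x : ℝ)))
      = ({x | t x ≤ c}.indicator 1 : S → ℝ≥0∞) x
        + ENNReal.ofReal (1 - Real.exp (-(tailWeight t w b x : ℝ))) := fun x => by
    by_cases hx : t x ≤ c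
    · have hx' : ¬ b < t x := not_lt.2 (hx.trans hcb)
      simp [hx, hx', tailWeight]
    · simp only [not_le] at hx
      have : x ∈ {x | t x ≤ c}ᶜ := by simpa using hx
      rw [indicator_of_mem this, indicator_of_notMem (by simpa using hx), ← one_sub_ofReal_exp_neg]
      simp
  have hint : ∫⁻ x, 1 - ({x | t x ≤ c}ᶜ.indicator 1 : S → ℝ≥0∞) x *
      ENNReal.ofReal (Real.exp (-(tailWeight t w b x : ℝ))) ∂Λ
      = Λ {x | t x ≤ c} + tailExponent Λ t w b := by
    simp_rw [hsub]
    rw [lintegral_add_left (measurable_one.indicator hBm), lintegral_indicator_one hBm]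
    rfl
  have h1 := h.lintegral_infProd (fun x => ({x | t x ≤ c}ᶜ.indicator 1 : S → ℝ≥0∞) x *
      ENNReal.ofReal (Real.exp (-(tailWeight t w b x : ℝ))))
    ((measurable_one.indicator hBm.compl).mul hgm)
    (fun x => mul_le_one' (hi1 x) (ofReal_exp_neg_le_one _))
    (by rw [hint]; exact ENNReal.add_ne_top.2 ⟨hΛ c, hfin b hb⟩)
  rw [hint, ENNReal.toReal_add (hΛ c) (hfin b hb), neg_add, Real.exp_add,
    ENNReal.ofReal_mul (Real.exp_pos _).le, ← h.measure_forall_notMem hBm (hΛ c)] at h1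
  have hTc : MeasurableSet {ω | c < T ω} := hTm measurableSet_Ioi
  have hset : ({ω | ∀ j, Y j ω ∉ {x | t x ≤ c}} : Set Ω) =ᵐ[μ] {ω | c < T ω} := by
    filter_upwards [hT] with ω ⟨j, hj, hmin⟩
    refine propext ⟨fun (hω : ∀ j, Y j ω ∉ {x | t x ≤ c}) => ?_, fun (hω : c < T ω) i => ?_⟩
    · show c < T ω
      rw [hj]
      simpa using hω j
    · refine not_le.2 ?_
      by_cases hi : i = j
      · rw [hi, ← hj]; exact hω
      · exact (hj ▸ hω).trans (hmin i hi)
  rw [measure_congr hset] at h1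
  rw [mul_comm, ← h1, ← lintegral_indicator hTc]
  refine lintegral_congr_ae ?_
  filter_upwards [hset, h.ae_summable_tailWeight ht hw hfin] with ω hω hs
  rw [infProd_mul hi1 (fun x => ofReal_exp_neg_le_one _), infProd_exp_of_summable (hs b hb),
    infProd_indicator]
  have hω' : (∀ j, Y j ω ∉ {x | t x ≤ c}) ↔ c < T ω := iff_of_eq hω
  by_cases hc : c < T ω
  · rw [if_pos (show ∀ j, Y j ω ∈ {x | t x ≤ c}ᶜ from hω'.2 hc), one_mul,
      indicator_of_mem (show ω ∈ {ω | c < T ω} from hc)]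
    rfl
  · have : ¬ ∀ j, Y j ω ∈ {x | t x ≤ c}ᶜ := fun h' => hc (hω'.1 h')
    rw [if_neg this, zero_mul, indicator_of_notMem (show ω ∉ {ω | c < T ω} from hc)]

/-- Laplace transform of the total weight of the points other than the one with the smallest value
`T` of `t`, given `T`. -/
theorem setLIntegral_exp_tailSum_min [IsProbabilityMeasure μ] (h : HasPoissonPGFL Y Λ μ)
    (ht : Measurable t) (hw : Measurable w) (hfin : ∀ b, 0 < b → tailExponent Λ t w b ≠ ∞)
    (hΛ : ∀ r, Λ {x | t x ≤ r} ≠ ∞) (hTm : Measurable T)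
    (hT : ∀ᵐ ω ∂μ, ∃ j, T ω = t (Y j ω) ∧ ∀ i, i ≠ j → t (Y j ω) < t (Y i ω))
    {a : ℝ} (ha : 0 ≤ a) :
    ∫⁻ ω in {ω | a < T ω}, ENNReal.ofReal (Real.exp (-tailSum Y t w (T ω) ω)) ∂μ
      = ∫⁻ ω in {ω | a < T ω},
          ENNReal.ofReal (Real.exp (-(tailExponent Λ t w (T ω)).toReal)) ∂μ := by
  have hmeas : ∀ c, MeasurableSet {ω | c < T ω} := fun c => hTm measurableSet_Ioi
  have hm1 : ∀ K : Ω → ℝ, Measurable K →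
      Measurable fun ω => ENNReal.ofReal (Real.exp (-tailSum Y t w (K ω) ω)) := fun K hK =>
    (Real.measurable_exp.comp (measurable_tailSum h.measurable ht hw hK).neg).ennreal_ofReal
  have hm2 : ∀ K : Ω → ℝ, Measurable K → Measurable fun ω =>
      ENNReal.ofReal (Real.exp (-(tailExponent Λ t w (K ω)).toReal)) := fun K hK =>
    (Real.measurable_exp.comp
      ((antitone_tailExponent.measurable.comp hK).ennreal_toReal).neg).ennreal_ofReal
  have hle1 : ∀ b ω, ENNReal.ofReal (Real.exp (-tailSum Y t w b ω)) ≤ 1 := fun b ω => by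
    rw [ENNReal.ofReal_le_one, Real.exp_le_one_iff]
    exact neg_nonpos.2 (tailSum_nonneg b ω)
  have hdisc : ∀ n, ∫⁻ ω in {ω | a < T ω},
        ENNReal.ofReal (Real.exp (-tailSum Y t w (ceilDiv n (T ω)) ω)) ∂μ
      = ∫⁻ ω in {ω | a < T ω},
          ENNReal.ofReal (Real.exp (-(tailExponent Λ t w (ceilDiv n (T ω))).toReal)) ∂μ := by
    intro n
    have hn : (0 : ℝ) < n + 1 := by positivity
    let D : ℕ → Set Ω := fun k => {ω | a < T ω} ∩ {ω | ⌈T ω * (n + 1)⌉₊ = k}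
    have hDm : ∀ k, MeasurableSet (D k) := fun k =>
      (hmeas a).inter ((Nat.measurable_ceil.comp (hTm.mul_const _)) (measurableSet_singleton k))
    have hDd : Pairwise (Function.onFun Disjoint D) := fun k l hkl => by
      refine Set.disjoint_left.2 fun ω hk hl => hkl ?_
      exact (show ⌈T ω * (n + 1)⌉₊ = k from hk.2).symm.trans hl.2
    have hU : {ω | a < T ω} = ⋃ k, D k := by
      ext ω; simp [D]
    rw [hU, lintegral_iUnion hDm hDd, lintegral_iUnion hDm hDd]
    congr 1; ext k
    have hb_eq : ∀ ω ∈ D k, ceilDiv n (T ω) = k / (n + 1) := fun ω hω => by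
      rw [ceilDiv, show ⌈T ω * (n + 1)⌉₊ = k from hω.2]
    have c1 : ∫⁻ ω in D k, ENNReal.ofReal (Real.exp (-tailSum Y t w (ceilDiv n (T ω)) ω)) ∂μ
        = ∫⁻ ω in D k, ENNReal.ofReal (Real.exp (-tailSum Y t w (k / (n + 1)) ω)) ∂μ :=
      setLIntegral_congr_fun (hDm k) fun ω hω => by simp only [hb_eq ω hω]
    have c2 : ∫⁻ ω in D k, ENNReal.ofReal (Real.exp
          (-(tailExponent Λ t w (ceilDiv n (T ω))).toReal)) ∂μ
        = ∫⁻ _ in D k, ENNReal.ofReal (Real.exp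
          (-(tailExponent Λ t w (k / (n + 1))).toReal)) ∂μ :=
      setLIntegral_congr_fun (hDm k) fun ω hω => by simp only [hb_eq ω hω]
    rw [c1, c2]
    rcases Nat.eq_zero_or_pos k with rfl | hk
    · have : D 0 = ∅ := by
        ext ω
        simp only [D, mem_inter_iff, mem_ofPred_eq, Nat.ceil_eq_zero, mem_empty_iff_false,
          iff_false, not_and, not_le]
        intro hω
        have := ha.trans_lt hω
        positivity
      simp [this]
    obtain ⟨l, rfl⟩ : ∃ l, k = l + 1 := ⟨k - 1, by omega⟩
    set b : ℝ := ((l + 1 : ℕ) : ℝ) / (n + 1) with hbdef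
    set c : ℝ := max a (l / (n + 1))
    have hb : 0 < b := by positivity
    have hD : D (l + 1) = {ω | c < T ω} \ {ω | b < T ω} := by
      ext ω
      simp only [D, mem_inter_iff, mem_ofPred_eq, Set.mem_sdiff, not_lt, c, max_lt_iff, and_assoc]
      refine and_congr_right fun _ => ?_
      rw [Nat.ceil_eq_iff (by omega), hbdef, div_lt_iff₀ hn, le_div_iff₀ hn]
      simp
    rcases le_total b c with hbc | hcb
    · have : D (l + 1) = ∅ := by
        rw [hD, sdiff_eq_empty]
        exact fun ω hω => lt_of_le_of_lt hbc hω
      simp [this]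
    have hsubset : {ω | b < T ω} ⊆ {ω | c < T ω} := fun ω hω => lt_of_le_of_lt hcb hω
    have e1 := h.setLIntegral_exp_tailSum ht hw hfin hΛ hTm hT hb hcb
    have e2 := h.setLIntegral_exp_tailSum ht hw hfin hΛ hTm hT hb le_rfl
    have hsplit : ∀ f : Ω → ℝ≥0∞, ∫⁻ ω in {ω | c < T ω}, f ω ∂μ
        = ∫⁻ ω in {ω | b < T ω}, f ω ∂μ + ∫⁻ ω in D (l + 1), f ω ∂μ := fun f => by
      rw [hD, ← lintegral_inter_add_sdiff f {ω | c < T ω} (hmeas b), inter_eq_right.2 hsubset]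
    rw [← setLIntegral_const, hsplit, hsplit, e2, setLIntegral_const] at e1
    exact (ENNReal.add_right_inj
      (ENNReal.mul_ne_top ENNReal.ofReal_ne_top (measure_ne_top _ _))).1 e1
  have haeT : ∀ᵐ ω ∂(μ.restrict {ω | a < T ω}), a < T ω := ae_restrict_mem (hmeas a)
  have hlim1 : Tendsto (fun n => ∫⁻ ω in {ω | a < T ω},
        ENNReal.ofReal (Real.exp (-tailSum Y t w (ceilDiv n (T ω)) ω)) ∂μ) atTop
      (𝓝 (∫⁻ ω in {ω | a < T ω}, ENNReal.ofReal (Real.exp (-tailSum Y t w (T ω) ω)) ∂μ)) := by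
    refine tendsto_lintegral_of_dominated_convergence (fun _ => 1)
      (fun n => hm1 _ ((measurable_ceilDiv n).comp hTm)) (fun n => ae_of_all _ fun ω => hle1 _ ω)
      (by simp) ?_
    filter_upwards [haeT, ae_restrict_of_ae (h.ae_summable_tailWeight ht hw hfin)] with ω hω hs
    have hT0 : 0 < T ω := ha.trans_lt hω
    have : Tendsto (fun n => tailSum Y t w (ceilDiv n (T ω)) ω) atTop
        (𝓝 (tailSum Y t w (T ω) ω)) := by
      refine tendsto_tsum_of_dominated_convergence (hs _ hT0) (fun j => ?_)
        (Eventually.of_forall fun n j => ?_)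
      · refine tendsto_const_nhds.congr' ?_
        filter_upwards [tailWeight_eventuallyEq (t := t) (w := w) (fun n => le_ceilDiv n (T ω))
          (tendsto_ceilDiv hT0.le) (Y j ω)] with n hn
        rw [hn]
      · rw [Real.norm_eq_abs, abs_of_nonneg (NNReal.coe_nonneg _)]
        exact NNReal.coe_le_coe.2 (tailWeight_anti (le_ceilDiv n (T ω)) _)
    exact ((ENNReal.continuous_ofReal.comp Real.continuous_exp).tendsto _).comp this.neg
  have hlim2 : Tendsto (fun n => ∫⁻ ω in {ω | a < T ω},
        ENNReal.ofReal (Real.exp (-(tailExponent Λ t w (ceilDiv n (T ω))).toReal)) ∂μ) atTop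
      (𝓝 (∫⁻ ω in {ω | a < T ω},
        ENNReal.ofReal (Real.exp (-(tailExponent Λ t w (T ω)).toReal)) ∂μ)) := by
    refine tendsto_lintegral_of_dominated_convergence (fun _ => 1)
      (fun n => hm2 _ ((measurable_ceilDiv n).comp hTm)) (fun n => ae_of_all _ fun ω => ?_)
      (by simp) ?_
    · rw [ENNReal.ofReal_le_one, Real.exp_le_one_iff]
      exact neg_nonpos.2 ENNReal.toReal_nonneg
    filter_upwards [haeT] with ω hω
    have hT0 : 0 < T ω := ha.trans_lt hω
    have := tendsto_tailExponent (Λ := Λ) ht hw (fun n => le_ceilDiv n (T ω))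
      (tendsto_ceilDiv hT0.le) (hfin _ hT0)
    exact ((ENNReal.continuous_ofReal.comp Real.continuous_exp).tendsto _).comp
      ((ENNReal.tendsto_toReal (hfin _ hT0)).comp this).neg
  simp_rw [hdisc] at hlim1
  exact tendsto_nhds_unique hlim1 hlim2

end HasPoissonPGFL

end Tail

/-! ### Radial integrals in the plane, and Gamma laws -/

lemma lintegral_fun_norm_plane {f : ℝ → ℝ≥0∞} (hf : Measurable f) :
    ∫⁻ x : EuclideanSpace ℝ (Fin 2), f ‖x‖
      = ENNReal.ofReal (2 * Real.pi) * ∫⁻ r in Ioi (0 : ℝ), ENNReal.ofReal r * f r := by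
  have hdim : Module.finrank ℝ (EuclideanSpace ℝ (Fin 2)) = 2 := by simp
  have h0 : ∫⁻ x : EuclideanSpace ℝ (Fin 2), f ‖x‖
      = ∫⁻ x : ({(0)}ᶜ : Set (EuclideanSpace ℝ (Fin 2))), f ‖x.1‖
          ∂((volume : Measure (EuclideanSpace ℝ (Fin 2))).comap Subtype.val) := by
    rw [lintegral_subtype_comap (measurableSet_singleton _).compl fun x => f ‖x‖,
      restrict_compl_singleton]
  have h1 := (volume : Measure (EuclideanSpace ℝ (Fin 2))).measurePreserving_homeomorphUnitSphereProd
    |>.lintegral_comp_emb (Homeomorph.measurableEmbedding _) (f ∘ Subtype.val ∘ Prod.snd)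
  simp only [Function.comp_def, homeomorphUnitSphereProd_apply_snd_coe] at h1
  rw [h0, h1, lintegral_prod _ (by fun_prop)]
  simp only [lintegral_const]
  rw [Measure.toSphere_apply_univ, hdim, mul_comm]
  congr 1
  · rw [EuclideanSpace.volume_ball_fin_two, ENNReal.ofReal_mul (by norm_num)]
    simp
  · have hd : Measurable fun r : Ioi (0 : ℝ) => ENNReal.ofReal ((r : ℝ) ^ (2 - 1)) := by fun_prop
    have hf' : Measurable fun r : Ioi (0 : ℝ) => f r := hf.comp measurable_subtype_coe
    rw [Measure.volumeIoiPow, lintegral_withDensity_eq_lintegral_mul _ hd hf']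
    simp only [Pi.mul_apply, Nat.add_one_sub_one, pow_one]
    exact lintegral_subtype_comap measurableSet_Ioi fun r => ENNReal.ofReal r * f r

lemma gammaPDFReal_mul_exp {a r c : ℝ} (hr : 0 < r) (hc : 0 ≤ c) (x : ℝ) :
    gammaPDFReal a r x * Real.exp (-(c * x))
      = (r / (r + c)) ^ a * gammaPDFReal a (r + c) x := by
  unfold gammaPDFReal
  split_ifs with hx
  · have : Real.exp (-((r + c) * x)) = Real.exp (-(r * x)) * Real.exp (-(c * x)) := by
      rw [← Real.exp_add]; ring_nf
    rw [this, Real.div_rpow hr.le (by positivity)]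
    have : (r + c) ^ a ≠ 0 := (Real.rpow_pos_of_pos (by positivity) a).ne'
    field_simp
  · simp

lemma ae_nonneg_gammaMeasure (a r : ℝ) : ∀ᵐ x ∂(gammaMeasure a r), 0 ≤ x := by
  have hm : Measurable (gammaPDF a r) := (measurable_gammaPDFReal a r).ennreal_ofReal
  rw [gammaMeasure, ae_withDensity_iff hm]
  refine ae_of_all _ fun x hx => ?_
  by_contra h
  exact hx (gammaPDF_of_neg (not_le.1 h))

lemma lintegral_exp_gammaMeasure {a r c : ℝ} (ha : 0 < a) (hr : 0 < r) (hc : 0 ≤ c) :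
    ∫⁻ x, ENNReal.ofReal (Real.exp (-(c * x))) ∂(gammaMeasure a r)
      = ENNReal.ofReal ((r / (r + c)) ^ a) := by
  have hm : Measurable (gammaPDF a r) := (measurable_gammaPDFReal a r).ennreal_ofReal
  rw [gammaMeasure, lintegral_withDensity_eq_lintegral_mul _ hm (by fun_prop)]
  have : ∀ x, (gammaPDF a r * fun x => ENNReal.ofReal (Real.exp (-(c * x)))) x
      = ENNReal.ofReal ((r / (r + c)) ^ a) * gammaPDF a (r + c) x := fun x => by
    rw [Pi.mul_apply, gammaPDF, gammaPDF, ← ENNReal.ofReal_mul (gammaPDFReal_nonneg ha hr x),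
      gammaPDFReal_mul_exp hr hc, ENNReal.ofReal_mul (by positivity)]
  simp_rw [this]
  have hm' : Measurable (gammaPDF a (r + c)) := (measurable_gammaPDFReal a _).ennreal_ofReal
  rw [lintegral_const_mul _ hm',
    lintegral_gammaPDF_eq_one ha (by positivity), mul_one]

lemma lintegral_one_sub_exp_gammaMeasure {m : ℕ} (hm : 0 < m) {c : ℝ} (hc : 0 ≤ c) :
    ∫⁻ x, ENNReal.ofReal (1 - Real.exp (-((c * x).toNNReal : ℝ))) ∂(gammaMeasure m m)
      = ENNReal.ofReal (1 - 1 / (1 + c / m) ^ m) := by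
  have hm' : (0 : ℝ) < m := by exact_mod_cast hm
  have : IsProbabilityMeasure (gammaMeasure m m) := isProbabilityMeasure_gammaMeasure hm' hm'
  have h1 : ∀ᵐ x ∂(gammaMeasure m m), ENNReal.ofReal (1 - Real.exp (-((c * x).toNNReal : ℝ)))
      = 1 - ENNReal.ofReal (Real.exp (-((c * x).toNNReal : ℝ))) :=
    ae_of_all _ fun x => (one_sub_ofReal_exp_neg _).symm
  have h2 : ∫⁻ x, ENNReal.ofReal (Real.exp (-((c * x).toNNReal : ℝ))) ∂(gammaMeasure m m)
      = ENNReal.ofReal (1 / (1 + c / m) ^ m) := by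
    have : ∫⁻ x, ENNReal.ofReal (Real.exp (-((c * x).toNNReal : ℝ))) ∂(gammaMeasure m m)
        = ∫⁻ x, ENNReal.ofReal (Real.exp (-(c * x))) ∂(gammaMeasure m m) := by
      refine lintegral_congr_ae ?_
      filter_upwards [ae_nonneg_gammaMeasure m m] with x hx
      rw [Real.coe_toNNReal _ (by positivity)]
    rw [this, lintegral_exp_gammaMeasure hm' hm' hc, Real.rpow_natCast]
    congr 1
    rw [← one_div_pow]
    congr 1
    field_simp
  rw [lintegral_congr_ae h1, lintegral_sub (by fun_prop) (by rw [h2]; simp)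
    (ae_of_all _ fun x => ofReal_exp_neg_le_one _), h2, ENNReal.ofReal_sub _ (by positivity)]
  simp

/-- The tail of a Gamma law with integer shape. -/
lemma gammaMeasure_Ioi {m : ℕ} (hm : 0 < m) {r : ℝ} (hr : 0 < r) {y : ℝ} (hy : 0 ≤ y) :
    gammaMeasure m r (Ioi y)
      = ENNReal.ofReal (Real.exp (-(r * y)) * ∑ k ∈ Finset.range m, (r * y) ^ k / k.factorial) := by
  have hm' : (0 : ℝ) < m := by exact_mod_cast hm
  obtain ⟨n, rfl⟩ : ∃ n, m = n + 1 := ⟨m - 1, by omega⟩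
  set g : ℝ → ℝ := fun x =>
    -(Real.exp (-(r * x)) * ∑ k ∈ Finset.range (n + 1), (r * x) ^ k / k.factorial)
  have hpdf : ∀ x, 0 ≤ x → gammaPDFReal ((n + 1 : ℕ) : ℝ) r x
      = r * (Real.exp (-(r * x)) * ((r * x) ^ n / n.factorial)) := fun x hx => by
    rw [gammaPDFReal, if_pos hx]
    have h1 : ((n + 1 : ℕ) : ℝ) - 1 = n := by push_cast; ring
    rw [h1, Real.rpow_natCast, Real.rpow_natCast]
    have h2 : Real.Gamma ((n + 1 : ℕ) : ℝ) = n.factorial := by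
      push_cast; exact Real.Gamma_nat_eq_factorial n
    rw [h2, mul_pow, pow_succ]
    ring
  have hder : ∀ k : ℕ, ∀ x, HasDerivAt (fun x => ∑ k ∈ Finset.range (k + 1),
      (r * x) ^ k / k.factorial) (r * ∑ k ∈ Finset.range k, (r * x) ^ k / k.factorial) x := by
    intro k x
    induction k with
    | zero => simpa using hasDerivAt_const x (1 : ℝ)
    | succ k ih =>
      have h1 : HasDerivAt (fun x : ℝ => (r * x) ^ (k + 1) / (k + 1).factorial)
          (r * ((r * x) ^ k / k.factorial)) x := by
        have := ((((hasDerivAt_id x).const_mul r).pow (k + 1)).div_const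
          ((k + 1).factorial : ℝ))
        refine this.congr_deriv ?_
        rw [Nat.factorial_succ]
        have : (k.factorial : ℝ) ≠ 0 := by positivity
        have : ((k : ℝ) + 1) ≠ 0 := by positivity
        push_cast
        simp only [id]
        field_simp
      have h2 := ih.add h1
      rw [Finset.sum_range_succ (n := k), mul_add]
      refine h2.congr_of_eventuallyEq (Eventually.of_forall fun x => ?_)
      exact Finset.sum_range_succ (fun k => (r * x) ^ k / (k.factorial : ℝ)) (k + 1)
  have hgd : ∀ x, HasDerivAt g (r * (Real.exp (-(r * x)) * ((r * x) ^ n / n.factorial))) x := by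
    intro x
    have he : HasDerivAt (fun x : ℝ => Real.exp (-(r * x))) (Real.exp (-(r * x)) * (-(r * 1))) x :=
      (((hasDerivAt_id x).const_mul r).neg).exp
    refine (he.mul (hder n x)).neg.congr_deriv ?_
    rw [Finset.sum_range_succ]
    ring
  have hlim : Tendsto g atTop (𝓝 0) := by
    have h1 : Tendsto (fun x : ℝ => ∑ k ∈ Finset.range (n + 1),
        (x ^ k * Real.exp (-x)) / k.factorial) atTop (𝓝 0) := by
      rw [← Finset.sum_const_zero (s := Finset.range (n + 1)) (ι := ℕ)]
      refine tendsto_finsetSum _ fun k _ => ?_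
      simpa using (Real.tendsto_pow_mul_exp_neg_atTop_nhds_zero k).div_const (k.factorial : ℝ)
    have h2 := (h1.comp (tendsto_id.const_mul_atTop hr)).neg
    rw [neg_zero] at h2
    refine h2.congr fun x => ?_
    simp only [Function.comp, g, id, Finset.mul_sum]
    congr 1
    exact Finset.sum_congr rfl fun k _ => by ring
  have hpos : ∀ x ∈ Ioi y, 0 ≤ r * (Real.exp (-(r * x)) * ((r * x) ^ n / n.factorial)) :=
    fun x hx => by
      have : 0 < x := hy.trans_lt hx
      positivity
  have hI := integral_Ioi_of_hasDerivAt_of_nonneg' (fun x (_ : x ∈ Ici y) => hgd x) hpos hlim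
  have hint := integrableOn_Ioi_deriv_of_nonneg' (fun x (_ : x ∈ Ici y) => hgd x) hpos hlim
  rw [gammaMeasure, withDensity_apply _ measurableSet_Ioi]
  have : ∫⁻ x in Ioi y, gammaPDF ((n + 1 : ℕ) : ℝ) r x = ∫⁻ x in Ioi y,
      ENNReal.ofReal (r * (Real.exp (-(r * x)) * ((r * x) ^ n / n.factorial))) :=
    setLIntegral_congr_fun measurableSet_Ioi fun x hx => by
      simp only [gammaPDF, hpdf x (hy.trans (le_of_lt hx))]
  rw [this, ← ofReal_integral_eq_lintegral_ofReal hint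
    ((ae_restrict_iff' measurableSet_Ioi).2 (ae_of_all _ hpos)), hI]
  simp [g]

/-! ### Elementary properties of the network -/

namespace Network

variable (N : Network)

lemma PL_pos (r : ℝ) : 0 < N.PL r := Real.exp_pos _

lemma PL_le_one {r : ℝ} (hr : 0 ≤ r) : N.PL r ≤ 1 := by
  rw [PL, Real.exp_le_one_iff]
  have := mul_nonneg N.β_pos.le hr
  linarith

lemma PN_nonneg {r : ℝ} (hr : 0 ≤ r) : 0 ≤ N.PN r := sub_nonneg.2 (N.PL_le_one hr)

lemma continuous_PL : Continuous N.PL := by unfold PL; fun_prop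

lemma continuous_PN : Continuous N.PN := continuous_const.sub N.continuous_PL

lemma ct_mem : N.ct ∈ Icc (0 : ℝ) 1 := by
  have h := N.φt_mem
  have hpi := Real.pi_pos
  exact ⟨div_nonneg h.1 (by positivity), div_le_one_of_le₀ h.2 (by positivity)⟩

lemma cr_mem : N.cr ∈ Icc (0 : ℝ) 1 := by
  have h := N.φr_mem
  have hpi := Real.pi_pos
  exact ⟨div_nonneg h.1 (by positivity), div_le_one_of_le₀ h.2 (by positivity)⟩

lemma p_nonneg (i : Fin 4) : 0 ≤ N.p i := by
  have h1 := N.ct_mem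
  have h2 := N.cr_mem
  have h3 := sub_nonneg.2 h1.2
  have h4 := sub_nonneg.2 h2.2
  fin_cases i
  exacts [mul_nonneg h1.1 h2.1, mul_nonneg h1.1 h4, mul_nonneg h3 h2.1, mul_nonneg h3 h4]

lemma sum_p : ∑ i, N.p i = 1 := by
  simp [p, Fin.sum_univ_four]; ring

lemma d_nonneg (i : Fin 4) : 0 ≤ N.d i := by
  have h1 := N.Mt_pos.le
  have h2 := N.Mr_pos.le
  have h3 := N.mt_nonneg
  have h4 := N.mr_nonneg
  fin_cases i
  exacts [mul_nonneg h1 h2, mul_nonneg h1 h4, mul_nonneg h3 h2, mul_nonneg h3 h4]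

lemma G_pos (x θ : ℝ) : 0 < N.G x θ := Real.rpow_pos_of_pos (by norm_num) _

lemma G_le_one (x θ : ℝ) : N.G x θ ≤ 1 := by
  refine Real.rpow_le_one_of_one_le_of_nonpos (by norm_num) ?_
  have : 0 ≤ min (12 * ((Real.arctan ((N.HBS - N.Hu) / x) - θ) / N.θ3dB) ^ 2) N.SLL :=
    le_min (by positivity) N.SLL_nonneg
  rw [neg_div]
  exact neg_nonpos.2 (by positivity)

lemma measurable_G (θ : ℝ) : Measurable fun x => N.G x θ := by
  unfold G
  exact measurable_const.pow (((((((Real.measurable_arctan.comp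
    (measurable_const.div measurable_id)).sub_const _).div_const _).pow_const 2).const_mul 12).min
    measurable_const).neg.div_const 10)

lemma m_pos' : (0 : ℝ) < N.m := by exact_mod_cast N.m_pos

lemma αN_pos : 0 < N.αN := two_pos.trans N.αN_gt

lemma mu_pos : 0 < N.mu := Real.rpow_pos_of_pos (div_pos N.CN_pos N.CL_pos) _

lemma kappa_pos : 0 < N.kappa := div_pos N.αL_pos N.αN_pos

lemma ReqInv_Req {r : ℝ} (hr : 0 ≤ r) : N.ReqInv (N.Req r) = r := by
  have h1 : 0 < N.CL / N.CN := div_pos N.CL_pos N.CN_pos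
  have hL := N.αL_pos.ne'
  have hN := N.αN_pos.ne'
  rw [ReqInv, Req, mu, kappa, Real.mul_rpow (Real.rpow_nonneg h1.le _) (Real.rpow_nonneg hr _),
    ← Real.rpow_mul h1.le, ← Real.rpow_mul hr,
    show 1 / N.αL * (N.αL / N.αN) = 1 / N.αN by field_simp,
    show N.αN / N.αL * (N.αL / N.αN) = 1 by field_simp, Real.rpow_one, ← mul_assoc,
    ← Real.mul_rpow (div_pos N.CN_pos N.CL_pos).le h1.le,
    div_mul_div_cancel₀ N.CL_pos.ne', div_self N.CN_pos.ne', Real.one_rpow, one_mul]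

lemma Req_nonneg {r : ℝ} (hr : 0 ≤ r) : 0 ≤ N.Req r :=
  mul_nonneg (Real.rpow_nonneg (div_pos N.CL_pos N.CN_pos).le _) (Real.rpow_nonneg hr _)

lemma ReqInv_nonneg {r : ℝ} (hr : 0 ≤ r) : 0 ≤ N.ReqInv r :=
  mul_nonneg N.mu_pos.le (Real.rpow_nonneg hr _)

lemma ReqInv_pos {r : ℝ} (hr : 0 < r) : 0 < N.ReqInv r :=
  mul_pos N.mu_pos (Real.rpow_pos_of_pos hr _)

lemma ReqInv_zero : N.ReqInv 0 = 0 := by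
  rw [ReqInv, Real.zero_rpow N.kappa_pos.ne', mul_zero]

lemma ReqInv_lt_ReqInv {r s : ℝ} (hr : 0 ≤ r) (h : r < s) : N.ReqInv r < N.ReqInv s :=
  mul_lt_mul_of_pos_left (Real.rpow_lt_rpow hr h N.kappa_pos) N.mu_pos

lemma continuous_ReqInv : Continuous N.ReqInv :=
  continuous_const.mul (Real.continuous_rpow_const N.kappa_pos.le)

lemma lt_Req_iff {r u : ℝ} (hr : 0 ≤ r) (hu : 0 ≤ u) : r < N.Req u ↔ N.ReqInv r < u := by
  constructor
  · intro h
    rw [← N.ReqInv_Req hu]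
    exact N.ReqInv_lt_ReqInv hr h
  · intro h
    by_contra hle
    rw [not_lt] at hle
    rcases hle.eq_or_lt with he | hlt
    · rw [← he, N.ReqInv_Req hu] at h
      exact lt_irrefl _ h
    · have := N.ReqInv_lt_ReqInv (N.Req_nonneg hu) hlt
      rw [N.ReqInv_Req hu] at this
      exact lt_asymm h this

lemma measurable_Req : Measurable N.Req := by
  unfold Req; fun_prop

lemma pathGain_nonneg (b : Bool) {u : ℝ} (hu : 0 ≤ u) : 0 ≤ N.pathGain b u := by
  have h1 := N.CL_pos.le
  have h2 := N.CN_pos.le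
  unfold pathGain
  split_ifs
  exacts [mul_nonneg h1 (Real.rpow_nonneg hu _), mul_nonneg h2 (Real.rpow_nonneg hu _)]

lemma measurable_pathGain (b : Bool) : Measurable (N.pathGain b) := by
  unfold pathGain
  split_ifs <;> fun_prop

/-- The equivalent LOS distance as a function of position and mark. -/
noncomputable def markDist (q : EuclideanSpace ℝ (Fin 2) × LinkMark) : ℝ :=
  if q.2.1 then ‖q.1‖ else N.Req ‖q.1‖

lemma measurable_markDist : Measurable N.markDist := by
  refine Measurable.ite ?_ measurable_fst.norm (N.measurable_Req.comp measurable_fst.norm)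
  exact (measurable_fst.comp measurable_snd) (measurableSet_singleton true)

lemma pathGain_eq_markDist (q : EuclideanSpace ℝ (Fin 2) × LinkMark) :
    N.pathGain q.2.1 ‖q.1‖ = N.CL * N.markDist q ^ (-N.αL) := by
  unfold markDist
  unfold pathGain
  split_ifs with h
  · rfl
  · have hn := norm_nonneg q.1
    have h1 : 0 < N.CL / N.CN := div_pos N.CL_pos N.CN_pos
    have hL := N.αL_pos.ne'
    rw [Req, Real.mul_rpow (Real.rpow_nonneg h1.le _) (Real.rpow_nonneg hn _),
      ← Real.rpow_mul h1.le, ← Real.rpow_mul hn,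
      show 1 / N.αL * -N.αL = -1 by field_simp, show N.αN / N.αL * -N.αL = -N.αN by field_simp,
      Real.rpow_neg_one, inv_div, ← mul_assoc, mul_div_cancel₀ _ N.CL_pos.ne']

lemma pathGain_lt_pathGain_iff {q q' : EuclideanSpace ℝ (Fin 2) × LinkMark}
    (hq : 0 < N.markDist q) (hq' : 0 < N.markDist q') :
    N.pathGain q.2.1 ‖q.1‖ < N.pathGain q'.2.1 ‖q'.1‖ ↔ N.markDist q' < N.markDist q := by
  rw [N.pathGain_eq_markDist, N.pathGain_eq_markDist, mul_lt_mul_iff_right₀ N.CL_pos,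
    Real.rpow_lt_rpow_iff_of_neg hq hq' (neg_neg_of_pos N.αL_pos)]

/-! ### The law of the marks -/

/-- Law of the gain state and the fading power of a link. -/
noncomputable def fadingLaw : Measure (Fin 4 × ℝ) := N.gainLaw.prod (gammaMeasure N.m N.m)

instance : IsProbabilityMeasure (gammaMeasure N.m N.m) :=
  isProbabilityMeasure_gammaMeasure N.m_pos' N.m_pos'

instance : IsProbabilityMeasure N.gainLaw := by
  constructor
  rw [gainLaw, Measure.finsetSum_apply]
  simp only [Measure.smul_apply, measure_univ, smul_eq_mul, mul_one]
  rw [← ENNReal.ofReal_sum_of_nonneg fun i _ => N.p_nonneg i, N.sum_p, ENNReal.ofReal_one]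

instance : IsProbabilityMeasure N.fadingLaw := by unfold fadingLaw; infer_instance

lemma lintegral_fadingLaw {f : Fin 4 × ℝ → ℝ≥0∞} (hf : Measurable f) :
    ∫⁻ y, f y ∂N.fadingLaw
      = ∑ i, ENNReal.ofReal (N.p i) * ∫⁻ h, f (i, h) ∂(gammaMeasure N.m N.m) := by
  rw [fadingLaw, lintegral_prod _ hf.aemeasurable, gainLaw, lintegral_finsetSum_measure]
  simp only [lintegral_smul_measure, lintegral_dirac, smul_eq_mul]

lemma isProbabilityMeasure_losLaw {r : ℝ} (hr : 0 ≤ r) : IsProbabilityMeasure (N.losLaw r) := by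
  constructor
  rw [losLaw]
  simp only [Measure.add_apply, Measure.smul_apply, measure_univ, smul_eq_mul, mul_one]
  rw [← ENNReal.ofReal_add (N.PL_pos r).le (N.PN_nonneg hr), PN]
  simp

instance (x : EuclideanSpace ℝ (Fin 2)) : IsProbabilityMeasure (N.markLaw x) := by
  have := N.isProbabilityMeasure_losLaw (norm_nonneg x)
  unfold markLaw
  infer_instance

lemma lintegral_markLaw (x : EuclideanSpace ℝ (Fin 2)) {f : LinkMark → ℝ≥0∞} (hf : Measurable f) :
    ∫⁻ y, f y ∂(N.markLaw x) = ENNReal.ofReal (N.PL ‖x‖) * ∫⁻ y, f (true, y) ∂N.fadingLaw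
      + ENNReal.ofReal (N.PN ‖x‖) * ∫⁻ y, f (false, y) ∂N.fadingLaw := by
  rw [markLaw, ← fadingLaw, lintegral_prod _ hf.aemeasurable, losLaw, lintegral_add_measure]
  simp only [lintegral_smul_measure, lintegral_dirac, smul_eq_mul]

/-- The law of the mark as a kernel. -/
noncomputable def markKernel : Kernel (EuclideanSpace ℝ (Fin 2)) LinkMark where
  toFun := N.markLaw
  measurable' := by
    refine Measure.measurable_of_measurable_coe _ fun s hs => ?_
    simp_rw [← lintegral_indicator_one hs, N.lintegral_markLaw _ (measurable_one.indicator hs)]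
    have h1 := N.continuous_PL.measurable
    have h2 := N.continuous_PN.measurable
    fun_prop

instance : IsMarkovKernel N.markKernel :=
  ⟨fun x => inferInstanceAs (IsProbabilityMeasure (N.markLaw x))⟩

/-- Intensity measure of the marked base stations. -/
noncomputable def intensity : Measure (EuclideanSpace ℝ (Fin 2) × LinkMark) :=
  (ENNReal.ofReal N.lam • volume) ⊗ₘ N.markKernel

lemma lintegral_intensity {f : EuclideanSpace ℝ (Fin 2) × LinkMark → ℝ≥0∞} (hf : Measurable f)
    {φ : Bool → ℝ → ℝ≥0∞} (hφ : ∀ b, Measurable (φ b))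
    (h : ∀ x b, ∫⁻ y, f (x, b, y) ∂N.fadingLaw = φ b ‖x‖) :
    ∫⁻ q, f q ∂N.intensity
      = (∫⁻ r in Ioi 0, ENNReal.ofReal (2 * Real.pi * N.lam * r * N.PL r) * φ true r)
        + ∫⁻ r in Ioi 0, ENNReal.ofReal (2 * Real.pi * N.lam * r * N.PN r) * φ false r := by
  have h1 := N.continuous_PL.measurable
  have h2 := N.continuous_PN.measurable
  have h3 := hφ true
  have h4 := hφ false
  have hpi := Real.pi_pos
  have hlam := N.lam_pos
  have hin : ∀ x, ∫⁻ y, f (x, y) ∂(N.markKernel x)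
      = ENNReal.ofReal (N.PL ‖x‖) * φ true ‖x‖ + ENNReal.ofReal (N.PN ‖x‖) * φ false ‖x‖ :=
    fun x => by
      rw [← h, ← h]
      exact N.lintegral_markLaw x (hf.comp measurable_prodMk_left)
  rw [intensity, Measure.lintegral_compProd hf, lintegral_smul_measure]
  simp_rw [hin]
  rw [lintegral_fun_norm_plane (f := fun r => ENNReal.ofReal (N.PL r) * φ true r
      + ENNReal.ofReal (N.PN r) * φ false r) (by fun_prop), smul_eq_mul, ← mul_assoc,
    ← ENNReal.ofReal_mul N.lam_pos.le, ← lintegral_const_mul _ (by fun_prop),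
    ← lintegral_add_left (by fun_prop)]
  refine setLIntegral_congr_fun measurableSet_Ioi fun r hr => ?_
  have hr' : 0 ≤ r := le_of_lt hr
  have e1 : ENNReal.ofReal (2 * Real.pi * N.lam * r * N.PL r) = ENNReal.ofReal
      (N.lam * (2 * Real.pi)) * (ENNReal.ofReal r * ENNReal.ofReal (N.PL r)) := by
    rw [← ENNReal.ofReal_mul hr', ← ENNReal.ofReal_mul (by positivity)]
    ring_nf
  have e2 : ENNReal.ofReal (2 * Real.pi * N.lam * r * N.PN r) = ENNReal.ofReal
      (N.lam * (2 * Real.pi)) * (ENNReal.ofReal r * ENNReal.ofReal (N.PN r)) := by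
    rw [← ENNReal.ofReal_mul hr', ← ENNReal.ofReal_mul (by positivity)]
    ring_nf
  simp only [e1, e2]
  ring

end Network

lemma lintegral_Ioi_mul_indicator_le {F f : ℝ → ℝ} (hF : ∀ x, HasDerivAt F (f x) x)
    (hf : Continuous f) (hf0 : ∀ x, 0 ≤ x → 0 ≤ f x) (hF0 : F 0 = 0) {c : ℝ} (hc : 0 ≤ c) :
    ∫⁻ u in Ioi (0 : ℝ), ENNReal.ofReal (f u) * (Iic c).indicator 1 u = ENNReal.ofReal (F c) := by
  have h1 : ∀ u, ENNReal.ofReal (f u) * (Iic c).indicator 1 u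
      = (Iic c).indicator (fun u => ENNReal.ofReal (f u)) u := fun u => by
    by_cases hu : u ≤ c <;> simp [indicator, hu]
  simp_rw [h1]
  rw [lintegral_indicator measurableSet_Iic, Measure.restrict_restrict measurableSet_Iic,
    inter_comm, Ioi_inter_Iic, ← ofReal_integral_eq_lintegral_ofReal
    (hf.integrableOn_Icc.mono_set Ioc_subset_Icc_self)
    ((ae_restrict_iff' measurableSet_Ioc).2 (ae_of_all _ fun u hu => hf0 u hu.1.le)),
    ← intervalIntegral.integral_of_le hc,
    intervalIntegral.integral_eq_sub_of_hasDerivAt (fun x _ => hF x) (hf.intervalIntegrable _ _),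
    hF0, sub_zero]

namespace Network

variable (N : Network)

/-! ### The intensity of the equivalent distances -/

/-- Mean number of LOS base stations within distance `r`. -/
noncomputable def losMean (r : ℝ) : ℝ :=
  2 * Real.pi * N.lam / N.β ^ 2 * (1 - (1 + N.β * r) * Real.exp (-(N.β * r)))

/-- Mean number of NLOS base stations within distance `r`. -/
noncomputable def nlosMean (r : ℝ) : ℝ :=
  2 * Real.pi * N.lam / N.β ^ 2
    * (N.β ^ 2 * r ^ 2 / 2 + (N.β * r + 1) * Real.exp (-(N.β * r)) - 1)

/-- Mean number of base stations within equivalent distance `r`. -/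
noncomputable def distMean (r : ℝ) : ℝ := N.losMean r + N.nlosMean (N.ReqInv r)

lemma hasDerivAt_exp_neg_β (r : ℝ) :
    HasDerivAt (fun r => Real.exp (-(N.β * r))) (Real.exp (-(N.β * r)) * (-(N.β * 1))) r :=
  (((hasDerivAt_id r).const_mul N.β).neg).exp

lemma hasDerivAt_losMean (r : ℝ) :
    HasDerivAt N.losMean (2 * Real.pi * N.lam * r * N.PL r) r := by
  have hβ := N.β_pos.ne'
  have h1 : HasDerivAt (fun r => 1 + N.β * r) (N.β * 1) r :=
    ((hasDerivAt_id r).const_mul N.β).const_add 1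
  refine (((h1.mul (N.hasDerivAt_exp_neg_β r)).const_sub 1).const_mul
    (2 * Real.pi * N.lam / N.β ^ 2)).congr_deriv ?_
  rw [PL]
  field_simp
  ring

lemma hasDerivAt_nlosMean (r : ℝ) :
    HasDerivAt N.nlosMean (2 * Real.pi * N.lam * r * N.PN r) r := by
  have hβ := N.β_pos.ne'
  have h1 : HasDerivAt (fun r => N.β * r + 1) (N.β * 1) r :=
    ((hasDerivAt_id r).const_mul N.β).add_const 1
  have h2 : HasDerivAt (fun r => N.β ^ 2 * r ^ 2 / 2) (N.β ^ 2 * r) r := by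
    refine (((hasDerivAt_pow 2 r).const_mul (N.β ^ 2)).div_const 2).congr_deriv ?_
    push_cast; ring
  refine (((h2.add (h1.mul (N.hasDerivAt_exp_neg_β r))).sub_const 1).const_mul
    (2 * Real.pi * N.lam / N.β ^ 2)).congr_deriv ?_
  rw [PN, PL]
  field_simp
  ring

lemma losMean_zero : N.losMean 0 = 0 := by simp [losMean]

lemma nlosMean_zero : N.nlosMean 0 = 0 := by simp [nlosMean]

lemma losDensity_nonneg {r : ℝ} (hr : 0 ≤ r) : 0 ≤ 2 * Real.pi * N.lam * r * N.PL r := by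
  have h1 := N.lam_pos
  have h2 := N.PL_pos r
  have h3 := Real.pi_pos
  positivity

lemma nlosDensity_nonneg {r : ℝ} (hr : 0 ≤ r) : 0 ≤ 2 * Real.pi * N.lam * r * N.PN r := by
  have h1 := N.lam_pos
  have h2 := N.PN_nonneg hr
  have h3 := Real.pi_pos
  positivity

lemma monotoneOn_losMean : MonotoneOn N.losMean (Ici 0) :=
  monotoneOn_of_hasDerivWithinAt_nonneg (convex_Ici 0)
    (fun x _ => (N.hasDerivAt_losMean x).continuousAt.continuousWithinAt)
    (fun x _ => (N.hasDerivAt_losMean x).hasDerivWithinAt) fun _ hx =>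
      N.losDensity_nonneg (interior_subset hx)

lemma monotoneOn_nlosMean : MonotoneOn N.nlosMean (Ici 0) :=
  monotoneOn_of_hasDerivWithinAt_nonneg (convex_Ici 0)
    (fun x _ => (N.hasDerivAt_nlosMean x).continuousAt.continuousWithinAt)
    (fun x _ => (N.hasDerivAt_nlosMean x).hasDerivWithinAt) fun _ hx =>
      N.nlosDensity_nonneg (interior_subset hx)

lemma monotoneOn_distMean : MonotoneOn N.distMean (Ici 0) := by
  intro r hr s hs hrs
  refine add_le_add (N.monotoneOn_losMean hr hs hrs)
    (N.monotoneOn_nlosMean (N.ReqInv_nonneg hr) (N.ReqInv_nonneg hs) ?_)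
  rcases hrs.eq_or_lt with rfl | h
  exacts [le_rfl, (N.ReqInv_lt_ReqInv hr h).le]

lemma distMean_zero : N.distMean 0 = 0 := by
  rw [distMean, N.ReqInv_zero, N.losMean_zero, N.nlosMean_zero, add_zero]

lemma distMean_nonneg {r : ℝ} (hr : 0 ≤ r) : 0 ≤ N.distMean r := by
  rw [← N.distMean_zero]
  exact N.monotoneOn_distMean self_mem_Ici hr hr

lemma continuous_distMean : Continuous N.distMean := by
  have h1 : Continuous N.losMean :=
    continuous_iff_continuousAt.2 fun x => (N.hasDerivAt_losMean x).continuousAt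
  have h2 : Continuous N.nlosMean :=
    continuous_iff_continuousAt.2 fun x => (N.hasDerivAt_nlosMean x).continuousAt
  exact h1.add (h2.comp N.continuous_ReqInv)

lemma tendsto_ReqInv : Tendsto N.ReqInv atTop atTop :=
  (tendsto_rpow_atTop N.kappa_pos).const_mul_atTop N.mu_pos

lemma tendsto_distMean : Tendsto N.distMean atTop atTop := by
  have hβ := N.β_pos
  have hc : 0 < 2 * Real.pi * N.lam / N.β ^ 2 := by
    have h1 := N.lam_pos
    have h3 := Real.pi_pos
    positivity
  have h1 : Tendsto (fun R : ℝ => 2 * Real.pi * N.lam / N.β ^ 2 * (N.β ^ 2 * R ^ 2 / 2 + -1))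
      atTop atTop :=
    (tendsto_atTop_add_const_right _ _ ((((tendsto_pow_atTop two_ne_zero).const_mul_atTop
      (by positivity)).atTop_div_const two_pos))).const_mul_atTop hc
  refine tendsto_atTop_mono' _ ?_ (h1.comp N.tendsto_ReqInv)
  filter_upwards [eventually_ge_atTop 0] with r hr
  have hR := N.ReqInv_nonneg hr
  have hA : 0 ≤ N.losMean r := by
    rw [← N.losMean_zero]
    exact N.monotoneOn_losMean self_mem_Ici hr hr
  have hB : 2 * Real.pi * N.lam / N.β ^ 2 * (N.β ^ 2 * (N.ReqInv r) ^ 2 / 2 + -1)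
      ≤ N.nlosMean (N.ReqInv r) := by
    refine mul_le_mul_of_nonneg_left ?_ hc.le
    have : 0 ≤ (N.β * N.ReqInv r + 1) * Real.exp (-(N.β * N.ReqInv r)) := by positivity
    linarith
  simp only [Function.comp, distMean]
  linarith

lemma intensity_markDist_le {r : ℝ} (hr : 0 ≤ r) :
    N.intensity {q | N.markDist q ≤ r} = ENNReal.ofReal (N.distMean r) := by
  have hm : MeasurableSet {q | N.markDist q ≤ r} := N.measurable_markDist measurableSet_Iic
  have h1 := N.continuous_PL
  have h2 := N.continuous_PN
  rw [← lintegral_indicator_one hm, N.lintegral_intensity (measurable_one.indicator hm)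
    (φ := fun b => (Iic (if b then r else N.ReqInv r)).indicator 1)
    (fun b => measurable_one.indicator measurableSet_Iic)]
  · simp only [if_true, Bool.false_eq_true, if_false]
    rw [lintegral_Ioi_mul_indicator_le N.hasDerivAt_losMean (by fun_prop)
        (fun x hx => N.losDensity_nonneg hx) N.losMean_zero hr,
      lintegral_Ioi_mul_indicator_le N.hasDerivAt_nlosMean (by fun_prop)
        (fun x hx => N.nlosDensity_nonneg hx) N.nlosMean_zero (N.ReqInv_nonneg hr), distMean,
      ENNReal.ofReal_add]
    · rw [← N.losMean_zero]
      exact N.monotoneOn_losMean self_mem_Ici hr hr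
    · rw [← N.nlosMean_zero]
      exact N.monotoneOn_nlosMean self_mem_Ici (N.ReqInv_nonneg hr) (N.ReqInv_nonneg hr)
  · intro x b
    have hiff : ∀ y, (x, b, y) ∈ {q | N.markDist q ≤ r}
        ↔ ‖x‖ ∈ Iic (if b then r else N.ReqInv r) := fun y => by
      cases b
      · have := N.lt_Req_iff hr (norm_nonneg x)
        simp only [markDist, mem_ofPred_eq, mem_Iic, Bool.false_eq_true, if_false]
        rw [← not_lt, this, not_lt]
      · simp [markDist]
    by_cases hx : ‖x‖ ∈ Iic (if b then r else N.ReqInv r)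
    · rw [indicator_of_mem hx]
      simp_rw [indicator_of_mem ((hiff _).2 hx)]
      simp
    · rw [indicator_of_notMem hx]
      simp_rw [indicator_of_notMem (fun h => hx ((hiff _).1 h))]
      simp

/-! ### The density of the serving distance -/

lemma fR_eq (r : ℝ) : N.fR r = 2 * Real.pi * N.lam * (r * Real.exp (-(N.β * r))
      + N.mu ^ 2 * N.kappa * r ^ (2 * N.kappa - 1) * (1 - Real.exp (-(N.β * N.ReqInv r))))
    * Real.exp (-N.distMean r) := by
  rw [fR, distMean, losMean, nlosMean, neg_add, Real.exp_add, mul_assoc, neg_mul, neg_mul]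

lemma fR_nonneg {r : ℝ} (hr : 0 ≤ r) : 0 ≤ N.fR r := by
  have h1 := N.lam_pos
  have h2 := N.PN_nonneg (N.ReqInv_nonneg hr)
  have h3 := Real.pi_pos
  have h4 := N.kappa_pos
  rw [PN, PL] at h2
  rw [fR_eq]
  positivity

lemma measurable_fR : Measurable N.fR := by
  have h1 := N.continuous_ReqInv.measurable
  unfold fR
  fun_prop

lemma hasDerivAt_exp_distMean {r : ℝ} (hr : 0 < r) :
    HasDerivAt (fun r => -Real.exp (-N.distMean r)) (N.fR r) r := by
  have hR : HasDerivAt N.ReqInv (N.mu * (N.kappa * r ^ (N.kappa - 1))) r :=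
    (Real.hasDerivAt_rpow_const (Or.inl hr.ne')).const_mul N.mu
  have h1 := (N.hasDerivAt_losMean r).add ((N.hasDerivAt_nlosMean (N.ReqInv r)).comp r hR)
  refine h1.neg.exp.neg.congr_deriv ?_
  have h2 : r ^ (2 * N.kappa - 1) = r ^ N.kappa * r ^ (N.kappa - 1) := by
    rw [← Real.rpow_add hr]; ring_nf
  rw [fR_eq, PL, PN, PL, h2]
  have h3 : N.ReqInv r = N.mu * r ^ N.kappa := rfl
  simp only [distMean, Pi.neg_apply, Pi.add_apply, Function.comp]
  generalize Real.exp (-(N.β * N.ReqInv r)) = e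
  generalize Real.exp (-(N.losMean r + N.nlosMean (N.ReqInv r))) = e'
  rw [h3]
  ring

lemma setLIntegral_fR {a : ℝ} (ha : 0 ≤ a) :
    ∫⁻ r in Ioi a, ENNReal.ofReal (N.fR r) = ENNReal.ofReal (Real.exp (-N.distMean a)) := by
  have hcont : ContinuousWithinAt (fun r => -Real.exp (-N.distMean r)) (Ici a) a :=
    (Real.continuous_exp.comp N.continuous_distMean.neg).neg.continuousWithinAt
  have hd : ∀ x ∈ Ioi a, HasDerivAt (fun r => -Real.exp (-N.distMean r)) (N.fR x) x :=
    fun x hx => N.hasDerivAt_exp_distMean (ha.trans_lt hx)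
  have hpos : ∀ x ∈ Ioi a, 0 ≤ N.fR x := fun x hx => N.fR_nonneg (ha.trans (le_of_lt hx))
  have hlim : Tendsto (fun r => -Real.exp (-N.distMean r)) atTop (𝓝 0) := by
    simpa using (Real.tendsto_exp_neg_atTop_nhds_zero.comp N.tendsto_distMean).neg
  rw [← ofReal_integral_eq_lintegral_ofReal
    (integrableOn_Ioi_deriv_of_nonneg hcont hd hpos hlim)
    ((ae_restrict_iff' measurableSet_Ioi).2 (ae_of_all _ hpos)),
    integral_Ioi_of_hasDerivAt_of_nonneg hcont hd hpos hlim]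
  simp

end Network

namespace Network

variable (N : Network)

/-! ### The Laplace transform of the interference -/

/-- Average received power of an interfering link of length `u`. -/
noncomputable def linkPower (θ : ℝ) (b : Bool) (i : Fin 4) (u : ℝ) : ℝ :=
  N.Pm * N.pathGain b u * N.d i * N.G u θ

lemma linkPower_nonneg (θ : ℝ) (b : Bool) (i : Fin 4) {u : ℝ} (hu : 0 ≤ u) :
    0 ≤ N.linkPower θ b i u :=
  mul_nonneg (mul_nonneg (mul_nonneg N.Pm_pos.le (N.pathGain_nonneg b hu)) (N.d_nonneg i))
    (N.G_pos u θ).le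

lemma measurable_linkPower (θ : ℝ) (b : Bool) (i : Fin 4) : Measurable (N.linkPower θ b i) :=
  (((N.measurable_pathGain b).const_mul _).mul_const _).mul (N.measurable_G θ)

/-- One minus the Laplace transform at `z` of the power received over an interfering link. -/
noncomputable def linkLaplace (θ z : ℝ) (b : Bool) (i : Fin 4) (u : ℝ) : ℝ :=
  1 - 1 / (1 + z * N.linkPower θ b i u / N.m) ^ N.m

lemma measurable_linkLaplace (θ z : ℝ) (b : Bool) (i : Fin 4) :
    Measurable (N.linkLaplace θ z b i) := by
  have := N.measurable_linkPower θ b i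
  unfold linkLaplace
  fun_prop

lemma FL_eq {θ z x : ℝ} (hx : 0 < x) (i : Fin 4) :
    N.FL θ z x (N.d i) = N.linkLaplace θ z true i x := by
  rw [FL, linkLaplace, linkPower, pathGain, if_pos rfl, Real.rpow_neg hx.le]
  have h1 := (Real.rpow_pos_of_pos hx N.αL).ne'
  have h2 := N.m_pos'.ne'
  congr 4
  field_simp

lemma FN_eq {θ z x : ℝ} (hx : 0 < x) (i : Fin 4) :
    N.FN θ z x (N.d i) = N.linkLaplace θ z false i x := by
  rw [FN, linkLaplace, linkPower, pathGain, if_neg (by simp), Real.rpow_neg hx.le]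
  have h1 := (Real.rpow_pos_of_pos hx N.αN).ne'
  have h2 := N.m_pos'.ne'
  congr 4
  field_simp

lemma one_sub_one_div_pow_le {t : ℝ} (ht : 0 ≤ t) (m : ℕ) : 1 - 1 / (1 + t) ^ m ≤ m * t := by
  have h1 : 0 < 1 + t := by linarith
  have h2 : t / (1 + t) ≤ t := div_le_self ht (by linarith)
  have h3 : -2 ≤ -(t / (1 + t)) := by
    have : t / (1 + t) ≤ 1 := (div_le_one h1).2 (by linarith)
    linarith
  have h4 := one_add_mul_le_pow h3 m
  have h5 : 1 + -(t / (1 + t)) = 1 / (1 + t) := by field_simp; ring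
  rw [h5, one_div_pow] at h4
  have : (m : ℝ) * (t / (1 + t)) ≤ m * t := by gcongr
  linarith

section

variable {θ z : ℝ} (hz : 0 ≤ z) (b : Bool) (i : Fin 4)
include hz

lemma linkLaplace_nonneg {u : ℝ} (hu : 0 ≤ u) : 0 ≤ N.linkLaplace θ z b i u := by
  have h1 := N.linkPower_nonneg θ b i hu
  have h2 := N.m_pos'
  rw [linkLaplace, sub_nonneg]
  refine div_le_one_of_le₀ (one_le_pow₀ ?_) (by positivity)
  have : 0 ≤ z * N.linkPower θ b i u / N.m := by positivity
  linarith

lemma linkLaplace_le_one {u : ℝ} (hu : 0 ≤ u) : N.linkLaplace θ z b i u ≤ 1 := by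
  have h1 := N.linkPower_nonneg θ b i hu
  have h2 := N.m_pos'
  rw [linkLaplace, sub_le_self_iff]
  positivity

lemma linkLaplace_le {u : ℝ} (hu : 0 ≤ u) : N.linkLaplace θ z b i u ≤ z * N.linkPower θ b i u := by
  have h1 := N.linkPower_nonneg θ b i hu
  have h2 := N.m_pos'
  refine (one_sub_one_div_pow_le (t := z * N.linkPower θ b i u / N.m) (by positivity) N.m).trans ?_
  rw [mul_div_cancel₀ _ h2.ne']

end

lemma integrableOn_FL {θ z ρ : ℝ} (hz : 0 ≤ z) (hρ : 0 < ρ) (i : Fin 4) :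
    IntegrableOn (fun x => N.FL θ z x (N.d i) * x * N.PL x) (Ioi ρ) := by
  have h0 : IntegrableOn (fun x : ℝ => x * N.PL x) (Ioi ρ) := by
    have := integrableOn_rpow_mul_exp_neg_mul_rpow (p := 1) (s := 1) (b := N.β)
      (by norm_num) one_pos N.β_pos
    refine (this.mono_set (Ioi_subset_Ioi hρ.le)).congr_fun (fun x _ => ?_) measurableSet_Ioi
    simp [PL]
  have hm := N.measurable_linkLaplace θ z true i
  have h1 := N.continuous_PL.measurable
  have h2 : IntegrableOn (fun x => N.linkLaplace θ z true i x * x * N.PL x) (Ioi ρ) := by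
    refine h0.mono' (by fun_prop) ((ae_restrict_iff' measurableSet_Ioi).2 (ae_of_all _ ?_))
    intro x hx
    have hx0 : 0 ≤ x := hρ.le.trans (le_of_lt hx)
    have h3 := N.linkLaplace_nonneg hz true i hx0 (θ := θ)
    have h4 := N.linkLaplace_le_one hz true i hx0 (θ := θ)
    have h5 := N.PL_pos x
    rw [Real.norm_eq_abs, abs_of_nonneg (by positivity), mul_assoc]
    exact mul_le_of_le_one_left (by positivity) h4
  refine h2.congr_fun (fun x hx => ?_) measurableSet_Ioi
  simp only [N.FL_eq (hρ.trans hx)]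

lemma integrableOn_FN {θ z ρ : ℝ} (hz : 0 ≤ z) (hρ : 0 < ρ) (i : Fin 4) :
    IntegrableOn (fun x => N.FN θ z x (N.d i) * x * N.PN x) (Ioi ρ) := by
  have h0 : IntegrableOn (fun x : ℝ => z * (N.Pm * N.CN * N.d i) * x ^ (-N.αN + 1)) (Ioi ρ) :=
    (integrableOn_Ioi_rpow_of_lt (by have := N.αN_gt; linarith) hρ).const_mul _
  have hm := N.measurable_linkLaplace θ z false i
  have h1 := N.continuous_PN.measurable
  have h2 : IntegrableOn (fun x => N.linkLaplace θ z false i x * x * N.PN x) (Ioi ρ) := by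
    refine h0.mono' (by fun_prop) ((ae_restrict_iff' measurableSet_Ioi).2 (ae_of_all _ ?_))
    intro x hx
    have hx0 : 0 < x := hρ.trans hx
    have h3 := N.linkLaplace_nonneg hz false i hx0.le (θ := θ)
    have h4 := N.linkLaplace_le hz false i hx0.le (θ := θ)
    have h5 := N.PN_nonneg hx0.le
    have h6 : N.PN x ≤ 1 := by
      have := N.PL_pos x
      rw [PN]; linarith
    have h7 : N.linkPower θ false i x ≤ N.Pm * N.CN * N.d i * x ^ (-N.αN) := by
      have e : N.Pm * N.CN * N.d i * x ^ (-N.αN) = N.Pm * N.pathGain false x * N.d i * 1 := by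
        rw [pathGain, if_neg (by simp)]; ring
      rw [e, linkPower]
      exact mul_le_mul_of_nonneg_left (N.G_le_one x θ) (mul_nonneg (mul_nonneg N.Pm_pos.le
        (N.pathGain_nonneg false hx0.le)) (N.d_nonneg i))
    rw [Real.norm_eq_abs, abs_of_nonneg (by positivity), Real.rpow_add_one hx0.ne']
    calc N.linkLaplace θ z false i x * x * N.PN x
        ≤ N.linkLaplace θ z false i x * x * 1 := by gcongr
      _ ≤ z * (N.Pm * N.CN * N.d i * x ^ (-N.αN)) * x * 1 := by
          gcongr
          exact h4.trans (by gcongr)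
      _ = _ := by ring
  refine h2.congr_fun (fun x hx => ?_) measurableSet_Ioi
  simp only [N.FN_eq (hρ.trans hx)]

/-- The interfering power carried by a marked point. -/
noncomputable def markPower (θ : ℝ) (q : EuclideanSpace ℝ (Fin 2) × LinkMark) : ℝ :=
  N.Pm * N.pathGain q.2.1 ‖q.1‖ * N.d q.2.2.1 * N.G ‖q.1‖ θ * q.2.2.2

/-- The interfering power, scaled by `z`, as a nonnegative weight. -/
noncomputable def markWeight (θ z : ℝ) (q : EuclideanSpace ℝ (Fin 2) × LinkMark) : ℝ≥0 :=
  (z * N.markPower θ q).toNNReal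

lemma measurable_markPower (θ : ℝ) : Measurable (N.markPower θ) := by
  have h1 : Measurable fun q : EuclideanSpace ℝ (Fin 2) × LinkMark => N.pathGain q.2.1 ‖q.1‖ := by
    have he : (fun q : EuclideanSpace ℝ (Fin 2) × LinkMark => N.pathGain q.2.1 ‖q.1‖)
        = fun q => if q.2.1 = true then N.pathGain true ‖q.1‖ else N.pathGain false ‖q.1‖ := by
      ext q; cases h : q.2.1 <;> simp
    rw [he]
    exact Measurable.ite ((measurable_fst.comp measurable_snd) (measurableSet_singleton true))
      ((N.measurable_pathGain true).comp measurable_fst.norm)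
      ((N.measurable_pathGain false).comp measurable_fst.norm)
  have h2 : Measurable fun q : EuclideanSpace ℝ (Fin 2) × LinkMark => N.d q.2.2.1 :=
    (measurable_of_finite N.d).comp (measurable_fst.comp (measurable_snd.comp measurable_snd))
  have h3 : Measurable fun q : EuclideanSpace ℝ (Fin 2) × LinkMark => N.G ‖q.1‖ θ :=
    (N.measurable_G θ).comp measurable_fst.norm
  unfold markPower
  fun_prop

lemma measurable_markWeight (θ z : ℝ) : Measurable (N.markWeight θ z) :=
  ((N.measurable_markPower θ).const_mul z).real_toNNReal

lemma lintegral_Ioi_mul_sum {c : ℝ} (hc : 0 < c) {P : ℝ → ℝ} (hP : ∀ r, 0 ≤ r → 0 ≤ P r)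
    {F : Fin 4 → ℝ → ℝ} (hF : ∀ i r, 0 ≤ r → 0 ≤ F i r) (hPm : Measurable P)
    (hFm : ∀ i, Measurable (F i))
    (hint : ∀ i, IntegrableOn (fun r => F i r * r * P r) (Ioi c)) :
    ∫⁻ r in Ioi (0 : ℝ), ENNReal.ofReal (2 * Real.pi * N.lam * r * P r)
        * (Ioi c).indicator (fun r => ∑ i, ENNReal.ofReal (N.p i) * ENNReal.ofReal (F i r)) r
      = ENNReal.ofReal (∑ i, N.C i * ∫ r in Ioi c, F i r * r * P r) := by
  have hpi := Real.pi_pos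
  have hlam := N.lam_pos
  have hC : ∀ i, 0 ≤ N.C i := fun i => by
    have := N.p_nonneg i
    unfold C; positivity
  have h1 : ∀ r, ENNReal.ofReal (2 * Real.pi * N.lam * r * P r)
        * (Ioi c).indicator (fun r => ∑ i, ENNReal.ofReal (N.p i) * ENNReal.ofReal (F i r)) r
      = (Ioi c).indicator (fun r => ∑ i, ENNReal.ofReal (N.C i * (F i r * r * P r))) r := by
    intro r
    by_cases hr : r ∈ Ioi c
    · have hr0 : 0 ≤ r := hc.le.trans (le_of_lt hr)
      have hP' := hP r hr0
      rw [indicator_of_mem hr, indicator_of_mem hr, Finset.mul_sum]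
      refine Finset.sum_congr rfl fun i _ => ?_
      rw [← ENNReal.ofReal_mul (N.p_nonneg i), ← ENNReal.ofReal_mul (by positivity), C]
      ring_nf
    · rw [indicator_of_notMem hr, indicator_of_notMem hr, mul_zero]
  simp_rw [h1]
  rw [lintegral_indicator measurableSet_Ioi, Measure.restrict_restrict measurableSet_Ioi,
    inter_eq_left.2 (Ioi_subset_Ioi hc.le), lintegral_finsetSum _ (fun i _ => by
      have := hFm i
      fun_prop)]
  rw [ENNReal.ofReal_sum_of_nonneg]
  · refine Finset.sum_congr rfl fun i _ => ?_
    rw [← integral_const_mul, ofReal_integral_eq_lintegral_ofReal ((hint i).const_mul _)]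
    refine (ae_restrict_iff' measurableSet_Ioi).2 (ae_of_all _ fun r hr => ?_)
    have hr0 : 0 ≤ r := hc.le.trans (le_of_lt hr)
    exact mul_nonneg (hC i) (mul_nonneg (mul_nonneg (hF i r hr0) hr0) (hP r hr0))
  · intro i _
    refine mul_nonneg (hC i) (setIntegral_nonneg measurableSet_Ioi fun r hr => ?_)
    have hr0 : 0 ≤ r := hc.le.trans (le_of_lt hr)
    exact mul_nonneg (mul_nonneg (hF i r hr0) hr0) (hP r hr0)

lemma lintegral_one_sub_exp_markWeight {θ z : ℝ} (hz : 0 ≤ z) (x : EuclideanSpace ℝ (Fin 2))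
    (b : Bool) :
    ∫⁻ y, ENNReal.ofReal (1 - Real.exp (-(N.markWeight θ z (x, b, y) : ℝ))) ∂N.fadingLaw
      = ∑ i, ENNReal.ofReal (N.p i) * ENNReal.ofReal (N.linkLaplace θ z b i ‖x‖) := by
  have hm := N.measurable_markWeight θ z
  rw [N.lintegral_fadingLaw (by fun_prop)]
  refine Finset.sum_congr rfl fun i _ => ?_
  congr 1
  rw [linkLaplace, ← lintegral_one_sub_exp_gammaMeasure N.m_pos
    (mul_nonneg hz (N.linkPower_nonneg θ b i (norm_nonneg x)))]
  simp only [markWeight, markPower, linkPower, mul_assoc]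

lemma tailExponent_eq {θ z ρ : ℝ} (hz : 0 ≤ z) (hρ : 0 < ρ) :
    tailExponent N.intensity N.markDist (N.markWeight θ z) ρ
      = ENNReal.ofReal ((∑ i, N.C i * ∫ x in Ioi ρ, N.FL θ z x (N.d i) * x * N.PL x)
        + ∑ i, N.C i * ∫ x in Ioi (N.ReqInv ρ), N.FN θ z x (N.d i) * x * N.PN x) := by
  have hR := N.ReqInv_pos hρ
  have hm : Measurable fun q => ENNReal.ofReal
      (1 - Real.exp (-(tailWeight N.markDist (N.markWeight θ z) ρ q : ℝ))) := by
    have := measurable_tailWeight N.measurable_markDist (N.measurable_markWeight θ z) ρ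
    fun_prop
  have hpi := Real.pi_pos
  have hlam := N.lam_pos
  have hC : ∀ i, 0 ≤ N.C i := fun i => by
    have := N.p_nonneg i
    unfold C; positivity
  have hLm := N.measurable_linkLaplace θ z
  have eL : ∀ i, ∫ x in Ioi ρ, N.FL θ z x (N.d i) * x * N.PL x
      = ∫ x in Ioi ρ, N.linkLaplace θ z true i x * x * N.PL x := fun i =>
    setIntegral_congr_fun measurableSet_Ioi fun x hx => by simp only [N.FL_eq (hρ.trans hx)]
  have eN : ∀ i, ∫ x in Ioi (N.ReqInv ρ), N.FN θ z x (N.d i) * x * N.PN x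
      = ∫ x in Ioi (N.ReqInv ρ), N.linkLaplace θ z false i x * x * N.PN x := fun i =>
    setIntegral_congr_fun measurableSet_Ioi fun x hx => by simp only [N.FN_eq (hR.trans hx)]
  rw [tailExponent, N.lintegral_intensity hm (φ := fun b => (Ioi (if b then ρ else N.ReqInv ρ)).indicator
    fun r => ∑ i, ENNReal.ofReal (N.p i) * ENNReal.ofReal (N.linkLaplace θ z b i r))]
  · simp only [if_true, Bool.false_eq_true, if_false]
    simp_rw [eL, eN]
    rw [N.lintegral_Ioi_mul_sum hρ (fun r _ => (N.PL_pos r).le)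
        (fun i r hr => N.linkLaplace_nonneg hz true i hr) N.continuous_PL.measurable (hLm true)
        (fun i => (N.integrableOn_FL (θ := θ) hz hρ i).congr_fun
          (fun x hx => by simp only [N.FL_eq (hρ.trans hx)]) measurableSet_Ioi),
      N.lintegral_Ioi_mul_sum hR (fun r hr => N.PN_nonneg hr)
        (fun i r hr => N.linkLaplace_nonneg hz false i hr) N.continuous_PN.measurable (hLm false)
        (fun i => (N.integrableOn_FN (θ := θ) hz hR i).congr_fun
          (fun x hx => by simp only [N.FN_eq (hR.trans hx)]) measurableSet_Ioi),
      ENNReal.ofReal_add]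
    · refine Finset.sum_nonneg fun i _ => mul_nonneg (hC i)
        (setIntegral_nonneg measurableSet_Ioi fun x hx => ?_)
      have hx0 : 0 ≤ x := hρ.le.trans (le_of_lt hx)
      exact mul_nonneg (mul_nonneg (N.linkLaplace_nonneg hz true i hx0) hx0) (N.PL_pos x).le
    · refine Finset.sum_nonneg fun i _ => mul_nonneg (hC i)
        (setIntegral_nonneg measurableSet_Ioi fun x hx => ?_)
      have hx0 : 0 ≤ x := hR.le.trans (le_of_lt hx)
      exact mul_nonneg (mul_nonneg (N.linkLaplace_nonneg hz false i hx0) hx0) (N.PN_nonneg hx0)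
  · intro b
    have := hLm b
    exact Measurable.indicator (by fun_prop) measurableSet_Ioi
  · intro x b
    have hiff : ∀ y, (x, b, y) ∈ {q | ρ < N.markDist q}
        ↔ ‖x‖ ∈ Ioi (if b then ρ else N.ReqInv ρ) := fun y => by
      cases b
      · have := N.lt_Req_iff hρ.le (norm_nonneg x)
        simpa only [markDist, mem_ofPred_eq, mem_Ioi, Bool.false_eq_true, if_false] using this
      · simp [markDist]
    by_cases hx : ‖x‖ ∈ Ioi (if b then ρ else N.ReqInv ρ)
    · rw [indicator_of_mem hx, ← N.lintegral_one_sub_exp_markWeight hz x b]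
      refine lintegral_congr fun y => ?_
      rw [tailWeight, indicator_of_mem ((hiff y).2 hx)]
    · rw [indicator_of_notMem hx]
      simp_rw [tailWeight, indicator_of_notMem (fun h => hx ((hiff _).1 h))]
      simp

lemma tailExponent_ne_top {θ z ρ : ℝ} (hz : 0 ≤ z) (hρ : 0 < ρ) :
    tailExponent N.intensity N.markDist (N.markWeight θ z) ρ ≠ ∞ := by
  rw [N.tailExponent_eq hz hρ]; exact ENNReal.ofReal_ne_top

lemma exp_tailExponent {θ z ρ : ℝ} (hz : 0 ≤ z) (hρ : 0 < ρ) :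
    Real.exp (-(tailExponent N.intensity N.markDist (N.markWeight θ z) ρ).toReal)
      = N.laplace θ ρ z := by
  have hpi := Real.pi_pos
  have hlam := N.lam_pos
  have hR := N.ReqInv_pos hρ
  have hC : ∀ i, 0 ≤ N.C i := fun i => by
    have := N.p_nonneg i
    unfold C; positivity
  rw [N.tailExponent_eq hz hρ, ENNReal.toReal_ofReal, laplace, ← Real.exp_sum, ← Real.exp_sum,
    ← Real.exp_add, neg_add, ← Finset.sum_neg_distrib, ← Finset.sum_neg_distrib]
  · simp only [neg_mul]
  · refine add_nonneg (Finset.sum_nonneg fun i _ => mul_nonneg (hC i)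
      (setIntegral_nonneg measurableSet_Ioi fun x hx => ?_))
      (Finset.sum_nonneg fun i _ => mul_nonneg (hC i)
      (setIntegral_nonneg measurableSet_Ioi fun x hx => ?_))
    · have hx0 : 0 < x := hρ.trans hx
      rw [N.FL_eq hx0]
      exact mul_nonneg (mul_nonneg (N.linkLaplace_nonneg hz true i hx0.le) hx0.le) (N.PL_pos x).le
    · have hx0 : 0 < x := hR.trans hx
      rw [N.FN_eq hx0]
      exact mul_nonneg (mul_nonneg (N.linkLaplace_nonneg hz false i hx0.le) hx0.le)
        (N.PN_nonneg hx0.le)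

end Network

namespace Network

/-! ### The serving base station and the interference -/

section Deterministic

variable {Ω : Type*} {N : Network} {X : ℕ → Ω → EuclideanSpace ℝ (Fin 2)} {M : ℕ → Ω → LinkMark}
  {ω : Ω} {j : ℕ}

lemma isServing_iff (hpos : ∀ i, 0 < N.markDist (X i ω, M i ω))
    (hmin : ∀ i, i ≠ j → N.markDist (X j ω, M j ω) < N.markDist (X i ω, M i ω)) (i : ℕ) :
    N.IsServing X M ω i ↔ i = j := by
  have key : ∀ i k, N.Pm * N.linkGain X M i ω ≤ N.Pm * N.linkGain X M k ω
      ↔ N.markDist (X k ω, M k ω) ≤ N.markDist (X i ω, M i ω) := fun i k => by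
    rw [mul_le_mul_iff_right₀ N.Pm_pos, ← not_lt, ← not_lt, not_iff_not]
    exact N.pathGain_lt_pathGain_iff (hpos k) (hpos i)
  constructor
  · intro h
    by_contra hij
    exact absurd ((key j i).1 (h j)) (not_le.2 (hmin i hij))
  · rintro rfl k
    rw [key]
    by_cases hk : k = i
    exacts [hk ▸ le_rfl, (hmin k hk).le]

lemma serving_eq (hpos : ∀ i, 0 < N.markDist (X i ω, M i ω))
    (hmin : ∀ i, i ≠ j → N.markDist (X j ω, M j ω) < N.markDist (X i ω, M i ω)) :
    N.serving X M ω = j := by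
  have : {i | N.IsServing X M ω i} = {j} := by
    ext i; exact isServing_iff hpos hmin i
  rw [serving, this, csInf_singleton]

lemma servingDist_eq (hpos : ∀ i, 0 < N.markDist (X i ω, M i ω))
    (hmin : ∀ i, i ≠ j → N.markDist (X j ω, M j ω) < N.markDist (X i ω, M i ω)) :
    N.servingDist X M ω = N.markDist (X j ω, M j ω) := by
  rw [servingDist, serving_eq hpos hmin]; rfl

lemma mul_interferenceTerm_eq (hpos : ∀ i, 0 < N.markDist (X i ω, M i ω))
    (hmin : ∀ i, i ≠ j → N.markDist (X j ω, M j ω) < N.markDist (X i ω, M i ω))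
    (hh : ∀ i, 0 ≤ (M i ω).2.2) (θ : ℝ) {z : ℝ} (hz : 0 ≤ z) (i : ℕ) :
    z * N.interferenceTerm X M θ ω i
      = tailWeight N.markDist (N.markWeight θ z) (N.servingDist X M ω) (X i ω, M i ω) := by
  rw [interferenceTerm, serving_eq hpos hmin, servingDist_eq hpos hmin, tailWeight]
  split_ifs with hi
  · subst hi
    rw [indicator_of_notMem (by simp)]
    simp
  · rw [indicator_of_mem (show (X i ω, M i ω) ∈ {q | _ < N.markDist q} from hmin i hi), markWeight,
      Real.coe_toNNReal]
    · rfl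
    · exact mul_nonneg hz (mul_nonneg (N.linkPower_nonneg θ _ _ (norm_nonneg _)) (hh i))

lemma mul_interference_eq (hpos : ∀ i, 0 < N.markDist (X i ω, M i ω))
    (hmin : ∀ i, i ≠ j → N.markDist (X j ω, M j ω) < N.markDist (X i ω, M i ω))
    (hh : ∀ i, 0 ≤ (M i ω).2.2) (θ : ℝ) {z : ℝ} (hz : 0 ≤ z) :
    z * N.interference X M θ ω = tailSum (fun i ω => (X i ω, M i ω)) N.markDist
      (N.markWeight θ z) (N.servingDist X M ω) ω := by
  rw [interference, ← tsum_mul_left, tailSum]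
  exact tsum_congr fun i => mul_interferenceTerm_eq hpos hmin hh θ hz i

end Deterministic

section Measurability

variable {Ω : Type*} [MeasurableSpace Ω] {N : Network} {X : ℕ → Ω → EuclideanSpace ℝ (Fin 2)}
  {M : ℕ → Ω → LinkMark}

lemma measurable_linkGain (hX : ∀ j, Measurable (X j)) (hM : ∀ j, Measurable (M j)) (j : ℕ) :
    Measurable (N.linkGain X M j) := by
  have he : N.linkGain X M j = fun ω => if (M j ω).1 = true then N.pathGain true ‖X j ω‖
      else N.pathGain false ‖X j ω‖ := by
    ext ω; cases h : (M j ω).1 <;> simp [linkGain, h]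
  rw [he]
  exact Measurable.ite ((measurable_fst.comp (hM j)) (measurableSet_singleton true))
    ((N.measurable_pathGain true).comp (hX j).norm)
    ((N.measurable_pathGain false).comp (hX j).norm)

lemma measurableSet_isServing (hX : ∀ j, Measurable (X j)) (hM : ∀ j, Measurable (M j)) (j : ℕ) :
    MeasurableSet {ω | N.IsServing X M ω j} := by
  have : {ω | N.IsServing X M ω j}
      = ⋂ i, {ω | N.Pm * N.linkGain X M i ω ≤ N.Pm * N.linkGain X M j ω} := by
    ext; simp [IsServing]
  rw [this]
  exact .iInter fun i => measurableSet_le ((measurable_linkGain hX hM i).const_mul _)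
    ((measurable_linkGain hX hM j).const_mul _)

lemma measurable_serving (hX : ∀ j, Measurable (X j)) (hM : ∀ j, Measurable (M j)) :
    Measurable (N.serving X M) := by
  classical
  refine measurable_to_countable' fun j => ?_
  have hS := measurableSet_isServing (N := N) hX hM
  have : N.serving X M ⁻¹' {j} = ({ω | N.IsServing X M ω j} ∩ ⋂ i, ⋂ (_ : i < j),
      {ω | N.IsServing X M ω i}ᶜ) ∪ ({_ω | j = 0} ∩ ⋂ i, {ω | N.IsServing X M ω i}ᶜ) := by
    ext ω
    simp only [mem_preimage, mem_singleton_iff, mem_union, mem_inter_iff, mem_iInter, mem_compl_iff,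
      mem_ofPred_eq]
    by_cases hne : ∃ i, N.IsServing X M ω i
    · have hne' : {i | N.IsServing X M ω i}.Nonempty := hne
      have hnot : ¬ ∀ i, ¬ N.IsServing X M ω i := not_forall_not.2 hne
      simp only [hnot, and_false, or_false]
      constructor
      · rintro rfl
        exact ⟨Nat.sInf_mem hne', fun i hi => Nat.notMem_of_lt_sInf hi⟩
      · rintro ⟨h1, h2⟩
        refine le_antisymm (Nat.sInf_le h1) ?_
        by_contra hlt
        exact h2 _ (not_le.1 hlt) (Nat.sInf_mem hne')
    · have h0 : {i | N.IsServing X M ω i} = ∅ := by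
        ext i; simpa using fun h => hne ⟨i, h⟩
      rw [serving, h0, Nat.sInf_empty]
      push Not at hne
      simp [hne, eq_comm]
  rw [this]
  exact ((hS j).inter (.iInter fun i => .iInter fun _ => (hS i).compl)).union
    ((MeasurableSet.const _).inter (.iInter fun i => (hS i).compl))

lemma measurable_eval_serving (hX : ∀ j, Measurable (X j)) (hM : ∀ j, Measurable (M j))
    {F : Type*} [MeasurableSpace F] {f : ℕ → Ω → F} (hf : ∀ j, Measurable (f j)) :
    Measurable fun ω => f (N.serving X M ω) ω := by
  have : Measurable fun p : ℕ × Ω => f p.1 p.2 := measurable_from_prod_countable_right hf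
  exact this.comp ((measurable_serving hX hM).prodMk measurable_id)

lemma measurable_servingDist (hX : ∀ j, Measurable (X j)) (hM : ∀ j, Measurable (M j)) :
    Measurable (N.servingDist X M) :=
  measurable_eval_serving (f := fun j ω => N.markDist (X j ω, M j ω)) hX hM
    fun j => N.measurable_markDist.comp ((hX j).prodMk (hM j))

lemma measurable_interference (hX : ∀ j, Measurable (X j)) (hM : ∀ j, Measurable (M j)) (θ : ℝ) :
    Measurable (N.interference X M θ) := by
  refine Measurable.tsum fun j => ?_
  refine Measurable.ite ?_ measurable_const
    ((N.measurable_markPower θ).comp ((hX j).prodMk (hM j)))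
  exact measurableSet_eq_fun measurable_const (measurable_serving hX hM)

end Measurability

section Probability

variable {Ω : Type*} [MeasurableSpace Ω] {μ : Measure Ω} [IsProbabilityMeasure μ] {N : Network}
  {X : ℕ → Ω → EuclideanSpace ℝ (Fin 2)} {M : ℕ → Ω → LinkMark}

lemma hasPoissonPGFL (hX : IsPoissonProcess X (ENNReal.ofReal N.lam • volume) μ)
    (hM : IsIndependentMarking X M N.markLaw μ) :
    HasPoissonPGFL (fun j ω => (X j ω, M j ω)) N.intensity μ where
  measurable j := (hX.measurable j).prodMk (hM.measurable j)
  lintegral_infProd g hg hg1 hfin := by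
    have : SigmaFinite (ENNReal.ofReal N.lam • (volume : Measure (EuclideanSpace ℝ (Fin 2)))) :=
      inferInstanceAs (SigmaFinite (N.lam.toNNReal • volume))
    exact IsIndependentMarking.lintegral_infProd (K := N.markKernel) hX hM hg hg1 hfin

/-- Resets the fading power of a mark. -/
def dropFading (y : LinkMark) : LinkMark := (y.1, y.2.1, 0)

lemma measurable_dropFading : Measurable dropFading := by unfold dropFading; fun_prop

lemma markLaw_inter (x : EuclideanSpace ℝ (Fin 2)) {S : Set LinkMark} {B : Set ℝ}
    (hS : MeasurableSet S) (hB : MeasurableSet B) :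
    N.markLaw x (dropFading ⁻¹' S ∩ (fun y : LinkMark => y.2.2) ⁻¹' B)
      = N.markLaw x (dropFading ⁻¹' S) * gammaMeasure N.m N.m B := by
  have hD := measurable_dropFading hS
  have hφ : Measurable fun y : LinkMark => y.2.2 := by fun_prop
  have hI := hD.inter (hφ hB)
  rw [← lintegral_indicator_one hI, ← lintegral_indicator_one hD,
    N.lintegral_markLaw x (measurable_one.indicator hI),
    N.lintegral_markLaw x (measurable_one.indicator hD)]
  have key : ∀ b : Bool, ∫⁻ y, (dropFading ⁻¹' S ∩ (fun y : LinkMark => y.2.2) ⁻¹' B).indicator 1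
        (b, y) ∂N.fadingLaw
      = (∫⁻ y, (dropFading ⁻¹' S).indicator 1 (b, y) ∂N.fadingLaw) * gammaMeasure N.m N.m B := by
    intro b
    have hI' : Measurable fun y : Fin 4 × ℝ => (dropFading ⁻¹' S ∩
        (fun y : LinkMark => y.2.2) ⁻¹' B).indicator (1 : LinkMark → ℝ≥0∞) (b, y) :=
      (measurable_one.indicator hI).comp measurable_prodMk_left
    have hD' : Measurable fun y : Fin 4 × ℝ =>
        (dropFading ⁻¹' S).indicator (1 : LinkMark → ℝ≥0∞) (b, y) :=
      (measurable_one.indicator hD).comp measurable_prodMk_left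
    rw [N.lintegral_fadingLaw hI', N.lintegral_fadingLaw hD', Finset.sum_mul]
    refine Finset.sum_congr rfl fun i _ => ?_
    rw [mul_assoc]
    congr 1
    by_cases h : (b, i, (0 : ℝ)) ∈ S
    · have h1 : ∀ t : ℝ, (dropFading ⁻¹' S ∩ (fun y : LinkMark => y.2.2) ⁻¹' B).indicator
          (1 : LinkMark → ℝ≥0∞) (b, i, t) = B.indicator 1 t := fun t => by
        by_cases ht : t ∈ B <;> simp [indicator, dropFading, h, ht]
      have h2 : ∀ t : ℝ, (dropFading ⁻¹' S).indicator (1 : LinkMark → ℝ≥0∞) (b, i, t) = 1 :=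
        fun t => by simp [indicator, dropFading, h]
      simp_rw [h1, h2]
      rw [lintegral_indicator_one hB]
      simp
    · have h1 : ∀ t : ℝ, (dropFading ⁻¹' S ∩ (fun y : LinkMark => y.2.2) ⁻¹' B).indicator
          (1 : LinkMark → ℝ≥0∞) (b, i, t) = 0 := fun t => by simp [indicator, dropFading, h]
      have h2 : ∀ t : ℝ, (dropFading ⁻¹' S).indicator (1 : LinkMark → ℝ≥0∞) (b, i, t) = 0 :=
        fun t => by simp [indicator, dropFading, h]
      simp_rw [h1, h2]
      simp
  rw [key, key]
  ring

lemma ae_fading_nonneg (hX : ∀ j, Measurable (X j)) (hM : IsIndependentMarking X M N.markLaw μ) :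
    ∀ᵐ ω ∂μ, ∀ j, 0 ≤ (M j ω).2.2 := by
  refine ae_all_iff.2 fun j => ?_
  have h := hM.measure_update_inter hX measurable_dropFading (φ := fun y : LinkMark => y.2.2)
    (by fun_prop) (fun x S B hS hB => markLaw_inter (N := N) x hS hB) j .univ
    (measurableSet_Iio (a := (0 : ℝ)))
  have h0 : gammaMeasure N.m N.m (Iio (0 : ℝ)) = 0 := by
    have := ae_nonneg_gammaMeasure N.m N.m
    rw [ae_iff] at this
    simpa [Iio] using this
  rw [h0, mul_zero] at h
  rw [ae_iff]
  simpa using h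

/-- The typical situation: a unique closest equivalent base station, and nonnegative fading. -/
lemma ae_typical (hX : IsPoissonProcess X (ENNReal.ofReal N.lam • volume) μ)
    (hM : IsIndependentMarking X M N.markLaw μ) :
    ∀ᵐ ω ∂μ, (∀ i, 0 < N.markDist (X i ω, M i ω)) ∧ (∀ i, 0 ≤ (M i ω).2.2) ∧
      ∃ j, ∀ i, i ≠ j → N.markDist (X j ω, M j ω) < N.markDist (X i ω, M i ω) := by
  have hP := hasPoissonPGFL hX hM
  filter_upwards [hP.ae_forall_pos N.measurable_markDist (by
      rw [N.intensity_markDist_le le_rfl, N.distMean_zero, ENNReal.ofReal_zero]),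
    ae_fading_nonneg hX.measurable hM,
    hP.ae_exists_forall_lt N.measurable_markDist N.continuous_distMean
      (fun r hr => N.intensity_markDist_le hr) (fun r hr => N.distMean_nonneg hr)
      N.monotoneOn_distMean N.distMean_zero] with ω h1 h2 h3
  exact ⟨h1, h2, h3⟩

lemma ae_servingDist (hX : IsPoissonProcess X (ENNReal.ofReal N.lam • volume) μ)
    (hM : IsIndependentMarking X M N.markLaw μ) :
    ∀ᵐ ω ∂μ, ∃ j, N.servingDist X M ω = N.markDist (X j ω, M j ω) ∧
      ∀ i, i ≠ j → N.markDist (X j ω, M j ω) < N.markDist (X i ω, M i ω) := by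
  filter_upwards [ae_typical hX hM] with ω ⟨h1, h2, j, hj⟩
  exact ⟨j, servingDist_eq h1 hj, hj⟩

lemma ae_servingDist_pos (hX : IsPoissonProcess X (ENNReal.ofReal N.lam • volume) μ)
    (hM : IsIndependentMarking X M N.markLaw μ) : ∀ᵐ ω ∂μ, 0 < N.servingDist X M ω := by
  filter_upwards [ae_typical hX hM] with ω ⟨h1, h2, j, hj⟩
  rw [servingDist_eq h1 hj]
  exact h1 j

lemma intensity_markDist_le_ne_top (r : ℝ) : N.intensity {q | N.markDist q ≤ r} ≠ ∞ := by
  refine ((measure_mono (t := {q | N.markDist q ≤ max r 0}) fun q hq => ?_).trans_lt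
    ((N.intensity_markDist_le (le_max_right _ _)).trans_lt ENNReal.ofReal_lt_top)).ne
  exact le_trans (show N.markDist q ≤ r from hq) (le_max_left _ _)

theorem ae_existsUnique_isServing
    (hX : IsPoissonProcess X (ENNReal.ofReal N.lam • volume) μ)
    (hM : IsIndependentMarking X M N.markLaw μ) : ∀ᵐ ω ∂μ, ∃! j, N.IsServing X M ω j := by
  filter_upwards [ae_typical hX hM] with ω ⟨h1, h2, j, hj⟩
  exact ⟨j, (isServing_iff h1 hj j).2 rfl, fun i hi => (isServing_iff h1 hj i).1 hi⟩

theorem ae_summable_interferenceTerm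
    (hX : IsPoissonProcess X (ENNReal.ofReal N.lam • volume) μ)
    (hM : IsIndependentMarking X M N.markLaw μ) (θ : ℝ) :
    ∀ᵐ ω ∂μ, Summable (N.interferenceTerm X M θ ω) := by
  have hs := (hasPoissonPGFL hX hM).ae_summable_tailWeight N.measurable_markDist
    (N.measurable_markWeight θ 1) (fun b hb => N.tailExponent_ne_top zero_le_one hb)
  filter_upwards [ae_typical hX hM, ae_servingDist_pos hX hM, hs] with ω ⟨h1, h2, j, hj⟩ hT hs
  refine (hs _ hT).congr fun i => ?_
  rw [← mul_interferenceTerm_eq h1 hj h2 θ zero_le_one, one_mul]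

lemma ae_interference_nonneg (hX : IsPoissonProcess X (ENNReal.ofReal N.lam • volume) μ)
    (hM : IsIndependentMarking X M N.markLaw μ) (θ : ℝ) :
    ∀ᵐ ω ∂μ, 0 ≤ N.interference X M θ ω := by
  filter_upwards [ae_typical hX hM] with ω ⟨h1, h2, j, hj⟩
  rw [← one_mul (N.interference X M θ ω), mul_interference_eq h1 hj h2 θ zero_le_one]
  exact tailSum_nonneg _ _

/-- The law of the serving distance. -/
theorem map_servingDist (hX : IsPoissonProcess X (ENNReal.ofReal N.lam • volume) μ)
    (hM : IsIndependentMarking X M N.markLaw μ) :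
    μ.map (N.servingDist X M)
      = (volume.restrict (Ioi (0 : ℝ))).withDensity (fun r => ENNReal.ofReal (N.fR r)) := by
  have hT := measurable_servingDist (N := N) hX.measurable hM.measurable
  have : IsProbabilityMeasure (μ.map (N.servingDist X M)) :=
    Measure.isProbabilityMeasure_map hT.aemeasurable
  have key : ∀ a, 0 ≤ a → μ.map (N.servingDist X M) (Ioi a) = (volume.restrict
      (Ioi (0 : ℝ))).withDensity (fun r => ENNReal.ofReal (N.fR r)) (Ioi a) := fun a ha => by
    rw [Measure.map_apply hT measurableSet_Ioi, withDensity_apply _ measurableSet_Ioi,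
      Measure.restrict_restrict measurableSet_Ioi, inter_eq_left.2 (Ioi_subset_Ioi ha),
      N.setLIntegral_fR ha]
    exact (hasPoissonPGFL hX hM).measure_lt_min N.measurable_markDist
      (fun r hr => N.intensity_markDist_le hr) (fun r hr => N.distMean_nonneg hr)
      (ae_servingDist hX hM) ha
  have hneg1 : ∀ B, Ioi 0 ⊆ B → MeasurableSet B →
      μ.map (N.servingDist X M) B = μ.map (N.servingDist X M) (Ioi 0) := fun B hB hBm => by
    rw [Measure.map_apply hT hBm, Measure.map_apply hT measurableSet_Ioi]
    refine measure_congr ?_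
    filter_upwards [ae_servingDist_pos hX hM] with ω hω
    exact propext ⟨fun _ => hω, fun h => hB h⟩
  have hneg2 : ∀ B, Ioi 0 ⊆ B → MeasurableSet B → (volume.restrict (Ioi (0 : ℝ))).withDensity
      (fun r => ENNReal.ofReal (N.fR r)) B = (volume.restrict (Ioi (0 : ℝ))).withDensity
      (fun r => ENNReal.ofReal (N.fR r)) (Ioi 0) := fun B hB hBm => by
    rw [withDensity_apply _ hBm, withDensity_apply _ measurableSet_Ioi,
      Measure.restrict_restrict hBm, Measure.restrict_restrict measurableSet_Ioi,
      inter_eq_right.2 hB, inter_self]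
  refine ext_of_generate_finite _ ((BorelSpace.measurable_eq (α := ℝ)).trans
    (borel_eq_generateFrom_Ioi ℝ)) isPiSystem_Ioi ?_ ?_
  · rintro _ ⟨a, rfl⟩
    rcases le_total 0 a with ha | ha
    · exact key a ha
    · rw [hneg1 _ (Ioi_subset_Ioi ha) measurableSet_Ioi, key 0 le_rfl,
        hneg2 _ (Ioi_subset_Ioi ha) measurableSet_Ioi]
  · rw [hneg1 _ (subset_univ _) .univ, key 0 le_rfl, hneg2 _ (subset_univ _) .univ]

end Probability

end Network

/-! ### Conditional Laplace transform -/

section General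

variable {Ω : Type*} [MeasurableSpace Ω] {μ : Measure Ω}

lemma setLIntegral_preimage_eq_of_Ioi {T : Ω → ℝ} (hT : Measurable T)
    (hpos : ∀ᵐ ω ∂μ, 0 < T ω) {f g : Ω → ℝ≥0∞} (hfin : ∫⁻ ω, f ω ∂μ ≠ ∞)
    (h : ∀ a, 0 ≤ a → ∫⁻ ω in {ω | a < T ω}, f ω ∂μ = ∫⁻ ω in {ω | a < T ω}, g ω ∂μ)
    {A : Set ℝ} (hA : MeasurableSet A) :
    ∫⁻ ω in T ⁻¹' A, f ω ∂μ = ∫⁻ ω in T ⁻¹' A, g ω ∂μ := by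
  have happ : ∀ (k : Ω → ℝ≥0∞) {B : Set ℝ}, MeasurableSet B →
      (μ.withDensity k).map T B = ∫⁻ ω in T ⁻¹' B, k ω ∂μ := fun k B hB => by
    rw [Measure.map_apply hT hB, withDensity_apply _ (hT hB)]
  have hle : ∀ (k : Ω → ℝ≥0∞) {B : Set ℝ}, Ioi 0 ⊆ B →
      ∫⁻ ω in T ⁻¹' B, k ω ∂μ = ∫⁻ ω in {ω | 0 < T ω}, k ω ∂μ := fun k B hB => by
    refine setLIntegral_congr ?_
    filter_upwards [hpos] with ω hω
    exact propext ⟨fun _ => hω, fun h => hB h⟩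
  have : IsFiniteMeasure ((μ.withDensity f).map T) := by
    refine ⟨?_⟩
    rw [happ f .univ, preimage_univ, setLIntegral_univ]
    exact hfin.lt_top
  have hfg : (μ.withDensity f).map T = (μ.withDensity g).map T := by
    refine ext_of_generate_finite _ ((BorelSpace.measurable_eq (α := ℝ)).trans
      (borel_eq_generateFrom_Ioi ℝ)) isPiSystem_Ioi ?_ ?_
    · rintro _ ⟨a, rfl⟩
      rw [happ f measurableSet_Ioi, happ g measurableSet_Ioi]
      rcases le_total 0 a with ha | ha
      · exact h a ha
      · rw [hle f (Ioi_subset_Ioi ha), hle g (Ioi_subset_Ioi ha), h 0 le_rfl]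
    · rw [happ f .univ, happ g .univ, hle f (subset_univ _), hle g (subset_univ _), h 0 le_rfl]
  rw [← happ f hA, ← happ g hA, hfg]

lemma Ioi_subset_integrableExpSet_neg [IsFiniteMeasure μ] {J : Ω → ℝ} (hJm : AEMeasurable J μ)
    (hJ : ∀ᵐ ω ∂μ, 0 ≤ J ω) : Ioi 0 ⊆ integrableExpSet (fun ω => -J ω) μ := fun z hz => by
  refine (integrable_const (1 : ℝ)).mono' (by fun_prop) ?_
  filter_upwards [hJ] with ω hω
  rw [Real.norm_eq_abs, Real.abs_exp, Real.exp_le_one_iff]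
  have hz : 0 < z := hz
  nlinarith [mul_nonneg hz.le hω]

lemma Ioi_subset_interior_integrableExpSet_neg [IsFiniteMeasure μ] {J : Ω → ℝ}
    (hJm : AEMeasurable J μ) (hJ : ∀ᵐ ω ∂μ, 0 ≤ J ω) :
    Ioi 0 ⊆ interior (integrableExpSet (fun ω => -J ω) μ) :=
  interior_maximal (Ioi_subset_integrableExpSet_neg hJm hJ) isOpen_Ioi

end General

namespace Network

variable {Ω : Type*} [MeasurableSpace Ω] {μ : Measure Ω} [IsProbabilityMeasure μ] {N : Network}
  {X : ℕ → Ω → EuclideanSpace ℝ (Fin 2)} {M : ℕ → Ω → LinkMark}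

lemma measurable_exp_tailExponent (θ z : ℝ) : Measurable fun b =>
    Real.exp (-(tailExponent N.intensity N.markDist (N.markWeight θ z) b).toReal) :=
  Real.measurable_exp.comp antitone_tailExponent.measurable.ennreal_toReal.neg

/-- The Laplace transform of the interference, on events determined by the serving distance. -/
lemma setLIntegral_exp_neg_mul_interference
    (hX : IsPoissonProcess X (ENNReal.ofReal N.lam • volume) μ)
    (hM : IsIndependentMarking X M N.markLaw μ) (θ : ℝ) {z : ℝ} (hz : 0 ≤ z) {A : Set ℝ}
    (hA : MeasurableSet A) :
    ∫⁻ ω in N.servingDist X M ⁻¹' A,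
        ENNReal.ofReal (Real.exp (-(z * N.interference X M θ ω))) ∂μ
      = ∫⁻ ω in N.servingDist X M ⁻¹' A,
        ENNReal.ofReal (N.laplace θ (N.servingDist X M ω) z) ∂μ := by
  have hT := measurable_servingDist (N := N) hX.measurable hM.measurable
  have hpos := ae_servingDist_pos hX hM
  refine setLIntegral_preimage_eq_of_Ioi hT hpos ?_ (fun a ha => ?_) hA
  · refine ((lintegral_mono_ae (g := fun _ => 1) ?_).trans_lt ?_).ne
    · filter_upwards [ae_interference_nonneg hX hM θ] with ω hω
      rw [ENNReal.ofReal_le_one, Real.exp_le_one_iff]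
      nlinarith [mul_nonneg hz hω]
    · simp
  · have h := (hasPoissonPGFL hX hM).setLIntegral_exp_tailSum_min N.measurable_markDist
      (N.measurable_markWeight θ z) (fun b hb => N.tailExponent_ne_top hz hb)
      intensity_markDist_le_ne_top hT (ae_servingDist hX hM) ha
    refine Eq.trans (lintegral_congr_ae (ae_restrict_of_ae ?_))
      (h.trans (lintegral_congr_ae (ae_restrict_of_ae ?_)))
    · filter_upwards [ae_typical hX hM] with ω ⟨h1, h2, j, hj⟩
      rw [mul_interference_eq h1 hj h2 θ hz]
    · filter_upwards [hpos] with ω hω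
      rw [N.exp_tailExponent hz hω]

lemma laplace_nonneg (θ ρ z : ℝ) : 0 ≤ N.laplace θ ρ z := by
  unfold laplace; positivity

lemma laplace_le_one (θ : ℝ) {ρ z : ℝ} (hz : 0 ≤ z) (hρ : 0 < ρ) : N.laplace θ ρ z ≤ 1 := by
  rw [← N.exp_tailExponent hz hρ, Real.exp_le_one_iff, neg_nonpos]
  exact ENNReal.toReal_nonneg

/-- Laplace transform of the interference, conditionally on the serving distance. -/
theorem condExp_exp_neg_mul_interference
    (hX : IsPoissonProcess X (ENNReal.ofReal N.lam • volume) μ)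
    (hM : IsIndependentMarking X M N.markLaw μ) (θ : ℝ) {z : ℝ} (hz : 0 ≤ z) :
    μ[fun ω => Real.exp (-(z * N.interference X M θ ω)) |
        MeasurableSpace.comap (N.servingDist X M) inferInstance]
      =ᵐ[μ] fun ω => N.laplace θ (N.servingDist X M ω) z := by
  have hT := measurable_servingDist (N := N) hX.measurable hM.measurable
  have hI := measurable_interference (N := N) hX.measurable hM.measurable θ
  have hpos := ae_servingDist_pos hX hM
  have hg : (fun ω => N.laplace θ (N.servingDist X M ω) z) =ᵐ[μ] fun ω => Real.exp
      (-(tailExponent N.intensity N.markDist (N.markWeight θ z) (N.servingDist X M ω)).toReal) := by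
    filter_upwards [hpos] with ω hω
    rw [N.exp_tailExponent hz hω]
  have hgm := ((measurable_exp_tailExponent (N := N) θ z).comp
    (comap_measurable (N.servingDist X M))).stronglyMeasurable
  have hgm' := ((measurable_exp_tailExponent (N := N) θ z).comp hT).aestronglyMeasurable.congr
    hg.symm (μ := μ)
  have hfm : AEStronglyMeasurable (fun ω => Real.exp (-(z * N.interference X M θ ω))) μ := by
    fun_prop
  refine (ae_eq_condExp_of_forall_setIntegral_eq hT.comap_le ?_ ?_ ?_ ?_).symm
  · refine (integrable_const (1 : ℝ)).mono' hfm ?_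
    filter_upwards [ae_interference_nonneg hX hM θ] with ω hω
    rw [Real.norm_eq_abs, Real.abs_exp, Real.exp_le_one_iff]
    nlinarith [mul_nonneg hz hω]
  · intro A _ _
    refine ((integrable_const (1 : ℝ)).mono' hgm' ?_).integrableOn
    filter_upwards [hpos] with ω hω
    rw [Real.norm_eq_abs, abs_of_nonneg (laplace_nonneg _ _ _)]
    exact laplace_le_one θ hz hω
  · rintro _ ⟨A, hA, rfl⟩ _
    rw [integral_eq_lintegral_of_nonneg_ae (ae_of_all _ fun ω => laplace_nonneg _ _ _)
        hgm'.restrict,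
      integral_eq_lintegral_of_nonneg_ae (ae_of_all _ fun ω => (Real.exp_pos _).le) hfm.restrict,
      setLIntegral_exp_neg_mul_interference hX hM θ hz hA]
  · exact hgm.aestronglyMeasurable.congr hg.symm

lemma markWeight_eq_mul (θ : ℝ) {z : ℝ} (hz : 0 ≤ z)
    (q : EuclideanSpace ℝ (Fin 2) × LinkMark) :
    (N.markWeight θ z q : ℝ) = z * N.markWeight θ 1 q := by
  rw [markWeight, markWeight, Real.toNNReal_mul hz, one_mul, NNReal.coe_mul, Real.coe_toNNReal z hz]

/-- `laplace` is the Laplace transform of the total power received from the base stations that are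
farther than `ρ`. -/
lemma laplace_eq_mgf (hX : IsPoissonProcess X (ENNReal.ofReal N.lam • volume) μ)
    (hM : IsIndependentMarking X M N.markLaw μ) (θ : ℝ) {ρ z : ℝ} (hρ : 0 < ρ) (hz : 0 ≤ z) :
    N.laplace θ ρ z = mgf (fun ω => -tailSum (fun i ω => (X i ω, M i ω)) N.markDist
      (N.markWeight θ 1) ρ ω) μ z := by
  have hT := measurable_servingDist (N := N) hX.measurable hM.measurable
  have hP := hasPoissonPGFL hX hM
  have hpos := ae_servingDist_pos hX hM
  have h := hP.setLIntegral_exp_tailSum N.measurable_markDist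
    (N.measurable_markWeight θ z) (fun b hb => N.tailExponent_ne_top hz hb)
    intensity_markDist_le_ne_top hT (ae_servingDist hX hM) hρ hρ.le
  have hu : {ω | 0 < N.servingDist X M ω} =ᵐ[μ] univ := eventuallyEq_univ.2 hpos
  rw [N.exp_tailExponent hz hρ, measure_congr hu, measure_univ, mul_one, setLIntegral_congr hu,
    setLIntegral_univ] at h
  have hs : ∀ ω, tailSum (fun i ω => (X i ω, M i ω)) N.markDist (N.markWeight θ z) ρ ω
      = z * tailSum (fun i ω => (X i ω, M i ω)) N.markDist (N.markWeight θ 1) ρ ω := fun ω => by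
    rw [tailSum, tailSum, ← tsum_mul_left]
    refine tsum_congr fun i => ?_
    by_cases hi : ρ < N.markDist (X i ω, M i ω) <;>
      simp [tailWeight, hi, markWeight_eq_mul θ hz]
  have hm := measurable_tailSum hP.measurable N.measurable_markDist (N.measurable_markWeight θ 1)
    (measurable_const (a := ρ))
  rw [mgf, integral_eq_lintegral_of_nonneg_ae (ae_of_all _ fun ω => (Real.exp_pos _).le)
    (by fun_prop), ← ENNReal.toReal_ofReal (laplace_nonneg (N := N) θ ρ z), ← h]
  simp_rw [hs, mul_neg]

theorem contDiffOn_laplace (hX : IsPoissonProcess X (ENNReal.ofReal N.lam • volume) μ)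
    (hM : IsIndependentMarking X M N.markLaw μ) (θ : ℝ) {ρ : ℝ} (hρ : 0 < ρ) :
    ContDiffOn ℝ ((⊤ : ℕ∞) : WithTop ℕ∞) (N.laplace θ ρ) (Ioi 0) := by
  have hm := measurable_tailSum (hasPoissonPGFL hX hM).measurable N.measurable_markDist
    (N.measurable_markWeight θ 1) (measurable_const (a := ρ))
  have h := Ioi_subset_interior_integrableExpSet_neg (μ := μ) hm.aemeasurable
    (ae_of_all _ fun ω => tailSum_nonneg ρ ω)
  exact ((analyticOn_mgf.mono h).contDiffOn isOpen_Ioi.uniqueDiffOn).congr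
    fun z hz => laplace_eq_mgf hX hM θ hρ (le_of_lt hz)

end Network

/-! ### Coverage probability -/

lemma exp_mul_sum_iteratedDeriv_eq_integral {κ : Measure ℝ} [IsFiniteMeasure κ]
    (hκ : ∀ᵐ y ∂κ, 0 ≤ y) {L : ℝ → ℝ} (hL : EqOn L (mgf (fun y => -y) κ) (Ioi 0)) {z : ℝ}
    (hz : 0 < z) (σ : ℝ) (n : ℕ) :
    Real.exp (-(z * σ)) * ∑ k ∈ Finset.range n, ∑ l ∈ Finset.range (k + 1),
        ((-1) ^ l * z ^ l * (z * σ) ^ (k - l) / (k.factorial : ℝ) * (k.choose l : ℝ))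
          * iteratedDeriv l L z
      = ∫ y, Real.exp (-(z * (y + σ))) * ∑ k ∈ Finset.range n,
          (z * (y + σ)) ^ k / (k.factorial : ℝ) ∂κ := by
  have hint : z ∈ interior (integrableExpSet (fun y => -y) κ) :=
    Ioi_subset_interior_integrableExpSet_neg (J := fun y => y) aemeasurable_id hκ hz
  have hLz : L =ᶠ[𝓝 z] mgf (fun y => -y) κ := hL.eventuallyEq_of_mem (Ioi_mem_nhds hz)
  have hD : ∀ l, iteratedDeriv l L z = ∫ y, (-y) ^ l * Real.exp (z * -y) ∂κ := fun l => by
    rw [hLz.iteratedDeriv_eq, iteratedDeriv_mgf hint]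
  have hI : ∀ l, Integrable (fun y => (-y) ^ l * Real.exp (z * -y)) κ := fun l =>
    integrable_pow_mul_exp_of_mem_interior_integrableExpSet hint l
  have hpt : ∀ y : ℝ, Real.exp (-(z * (y + σ))) * ∑ k ∈ Finset.range n,
      (z * (y + σ)) ^ k / (k.factorial : ℝ) = Real.exp (-(z * σ)) * ∑ k ∈ Finset.range n,
        ∑ l ∈ Finset.range (k + 1), ((-1) ^ l * z ^ l * (z * σ) ^ (k - l) / (k.factorial : ℝ)
          * (k.choose l : ℝ)) * ((-y) ^ l * Real.exp (z * -y)) := fun y => by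
    rw [show -(z * (y + σ)) = -(z * σ) + z * -y by ring, Real.exp_add, mul_assoc]
    congr 1
    rw [Finset.mul_sum]
    refine Finset.sum_congr rfl fun k _ => ?_
    rw [mul_add, add_pow, Finset.sum_div, Finset.mul_sum]
    refine Finset.sum_congr rfl fun l _ => ?_
    have h1 : ((-1 : ℝ)) ^ l * (-y) ^ l = y ^ l := by rw [← mul_pow]; ring
    rw [mul_pow, ← h1]
    ring
  simp_rw [hpt, hD]
  rw [integral_const_mul, integral_finsetSum _ fun k _ =>
    integrable_finsetSum _ fun l _ => (hI l).const_mul _]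
  congr 1
  refine Finset.sum_congr rfl fun k _ => ?_
  rw [integral_finsetSum _ fun l _ => (hI l).const_mul _]
  exact Finset.sum_congr rfl fun l _ => (integral_const_mul _ _).symm

namespace Network

/-! #### Independence of the fading power of the serving link -/

section Invariance

variable {Ω : Type*} {N : Network} {X : ℕ → Ω → EuclideanSpace ℝ (Fin 2)} {M M' : ℕ → Ω → LinkMark}
  {ω : Ω}

lemma linkGain_congr (h : ∀ i, (M' i ω).1 = (M i ω).1) (i : ℕ) :
    N.linkGain X M' i ω = N.linkGain X M i ω := by
  rw [linkGain, linkGain, h]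

lemma serving_congr (h : ∀ i, (M' i ω).1 = (M i ω).1) : N.serving X M' ω = N.serving X M ω := by
  simp only [serving, IsServing, linkGain_congr h]

lemma servingDist_congr (h : ∀ i, (M' i ω).1 = (M i ω).1) :
    N.servingDist X M' ω = N.servingDist X M ω := by
  simp only [servingDist, eqDist, serving_congr h, h]

lemma interference_congr (h : ∀ i, (M' i ω).1 = (M i ω).1)
    (h' : ∀ i, i ≠ N.serving X M ω → M' i ω = M i ω) (θ : ℝ) :
    N.interference X M' θ ω = N.interference X M θ ω := by
  refine tsum_congr fun i => ?_
  rw [interferenceTerm, interferenceTerm, serving_congr h]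
  split_ifs with hi
  · rfl
  · rw [linkGain_congr h, h' i hi]

end Invariance

/-- The space of positions and marks of all base stations. -/
abbrev Configuration : Type := (ℕ → EuclideanSpace ℝ (Fin 2)) × (ℕ → LinkMark)

section Probability

variable {Ω : Type*} [MeasurableSpace Ω] {μ : Measure Ω} [IsProbabilityMeasure μ] {N : Network}
  {X : ℕ → Ω → EuclideanSpace ℝ (Fin 2)} {M : ℕ → Ω → LinkMark}

lemma measure_serving_inter (hX : ∀ j, Measurable (X j))
    (hM : IsIndependentMarking X M N.markLaw μ) (θ : ℝ) (j : ℕ) {C : Set (ℝ × ℝ)} {B : Set ℝ}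
    (hC : MeasurableSet C) (hB : MeasurableSet B) :
    μ ({ω | N.serving X M ω = j ∧ (N.servingDist X M ω, N.interference X M θ ω) ∈ C}
        ∩ {ω | (M j ω).2.2 ∈ B})
      = μ {ω | N.serving X M ω = j ∧ (N.servingDist X M ω, N.interference X M θ ω) ∈ C}
        * gammaMeasure N.m N.m B := by
  let X' : ℕ → Configuration → EuclideanSpace ℝ (Fin 2) := fun i a => a.1 i
  let M' : ℕ → Configuration → LinkMark := fun i a => a.2 i
  have hX' : ∀ i, Measurable (X' i) := fun i => (measurable_pi_apply i).comp measurable_fst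
  have hM' : ∀ i, Measurable (M' i) := fun i => (measurable_pi_apply i).comp measurable_snd
  let D : Set Configuration :=
    {a | N.serving X' M' a = j ∧ (N.servingDist X' M' a, N.interference X' M' θ a) ∈ C}
  have hD : MeasurableSet D :=
    (measurable_serving hX' hM' (measurableSet_singleton j)).inter
      (((measurable_servingDist hX' hM').prodMk (measurable_interference hX' hM' θ)) hC)
  have hinv : {ω | N.serving X M ω = j ∧ (N.servingDist X M ω, N.interference X M θ ω) ∈ C}
      = {ω | ((fun i => X i ω), Function.update (fun i => M i ω) j (dropFading (M j ω))) ∈ D} := by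
    ext ω
    let M₁ : ℕ → Ω → LinkMark := fun i ω =>
      Function.update (fun i => M i ω) j (dropFading (M j ω)) i
    have h1 : ∀ i, (M₁ i ω).1 = (M i ω).1 := fun i => by
      by_cases hi : i = j
      · subst hi; simp [M₁, dropFading]
      · simp [M₁, hi]
    have h2 : ∀ i, i ≠ j → M₁ i ω = M i ω := fun i hi => by simp [M₁, hi]
    change _ ↔ N.serving X M₁ ω = j ∧ (N.servingDist X M₁ ω, N.interference X M₁ θ ω) ∈ C
    rw [serving_congr h1, servingDist_congr h1]
    refine and_congr_right fun hj => ?_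
    rw [interference_congr h1 (hj ▸ h2)]
  rw [hinv]
  exact hM.measure_update_inter hX measurable_dropFading (φ := fun y : LinkMark => y.2.2)
    (by fun_prop) (fun x S B hS hB => markLaw_inter (N := N) x hS hB) j hD hB

/-- The fading power of the serving link. -/
noncomputable def servingFading (N : Network) (X : ℕ → Ω → EuclideanSpace ℝ (Fin 2))
    (M : ℕ → Ω → LinkMark)
    (ω : Ω) : ℝ :=
  (M (N.serving X M ω) ω).2.2

lemma measurable_servingFading (hX : ∀ j, Measurable (X j)) (hM : ∀ j, Measurable (M j)) :
    Measurable (N.servingFading X M) :=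
  measurable_eval_serving (f := fun j ω => (M j ω).2.2) hX hM fun j =>
    measurable_snd.comp (measurable_snd.comp (hM j))

lemma map_servingFading (hX : ∀ j, Measurable (X j))
    (hM : IsIndependentMarking X M N.markLaw μ) (θ : ℝ) :
    μ.map (fun ω => ((N.servingDist X M ω, N.interference X M θ ω), N.servingFading X M ω))
      = (μ.map fun ω => (N.servingDist X M ω, N.interference X M θ ω)).prod
        (gammaMeasure N.m N.m) := by
  have hS := measurable_serving (N := N) hX hM.measurable
  have hTI := (measurable_servingDist (N := N) hX hM.measurable).prodMk
    (measurable_interference (N := N) hX hM.measurable θ)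
  have hF := measurable_servingFading (N := N) hX hM.measurable
  have : IsProbabilityMeasure (μ.map fun ω => (N.servingDist X M ω, N.interference X M θ ω)) :=
    Measure.isProbabilityMeasure_map hTI.aemeasurable
  refine (Measure.prod_eq fun C B hC hB => ?_).symm
  rw [Measure.map_apply (hTI.prodMk hF) (hC.prod hB), Measure.map_apply hTI hC]
  let A : ℕ → Set Ω := fun j =>
    {ω | N.serving X M ω = j ∧ (N.servingDist X M ω, N.interference X M θ ω) ∈ C}
  have hA : ∀ j, MeasurableSet (A j) := fun j => (hS (measurableSet_singleton j)).inter (hTI hC)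
  have hAB : ∀ j, MeasurableSet (A j ∩ {ω | (M j ω).2.2 ∈ B}) := fun j =>
    (hA j).inter ((measurable_snd.comp (measurable_snd.comp (hM.measurable j))) hB)
  have hd : Pairwise (Function.onFun Disjoint A) := fun i j hij =>
    disjoint_left.2 fun ω hi hj => hij (hi.1.symm.trans hj.1)
  have e1 : (fun ω => (N.servingDist X M ω, N.interference X M θ ω)) ⁻¹' C = ⋃ j, A j := by
    ext ω; simp [A]
  have e2 : (fun ω => ((N.servingDist X M ω, N.interference X M θ ω), N.servingFading X M ω))
      ⁻¹' (C ×ˢ B) = ⋃ j, (A j ∩ {ω | (M j ω).2.2 ∈ B}) := by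
    ext ω; simp [A, servingFading, and_assoc]
  rw [e1, e2, measure_iUnion hd hA, measure_iUnion (fun i j hij => (hd hij).mono
    inter_subset_left inter_subset_left) hAB, ← ENNReal.tsum_mul_right]
  exact tsum_congr fun j => measure_serving_inter hX hM θ j hC hB

/-! #### The conditional law of the interference -/

lemma ae_condDistrib_interference (hX : IsPoissonProcess X (ENNReal.ofReal N.lam • volume) μ)
    (hM : IsIndependentMarking X M N.markLaw μ) (θ : ℝ) :
    ∀ᵐ ρ ∂μ.map (N.servingDist X M), 0 < ρ ∧
      (∀ᵐ y ∂condDistrib (N.interference X M θ) (N.servingDist X M) μ ρ, 0 ≤ y) ∧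
      EqOn (N.laplace θ ρ) (mgf (fun y => -y)
        (condDistrib (N.interference X M θ) (N.servingDist X M) μ ρ)) (Ioi 0) := by
  have hT := measurable_servingDist (N := N) hX.measurable hM.measurable
  have hI := measurable_interference (N := N) hX.measurable hM.measurable θ
  set κ := condDistrib (N.interference X M θ) (N.servingDist X M) μ
  have hpos : ∀ᵐ ρ ∂μ.map (N.servingDist X M), 0 < ρ :=
    (ae_map_iff hT.aemeasurable measurableSet_Ioi).2 (ae_servingDist_pos hX hM)
  have hnn : ∀ᵐ ρ ∂μ.map (N.servingDist X M), ∀ᵐ y ∂κ ρ, 0 ≤ y := by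
    refine Measure.ae_ae_of_ae_compProd (p := fun q : ℝ × ℝ => 0 ≤ q.2) ?_
    rw [compProd_map_condDistrib hI.aemeasurable]
    exact (ae_map_iff (hT.prodMk hI).aemeasurable (measurable_snd measurableSet_Ici)).2
      (ae_interference_nonneg hX hM θ)
  have hlap : ∀ᵐ ρ ∂μ.map (N.servingDist X M), ∀ q : ℚ, 0 ≤ q →
      mgf (fun y => -y) (κ ρ) q = Real.exp
        (-(tailExponent N.intensity N.markDist (N.markWeight θ q) ρ).toReal) := by
    refine ae_all_iff.2 fun q => ?_
    by_cases hq : 0 ≤ q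
    swap
    · exact ae_of_all _ fun _ h => absurd h hq
    have hz : (0 : ℝ) ≤ q := by exact_mod_cast hq
    have hsm : StronglyMeasurable fun p : ℝ × ℝ => Real.exp (q * -p.2) :=
      Measurable.stronglyMeasurable (by fun_prop)
    have hm : Measurable fun ρ => mgf (fun y => -y) (κ ρ) q :=
      (hsm.integral_condDistrib (X := N.servingDist X M) (Y := N.interference X M θ)
        (μ := μ)).measurable
    have hint : Integrable (fun ω => Real.exp (q * -N.interference X M θ ω)) μ := by
      refine (integrable_const (1 : ℝ)).mono' (by fun_prop) ?_
      filter_upwards [ae_interference_nonneg hX hM θ] with ω hω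
      rw [Real.norm_eq_abs, Real.abs_exp, Real.exp_le_one_iff]
      nlinarith [mul_nonneg hz hω]
    suffices h : ∀ᵐ ρ ∂μ.map (N.servingDist X M), mgf (fun y => -y) (κ ρ) q = Real.exp
        (-(tailExponent N.intensity N.markDist (N.markWeight θ q) ρ).toReal) from
      h.mono fun _ h _ => h
    refine (ae_map_iff hT.aemeasurable (measurableSet_eq_fun hm
      (measurable_exp_tailExponent (N := N) θ q))).2 ?_
    have hsm' : StronglyMeasurable fun y : ℝ => Real.exp (q * -y) :=
      Measurable.stronglyMeasurable (by fun_prop)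
    filter_upwards [condExp_exp_neg_mul_interference hX hM θ hz, ae_servingDist_pos hX hM,
      condExp_ae_eq_integral_condDistrib hT hI.aemeasurable hsm' hint] with ω h1 h2 h3
    rw [N.exp_tailExponent hz h2, ← h1, mgf, ← h3]
    simp only [mul_neg]
  filter_upwards [hpos, hnn, hlap] with ρ h1 h2 h3
  refine ⟨h1, h2, EqOn.of_subset_closure (s := Ioi 0 ∩ range ((↑) : ℚ → ℝ)) ?_
    (contDiffOn_laplace hX hM θ h1).continuousOn ?_ inter_subset_left
    (Dense.open_subset_closure_inter Rat.denseRange_cast isOpen_Ioi)⟩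
  · rintro _ ⟨hq, q, rfl⟩
    have hq' : (0 : ℝ) ≤ q := le_of_lt hq
    rw [h3 q (by exact_mod_cast hq'), N.exp_tailExponent hq' h1]
  · exact analyticOn_mgf.continuousOn.mono
      (Ioi_subset_interior_integrableExpSet_neg (J := fun y => y) aemeasurable_id h2)

end Probability

end Network

namespace Network

/-! #### The coverage probability -/

section Parameters

variable {N : Network}

lemma D0_pos : 0 < N.D0 := mul_pos N.Mt_pos N.Mr_pos

lemma s_pos (θ : ℝ) {γ ρ : ℝ} (hγ : 0 < γ) (hρ : 0 < ρ) : 0 < N.s θ γ ρ := by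
  have h1 := N.Pm_pos
  have h2 := N.CL_pos
  have h3 := D0_pos (N := N)
  have h4 := N.G_pos ρ θ
  unfold s; positivity

lemma measurable_s (θ γ : ℝ) : Measurable (N.s θ γ) := by
  have := N.measurable_G θ
  unfold s; fun_prop

end Parameters

lemma lt_sinr_iff {Ω : Type*} {N : Network}
    {X : ℕ → Ω → EuclideanSpace ℝ (Fin 2)} {M : ℕ → Ω → LinkMark} (θ : ℝ) {γ : ℝ} {ω : Ω}
    (hT : 0 < N.servingDist X M ω)
    (hI : 0 ≤ N.interference X M θ ω) :
    γ < N.sinr X M θ ω ↔ N.s θ γ (N.servingDist X M ω) * (N.interference X M θ ω + N.noise)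
      < N.servingFading X M ω := by
  have h1 := N.Pm_pos
  have h2 := N.CL_pos
  have h3 := D0_pos (N := N)
  have h4 := N.G_pos (N.servingDist X M ω) θ
  have h5 := Real.rpow_pos_of_pos hT N.αL
  have hL : N.linkGain X M (N.serving X M ω) ω
      = N.CL * (N.servingDist X M ω ^ N.αL)⁻¹ := by
    rw [← Real.rpow_neg hT.le]
    exact N.pathGain_eq_markDist (X (N.serving X M ω) ω, M (N.serving X M ω) ω)
  rw [sinr, lt_div_iff₀ (add_pos_of_nonneg_of_pos hI N.noise_pos), hL, s, div_mul_eq_mul_div,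
    div_lt_iff₀ (by positivity), servingFading,
    ← mul_lt_mul_iff_left₀ (inv_pos.2 h5)]
  field_simp

section Probability

variable {Ω : Type*} [MeasurableSpace Ω] {μ : Measure Ω} [IsProbabilityMeasure μ] {N : Network}
  {X : ℕ → Ω → EuclideanSpace ℝ (Fin 2)} {M : ℕ → Ω → LinkMark}

/-- Probability that the fading power of the serving link suffices, given the serving distance `ρ`
and the interference `y`. -/
noncomputable def fadingCoverage (N : Network) (θ γ : ℝ) (q : ℝ × ℝ) : ℝ≥0∞ :=
  gammaMeasure N.m N.m (Ioi (N.s θ γ q.1 * (q.2 + N.noise)))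

lemma measurable_fadingCoverage (θ γ : ℝ) : Measurable (N.fadingCoverage θ γ) := by
  have h : Antitone fun y : ℝ => gammaMeasure N.m N.m (Ioi y) := fun a b hab =>
    measure_mono (Ioi_subset_Ioi hab)
  have hs := N.measurable_s θ γ
  exact h.measurable.comp (by fun_prop)

lemma fadingCoverage_le_one (θ γ : ℝ) (q : ℝ × ℝ) : N.fadingCoverage θ γ q ≤ 1 := prob_le_one

lemma measure_lt_sinr (hX : IsPoissonProcess X (ENNReal.ofReal N.lam • volume) μ)
    (hM : IsIndependentMarking X M N.markLaw μ) (θ γ : ℝ) :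
    μ {ω | γ < N.sinr X M θ ω} = ∫⁻ ρ, ∫⁻ y, N.fadingCoverage θ γ (ρ, y)
      ∂condDistrib (N.interference X M θ) (N.servingDist X M) μ ρ ∂μ.map (N.servingDist X M) := by
  have hT := measurable_servingDist (N := N) hX.measurable hM.measurable
  have hI := measurable_interference (N := N) hX.measurable hM.measurable θ
  have hF := measurable_servingFading (N := N) hX.measurable hM.measurable
  have hs := N.measurable_s θ γ
  have hD : MeasurableSet {p : (ℝ × ℝ) × ℝ | N.s θ γ p.1.1 * (p.1.2 + N.noise) < p.2} :=
    measurableSet_lt (by fun_prop) (by fun_prop)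
  have h : {ω | γ < N.sinr X M θ ω} =ᵐ[μ] (fun ω => ((N.servingDist X M ω,
      N.interference X M θ ω), N.servingFading X M ω)) ⁻¹'
      {p : (ℝ × ℝ) × ℝ | N.s θ γ p.1.1 * (p.1.2 + N.noise) < p.2} := by
    filter_upwards [ae_servingDist_pos hX hM, ae_interference_nonneg hX hM θ] with ω h1 h2
    exact propext (lt_sinr_iff θ h1 h2)
  rw [measure_congr h, ← Measure.map_apply ((hT.prodMk hI).prodMk hF) hD,
    map_servingFading hX.measurable hM θ, Measure.prod_apply hD,
    ← Measure.lintegral_compProd (N.measurable_fadingCoverage θ γ),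
    compProd_map_condDistrib hI.aemeasurable]
  rfl

lemma coverageIntegrand_eq (θ : ℝ) {γ ρ : ℝ} (hγ : 0 < γ) (hρ : 0 < ρ) {κ : Measure ℝ}
    [IsFiniteMeasure κ] (hκ : ∀ᵐ y ∂κ, 0 ≤ y)
    (hL : EqOn (N.laplace θ ρ) (mgf (fun y => -y) κ) (Ioi 0)) :
    N.coverageIntegrand θ γ ρ = (∫⁻ y, N.fadingCoverage θ γ (ρ, y) ∂κ).toReal * N.fR ρ := by
  have hs := N.s_pos θ hγ hρ
  have hz : 0 < N.m * N.s θ γ ρ := mul_pos N.m_pos' hs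
  have h := exp_mul_sum_iteratedDeriv_eq_integral hκ hL hz N.noise N.m
  simp only [coverageIntegrand, coeff]
  rw [h, integral_eq_lintegral_of_nonneg_ae]
  · congr 2
    refine lintegral_congr_ae ?_
    filter_upwards [hκ] with y hy
    rw [fadingCoverage, gammaMeasure_Ioi N.m_pos N.m_pos'
      (mul_nonneg hs.le (add_nonneg hy N.noise_pos.le))]
    simp only [mul_assoc]
  · filter_upwards [hκ] with y hy
    have := N.noise_pos
    simp only [Pi.zero_apply]
    positivity
  · exact (Measurable.aestronglyMeasurable (by fun_prop))

lemma integrableOn_fR : IntegrableOn N.fR (Ioi 0) := by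
  refine ⟨N.measurable_fR.aestronglyMeasurable, ?_⟩
  rw [hasFiniteIntegral_iff_ofReal ((ae_restrict_iff' measurableSet_Ioi).2
    (ae_of_all _ fun r hr => N.fR_nonneg (le_of_lt hr))), N.setLIntegral_fR le_rfl]
  exact ENNReal.ofReal_lt_top

theorem coverage (hX : IsPoissonProcess X (ENNReal.ofReal N.lam • volume) μ)
    (hM : IsIndependentMarking X M N.markLaw μ) (θ : ℝ) {γ : ℝ} (hγ : 0 < γ) :
    IntegrableOn (N.coverageIntegrand θ γ) (Ioi 0) ∧
      μ.real {ω | γ < N.sinr X M θ ω} = ∫ ρ in Ioi 0, N.coverageIntegrand θ γ ρ := by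
  set κ := condDistrib (N.interference X M θ) (N.servingDist X M) μ
  set K : ℝ → ℝ≥0∞ := fun ρ => ∫⁻ y, N.fadingCoverage θ γ (ρ, y) ∂κ ρ
  have hK : Measurable K := (N.measurable_fadingCoverage θ γ).lintegral_kernel_prod_right'
  have hK1 : ∀ ρ, K ρ ≤ 1 := fun ρ => by
    refine (lintegral_mono (g := fun _ => 1) fun y => fadingCoverage_le_one θ γ _).trans ?_
    simp
  have hfR := N.measurable_fR
  have hae : N.coverageIntegrand θ γ =ᵐ[volume.restrict (Ioi 0)]
      fun ρ => (K ρ).toReal * N.fR ρ := by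
    have h := ae_condDistrib_interference hX hM θ
    rw [map_servingDist hX hM, ae_withDensity_iff hfR.ennreal_ofReal] at h
    filter_upwards [h, ae_restrict_mem measurableSet_Ioi] with ρ h1 h2
    by_cases h0 : N.fR ρ = 0
    · simp [coverageIntegrand, h0]
    · have h3 := h1 (by
        rw [Ne, ENNReal.ofReal_eq_zero, not_le]
        exact lt_of_le_of_ne (N.fR_nonneg (le_of_lt h2)) (Ne.symm h0))
      exact coverageIntegrand_eq θ hγ h2 h3.2.1 h3.2.2
  have hm : AEStronglyMeasurable (fun ρ => (K ρ).toReal * N.fR ρ) (volume.restrict (Ioi 0)) :=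
    (hK.ennreal_toReal.mul hfR).aestronglyMeasurable
  constructor
  · refine Integrable.congr ((integrableOn_fR (N := N)).mono' hm ?_) hae.symm
    filter_upwards [ae_restrict_mem measurableSet_Ioi] with ρ hρ
    have hf := N.fR_nonneg (le_of_lt hρ)
    rw [Real.norm_eq_abs, abs_of_nonneg (mul_nonneg ENNReal.toReal_nonneg hf)]
    exact mul_le_of_le_one_left hf
      (ENNReal.toReal_le_of_le_ofReal zero_le_one (by simpa using hK1 ρ))
  · rw [integral_congr_ae hae, integral_eq_lintegral_of_nonneg_ae _ hm, measureReal_def,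
      measure_lt_sinr hX hM, map_servingDist hX hM,
      lintegral_withDensity_eq_lintegral_mul _ hfR.ennreal_ofReal hK]
    · congr 1
      refine setLIntegral_congr_fun measurableSet_Ioi fun ρ hρ => ?_
      simp only [Pi.mul_apply]
      rw [ENNReal.ofReal_mul ENNReal.toReal_nonneg,
        ENNReal.ofReal_toReal ((hK1 ρ).trans_lt ENNReal.one_lt_top).ne, mul_comm]
    · filter_upwards [ae_restrict_mem measurableSet_Ioi] with ρ hρ
      exact mul_nonneg ENNReal.toReal_nonneg (N.fR_nonneg (le_of_lt hρ))

end Probability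

end Network

theorem theorem1 {Ω : Type*} [MeasurableSpace Ω] (μ : Measure Ω) [IsProbabilityMeasure μ]
    (N : Network) (X : ℕ → Ω → EuclideanSpace ℝ (Fin 2)) (M : ℕ → Ω → LinkMark)
    (hX : IsPoissonProcess X (ENNReal.ofReal N.lam • volume) μ)
    (hM : IsIndependentMarking X M N.markLaw μ)
    (θ : ℝ) (hθ : 0 ≤ θ) (γ : ℝ) (hγ : 0 < γ) :
    -- almost surely the serving base station is well defined and the interference is finite
    (∀ᵐ ω ∂μ, ∃! j, N.IsServing X M ω j) ∧
    (∀ᵐ ω ∂μ, Summable (N.interferenceTerm X M θ ω)) ∧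
    -- the serving distance has density `fR` on `(0, ∞)`
    (μ.map (N.servingDist X M) =
      (volume.restrict (Ioi (0 : ℝ))).withDensity (fun r => ENNReal.ofReal (N.fR r))) ∧
    -- the integrals and derivatives in the explicit expressions exist
    (∀ ρ, 0 < ρ → ∀ z, 0 ≤ z → ∀ i,
      IntegrableOn (fun x => N.FL θ z x (N.d i) * x * N.PL x) (Ioi ρ) ∧
      IntegrableOn (fun x => N.FN θ z x (N.d i) * x * N.PN x) (Ioi (N.ReqInv ρ))) ∧
    (∀ ρ, 0 < ρ → ContDiffOn ℝ ((⊤ : ℕ∞) : WithTop ℕ∞) (N.laplace θ ρ) (Ioi 0)) ∧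
    -- Laplace transform of the interference, conditionally on the serving distance
    (∀ z, 0 ≤ z →
      μ[fun ω => Real.exp (-(z * N.interference X M θ ω)) |
          MeasurableSpace.comap (N.servingDist X M) inferInstance]
        =ᵐ[μ] fun ω => N.laplace θ (N.servingDist X M ω) z) ∧
    -- the coverage probability
    IntegrableOn (N.coverageIntegrand θ γ) (Ioi 0) ∧
    μ.real {ω | γ < N.sinr X M θ ω} = ∫ ρ in Ioi 0, N.coverageIntegrand θ γ ρ :=
  ⟨Network.ae_existsUnique_isServing hX hM, Network.ae_summable_interferenceTerm hX hM θ,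
    Network.map_servingDist hX hM,
    fun _ hρ _ hz i => ⟨N.integrableOn_FL hz hρ i, N.integrableOn_FN hz (N.ReqInv_pos hρ) i⟩,
    fun _ hρ => Network.contDiffOn_laplace hX hM θ hρ,
    fun _ hz => Network.condExp_exp_neg_mul_interference hX hM θ hz,
    Network.coverage hX hM θ hγ⟩
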